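/- **Notation.** For bijections $\phi_1,\dots,\phi_d$ of a metric manifold $M$, let $\Phi=\tau\ltimes(\phi_1,\dots,\phi_d)$ be the one-step skew-product $\Phi(\xi,x)=(\tau\xi,\phi_{\xi_0}(x))$ on $\Sigma\times M$, where $\Sigma=\{1,\dots,d\}^{\mathbb Z}$ and $\tau$ is the shift. Fix $0<\nu<1$ and $\alpha>0$. We say that $\Phi$ is *partially hyperbolic* if there are $\gamma,\hat\gamma\in(\nu^\alpha,1)$ with $\gamma\, d(x,y)\le d(\phi_i(x),\phi_i(y))\le\hat\gamma^{-1}d(x,y)$ for all $i,x,y$, and *fibre bunched* if moreover $\gamma\hat\gamma>\nu^\alpha$ for some such $\gamma,\hat\gamma$. A compact $\Phi$-invariant set $\Gamma\subset\Sigma\times M$ is *hyperbolic* if over $\Gamma$ the tangent spaces of the fibre $M$ split as $E^s\oplus E^u$, where $E^s,E^u$ have constant dimension, are invariant under the differentials of the fibre maps, and are uniformly exponentially contracted, respectively expanded, by them; $\dim E^s$ is its $cs$-index and $\dim E^u$ its $cu$-index. Let $B\neq\emptyset$ and $D$ be bounded open subsets of $M$ with $\overline B\subset D$. Then $B$ is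 a *$cs$-blending region* (resp. *$cu$-blending region*) *of $cs$-index $k$ with respect to $\{\phi_1,\dots,\phi_d\}$ on $D$* if $\Phi$ is partially hyperbolic, the maximal invariant set $\Gamma=\bigcap_{n\in\mathbb Z}\Phi^n(\Sigma\times\overline D)$ is contained in $\Sigma\times D$, is transitive (it has a dense forward orbit) and is hyperbolic of $cs$-index $k$, and $\overline B\subset\bigcup_i\phi_i(B)$ and the $cs$-index of $\Gamma$ is positive (resp. $\overline B\subset\bigcup_i\phi_i^{-1}(B)$ and the $cu$-index of $\Gamma$ is positive). Let $G(\ell,c)$ be the Grassmannian of $\ell$-planes of $\mathbb R^c$ with the metric $d(E,F)=\|P_E-P_F\|$ ($P_E$ the orthogonal projection onto $E$), and let $\hat M=\mathbb R^c\times G(\ell,c)$ carry the maximum metric. A diffeomorphism $\phi$ of $\mathbb R^c$ induces $\hat\phi(x,E)=(\phi(x),D\phi(x)E)$ on $\hat M$. An *$\ell$-cone* is a set $C=\{u+w: u\in E,\ w\in F,\ \|w\|\le a\|u\|\}$ with $\mathbb R^c=E\oplus F$, $\dim E=\ell$, $a>0$. It is *unstable on $B$* for $\{\phi_i\}$ if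 there is $\sigma>1$ such that, whenever $x\in B$, $\phi_i(x)\in B$ and $0\ne v\in C$, one has $D\phi_i(x)v\in\operatorname{int}C$ and $\|D\phi_i(x)v\|\ge\sigma\|v\|$; it is *stable on $B$* if it is unstable on $B$ for $\{\phi_i^{-1}\}$. A $cs$-blending (resp. $cu$-blending) region $B\subset\mathbb R^c$ with respect to $\{\phi_i\}$ *has the $\ell$-tangency $\hat B$* if $\hat B\subset\hat M$ is a $cs$-blending (resp. $cu$-blending) region, of some $cs$-index, with respect to $\{\hat\phi_1,\dots,\hat\phi_d\}$ on some $\hat D\subset\hat M$, and there is an unstable (resp. stable) $\ell$-cone $C$ on $B$ for $\{\phi_i\}$ such that $x\in B$ and $E\subset C$ for all $(x,E)\in\hat B$. **Proposition.** For every integer $c\ge0$ there is an integer $d=d(c)\ge2$ such that the following holds for all integers $i_1,i_2,\ell$ with $0<i_1,i_2<c$ and $\max\{0,i_2-i_1\}<\ell\le\min\{c-i_1,i_2\}$ (there are none if $c\le1$), all $r\in\{2,3,\dots\}\cup\{\infty\}$, all $\nu\in(0,1)$, $\alpha>0$ and all $x\in\mathbb R^c$. There are arcs of $C^r$-diffeomorphisms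 $\phi_1(\varepsilon),\dots,\phi_d(\varepsilon)$ of $\mathbb R^c$, $\varepsilon\ge0$, continuous in $\varepsilon$ for the topology of uniform convergence on compact sets of all derivatives of order at most $r$, with $\phi_i(0)=\mathrm{id}$ for all $i$, such that for every $\varepsilon>0$ the skew-product $\tau\ltimes(\phi_1(\varepsilon),\dots,\phi_d(\varepsilon))$ is partially hyperbolic and fibre bunched, and there are sets $B_1,B_2$ and $D_1,D_2\subset\{y:\|y-x\|<2\varepsilon\}$ in $\mathbb R^c$ and sets $\hat B_1,\hat B_2\subset\mathbb R^c\times G(\ell,c)$ such that, with respect to $\{\phi_1(\varepsilon),\dots,\phi_d(\varepsilon)\}$, - $B_1$ is a $cs$-blending region on $D_1$ of $cs$-index $i_1$ and has the $\ell$-tangency $\hat B_1$; - $B_2$ is a $cu$-blending region on $D_2$ of $cs$-index $i_2$ and has the $\ell$-tangency $\hat B_2$; - the semigroup $\langle\hat\phi_1,\dots,\hat\phi_d\rangle^+$ has a transition from $\hat B_1$ to $\hat B_2$: there are $z\in\hat B_1$ and $T$ in this semigroup with $T(z)\in\hat B_2$. -/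

import Mathlib

open Set Metric Topology
open scoped NNReal Manifold

/-! ## One-step skew-products over the full shift -/

/-- The shift `(τ ξ)_i = ξ_{i+1}` on bi-infinite sequences in `d` symbols. -/
def shiftPerm (d : ℕ) : Equiv.Perm (ℤ → Fin d) where
  toFun ξ := fun i => ξ (i + 1)
  invFun ξ := fun i => ξ (i - 1)
  left_inv ξ := by funext i; simp
  right_inv ξ := by funext i; simp

/-- The one-step skew-product `Φ(ξ, x) = (τ ξ, φ_{ξ_0}(x))`. -/
def skewProduct {d : ℕ} {M : Type*} (φ : Fin d → Equiv.Perm M) :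
    Equiv.Perm ((ℤ → Fin d) × M) where
  toFun z := (shiftPerm d z.1, φ (z.1 0) z.2)
  invFun z := ((shiftPerm d).symm z.1, (φ (z.1 (-1))).symm z.2)
  left_inv z := by
    refine Prod.ext ?_ ?_ <;> simp [shiftPerm]
  right_inv z := by
    refine Prod.ext ?_ ?_ <;> simp [shiftPerm]

/-- All fibre maps are bi-Lipschitz with constants `γ` and `γ'⁻¹`, where
`ν ^ α < γ < 1 < γ'⁻¹ < ν ^ (-α)`. Here `ν` is the base of the metric of the sequence space and
`α` is the Hölder exponent; the Hölder dependence of the fibre maps on the sequence is automatic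
for one-step maps. -/
def HasPHBounds {d : ℕ} {M : Type*} [MetricSpace M] (ν α γ γ' : ℝ)
    (φ : Fin d → Equiv.Perm M) : Prop :=
  ν ^ α < γ ∧ γ < 1 ∧ ν ^ α < γ' ∧ γ' < 1 ∧
    ∀ i x y, γ * dist x y ≤ dist (φ i x) (φ i y) ∧ dist (φ i x) (φ i y) ≤ γ'⁻¹ * dist x y

/-- The one-step skew-product of `φ` is partially hyperbolic (it lies in `PHS(M)`). -/
def IsPHS {d : ℕ} {M : Type*} [MetricSpace M] (ν α : ℝ) (φ : Fin d → Equiv.Perm M) : Prop :=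
  ∃ γ γ' : ℝ, HasPHBounds ν α γ γ' φ

/-- The one-step skew-product of `φ` lies in `PHS(M)` and is fibre bunched. -/
def IsFiberBunched {d : ℕ} {M : Type*} [MetricSpace M] (ν α : ℝ)
    (φ : Fin d → Equiv.Perm M) : Prop :=
  ∃ γ γ' : ℝ, HasPHBounds ν α γ γ' φ ∧ ν ^ α < γ * γ'

/-! ## Hyperbolic sets

The fibre space `M` is a submanifold of a normed space `V` through an embedding `e : M → V`. -/

/-- The tangent space of `M` at `x`, as the set of velocities of curves in `M` through `x`. -/
def tangentSet {M V : Type*} [NormedAddCommGroup V] [NormedSpace ℝ V] (e : M → V) (x : M) :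
    Set V :=
  {v | ∃ g : ℝ → M, g 0 = x ∧ HasDerivAt (fun t => e (g t)) v 0}

/-- `f : M → M` is differentiable at `x`, and its differential is the restriction of `A` to the
tangent space of `M` at `x`. -/
def HasTangentMapAt {M V : Type*} [NormedAddCommGroup V] [NormedSpace ℝ V] (e : M → V)
    (f : M → M) (A : V →L[ℝ] V) (x : M) : Prop :=
  ∀ (g : ℝ → M) (v : V), g 0 = x → HasDerivAt (fun t => e (g t)) v 0 →
    HasDerivAt (fun t => e (f (g t))) (A v) 0

/-- The cocycle `A(Φ^{n-1} z) ∘ ⋯ ∘ A(Φ z) ∘ A(z)`. -/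
def cocycle {X V : Type*} [NormedAddCommGroup V] [NormedSpace ℝ V] (Φ : X → X)
    (A : X → V →L[ℝ] V) : ℕ → X → V →L[ℝ] V
  | 0, _ => ContinuousLinearMap.id ℝ V
  | n + 1, z => (cocycle Φ A n (Φ z)).comp (A z)

/-- `Γ` is a compact invariant set of the skew-product on which the fibre tangent bundle splits
into a uniformly contracting invariant part of dimension `k` (the `cs`-index) and a uniformly
expanding invariant part of dimension `m` (the `cu`-index). -/
def IsHyperbolicSet {d : ℕ} {M V : Type*} [MetricSpace M] [NormedAddCommGroup V]
    [NormedSpace ℝ V] (e : M → V) (φ : Fin d → Equiv.Perm M) (Γ : Set ((ℤ → Fin d) × M))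
    (k m : ℕ) : Prop :=
  IsCompact Γ ∧ skewProduct φ '' Γ = Γ ∧
  ∃ (A : (ℤ → Fin d) × M → V →L[ℝ] V) (Es Eu : (ℤ → Fin d) × M → Submodule ℝ V) (K ρ : ℝ),
    0 < K ∧ 0 < ρ ∧ ρ < 1 ∧ ∀ z ∈ Γ,
      HasTangentMapAt e (φ (z.1 0)) (A z) z.2 ∧
      ((Es z ⊔ Eu z : Submodule ℝ V) : Set V) = tangentSet e z.2 ∧
      Disjoint (Es z) (Eu z) ∧
      Module.Finite ℝ (Es z) ∧ Module.finrank ℝ (Es z) = k ∧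
      Module.Finite ℝ (Eu z) ∧ Module.finrank ℝ (Eu z) = m ∧
      (Es z).map (A z : V →ₗ[ℝ] V) = Es (skewProduct φ z) ∧
      (Eu z).map (A z : V →ₗ[ℝ] V) = Eu (skewProduct φ z) ∧
      ∀ n : ℕ,
        (∀ v ∈ Es z, ‖cocycle (skewProduct φ) A n z v‖ ≤ K * ρ ^ n * ‖v‖) ∧
        (∀ v ∈ Eu z, ‖v‖ ≤ K * ρ ^ n * ‖cocycle (skewProduct φ) A n z v‖)

/-- `Γ` has a dense forward orbit (in particular, it is not empty). -/
def IsTransitiveSet {X : Type*} [TopologicalSpace X] (Φ : Equiv.Perm X) (Γ : Set X) : Prop :=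
  ∃ z ∈ Γ, Γ ⊆ closure (range fun n : ℕ => (Φ ^ n) z)

/-! ## Blending regions -/

/-- The maximal invariant set of the skew-product in `Σ × closure D`. -/
def maxInvariantSet {d : ℕ} {M : Type*} [MetricSpace M] (φ : Fin d → Equiv.Perm M) (D : Set M) :
    Set ((ℤ → Fin d) × M) :=
  ⋂ n : ℤ, (skewProduct φ ^ n) '' (univ ×ˢ closure D)

/-- The part of the definition of a blending region that `cs`- and `cu`-blending regions share:
the skew-product is in `PHS(M)`, the sets `B`, `D` are bounded and open with `closure B ⊆ D`, and
the maximal invariant set in `Σ × closure D` is an isolated transitive hyperbolic set of `cs`-index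
`k` and `cu`-index `m`. -/
def IsBlendingFrame {d : ℕ} {M V : Type*} [MetricSpace M] [NormedAddCommGroup V]
    [NormedSpace ℝ V] (ν α : ℝ) (e : M → V) (φ : Fin d → Equiv.Perm M) (B D : Set M)
    (k m : ℕ) : Prop :=
  IsPHS ν α φ ∧
  IsOpen B ∧ B.Nonempty ∧ Bornology.IsBounded B ∧
  IsOpen D ∧ Bornology.IsBounded D ∧ closure B ⊆ D ∧
  IsHyperbolicSet e φ (maxInvariantSet φ D) k m ∧
  IsTransitiveSet (skewProduct φ) (maxInvariantSet φ D) ∧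
  maxInvariantSet φ D ⊆ univ ×ˢ D

/-- `B` is a `cs`-blending region of `cs`-index `k` with respect to the family `φ` on `D`. -/
def IsCsBlendingRegion {d : ℕ} {M V : Type*} [MetricSpace M] [NormedAddCommGroup V]
    [NormedSpace ℝ V] (ν α : ℝ) (e : M → V) (φ : Fin d → Equiv.Perm M) (B D : Set M)
    (k : ℕ) : Prop :=
  ∃ m : ℕ, IsBlendingFrame ν α e φ B D k m ∧ 0 < k ∧ closure B ⊆ ⋃ i, φ i '' B

/-- `B` is a `cu`-blending region of `cs`-index `k` with respect to the family `φ` on `D`. -/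
def IsCuBlendingRegion {d : ℕ} {M V : Type*} [MetricSpace M] [NormedAddCommGroup V]
    [NormedSpace ℝ V] (ν α : ℝ) (e : M → V) (φ : Fin d → Equiv.Perm M) (B D : Set M)
    (k : ℕ) : Prop :=
  ∃ m : ℕ, IsBlendingFrame ν α e φ B D k m ∧ 0 < m ∧ closure B ⊆ ⋃ i, (φ i).symm '' B

/-- The semigroup generated by the family `φ` has a transition from `A₁` to `A₂`. -/
def HasTransition {d : ℕ} {M : Type*} (φ : Fin d → Equiv.Perm M) (A₁ A₂ : Set M) : Prop :=
  ∃ x ∈ A₁, ∃ T ∈ Subsemigroup.closure (range φ), T x ∈ A₂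

/-! ## The Grassmannian and the induced maps -/

/-- The Euclidean space of dimension `c`. -/
abbrev Euc (c : ℕ) : Type := EuclideanSpace ℝ (Fin c)

/-- `C^r`-diffeomorphisms of the Euclidean space. -/
abbrev Diffeo (c : ℕ) (r : ℕ∞) : Type :=
  Diffeomorph 𝓘(ℝ, Euc c) 𝓘(ℝ, Euc c) (Euc c) (Euc c) (r : WithTop ℕ∞)

/-- The Grassmannian of `ℓ`-dimensional linear subspaces. -/
def Gr (ℓ c : ℕ) : Type := {E : Submodule ℝ (Euc c) // Module.finrank ℝ E = ℓ}

/-- The orthogonal projection onto a subspace; it embeds the Grassmannian as a submanifold of the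
space of endomorphisms. -/
noncomputable def Gr.proj {ℓ c : ℕ} (E : Gr ℓ c) : Euc c →L[ℝ] Euc c := E.1.starProjection

theorem Gr.proj_injective {ℓ c : ℕ} : Function.Injective (Gr.proj : Gr ℓ c → _) := by
  intro E F h
  apply Subtype.ext
  have h' : E.1.starProjection = F.1.starProjection := h
  ext v
  rw [← Submodule.starProjection_eq_self_iff, ← Submodule.starProjection_eq_self_iff, h']

/-- The gap metric `dist E F = ‖P_E - P_F‖`. -/
noncomputable instance {ℓ c : ℕ} : MetricSpace (Gr ℓ c) :=
  MetricSpace.induced Gr.proj Gr.proj_injective inferInstance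

/-- The embedding of `ℝ^c × G(ℓ, c)` in a normed space. -/
noncomputable def hatEmbedding (ℓ c : ℕ) (z : Euc c × Gr ℓ c) : Euc c × (Euc c →L[ℝ] Euc c) :=
  (z.1, z.2.proj)

theorem Diffeo.fderiv_symm_comp {c : ℕ} {r : ℕ∞} (hr : 2 ≤ r) (f : Diffeo c r) (x : Euc c) :
    (fderiv ℝ f.symm (f x)).comp (fderiv ℝ f x) = ContinuousLinearMap.id ℝ (Euc c) := by
  have hr0 : (r : WithTop ℕ∞) ≠ 0 := by
    have h0 : r ≠ 0 := by rintro rfl; simp at hr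
    exact_mod_cast h0
  have h1 : DifferentiableAt ℝ f x := f.contMDiff.contDiff.differentiable hr0 x
  have h2 : DifferentiableAt ℝ f.symm (f x) :=
    f.symm.contMDiff.contDiff.differentiable hr0 (f x)
  rw [← fderiv_comp x h2 h1]
  have : (f.symm ∘ f : Euc c → Euc c) = id := by
    funext y; simp
  rw [this, fderiv_id]

/-- The differential of a diffeomorphism maps subspaces to subspaces of the same dimension. -/
theorem Diffeo.finrank_map_fderiv {c : ℕ} {r : ℕ∞} (hr : 2 ≤ r) (f : Diffeo c r) (x : Euc c)
    (E : Submodule ℝ (Euc c)) :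
    Module.finrank ℝ (E.map (fderiv ℝ f x : Euc c →ₗ[ℝ] Euc c)) = Module.finrank ℝ E := by
  have hinj : Function.Injective (fderiv ℝ f x : Euc c →ₗ[ℝ] Euc c) := ?_
  · exact (Submodule.equivMapOfInjective _ hinj E).finrank_eq.symm
  intro v w hvw
  have h := Diffeo.fderiv_symm_comp hr f x
  have hv := congrArg (fun L : Euc c →L[ℝ] Euc c => L v) h
  have hw := congrArg (fun L : Euc c →L[ℝ] Euc c => L w) h
  have hvw' : fderiv ℝ f x v = fderiv ℝ f x w := hvw
  simp only [ContinuousLinearMap.comp_apply, ContinuousLinearMap.id_apply] at hv hw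
  rw [← hv, ← hw, hvw']

/-- The map `(x, E) ↦ (f x, Df(x) E)`. -/
noncomputable def hatFun {c : ℕ} {r : ℕ∞} (hr : 2 ≤ r) (ℓ : ℕ) (f : Diffeo c r)
    (z : Euc c × Gr ℓ c) : Euc c × Gr ℓ c :=
  (f z.1, ⟨z.2.1.map (fderiv ℝ f z.1 : Euc c →ₗ[ℝ] Euc c),
    (Diffeo.finrank_map_fderiv hr f z.1 z.2.1).trans z.2.2⟩)

theorem hatFun_symm_hatFun {c : ℕ} {r : ℕ∞} (hr : 2 ≤ r) (ℓ : ℕ) (f : Diffeo c r)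
    (z : Euc c × Gr ℓ c) : hatFun hr ℓ f.symm (hatFun hr ℓ f z) = z := by
  refine Prod.ext ?_ (Subtype.ext ?_)
  · simp [hatFun]
  · have h := Diffeo.fderiv_symm_comp hr f z.1
    have h' := congrArg (fun L : Euc c →L[ℝ] Euc c => (L : Euc c →ₗ[ℝ] Euc c)) h
    simp only [ContinuousLinearMap.toLinearMap_comp] at h'
    simp only [hatFun]
    rw [← Submodule.map_comp, h']
    exact Submodule.map_id _

/-- The bijection of `ℝ^c × G(ℓ, c)` induced by a diffeomorphism of `ℝ^c`. -/
noncomputable def hatPerm {c : ℕ} {r : ℕ∞} (hr : 2 ≤ r) (ℓ : ℕ) (f : Diffeo c r) :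
    Equiv.Perm (Euc c × Gr ℓ c) where
  toFun := hatFun hr ℓ f
  invFun := hatFun hr ℓ f.symm
  left_inv := hatFun_symm_hatFun hr ℓ f
  right_inv := hatFun_symm_hatFun hr ℓ f.symm

/-! ## Cones and tangencies -/

/-- `C` is a cone of dimension `ℓ`, around an `ℓ`-dimensional subspace `E`. -/
def IsConeOfDim {c : ℕ} (ℓ : ℕ) (C : Set (Euc c)) : Prop :=
  ∃ (E F : Submodule ℝ (Euc c)) (a : ℝ), IsCompl E F ∧ Module.finrank ℝ E = ℓ ∧ 0 < a ∧
    C = {v | ∃ u ∈ E, ∃ w ∈ F, v = u + w ∧ ‖w‖ ≤ a * ‖u‖}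

/-- `C` is an `ℓ`-cone which, along orbit segments in `B`, is mapped strictly into itself by the
differentials of the maps `f i`, which uniformly expand its vectors. -/
def IsUnstableCone {c d : ℕ} (ℓ : ℕ) (f : Fin d → Euc c → Euc c) (B : Set (Euc c))
    (C : Set (Euc c)) : Prop :=
  IsConeOfDim ℓ C ∧ ∃ σ : ℝ, 1 < σ ∧ ∀ i, ∀ x ∈ B, f i x ∈ B → ∀ v ∈ C, v ≠ 0 →
    fderiv ℝ (f i) x v ∈ interior C ∧ σ * ‖v‖ ≤ ‖fderiv ℝ (f i) x v‖

/-- `Bh` is an `ℓ`-tangency of the `cs`-blending region `B` with respect to `φ`. -/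
def IsCsTangency {c d : ℕ} {r : ℕ∞} (hr : 2 ≤ r) (ν α : ℝ) (ℓ : ℕ) (φ : Fin d → Diffeo c r)
    (B : Set (Euc c)) (Bh : Set (Euc c × Gr ℓ c)) : Prop :=
  ∃ (Dh : Set (Euc c × Gr ℓ c)) (k : ℕ) (C : Set (Euc c)),
    IsCsBlendingRegion ν α (hatEmbedding ℓ c) (fun i => hatPerm hr ℓ (φ i)) Bh Dh k ∧
    IsUnstableCone ℓ (fun i => (φ i : Euc c → Euc c)) B C ∧
    Bh ⊆ B ×ˢ {E : Gr ℓ c | (E.1 : Set (Euc c)) ⊆ C}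

/-- `Bh` is an `ℓ`-tangency of the `cu`-blending region `B` with respect to `φ`. Here `C` is a
stable cone: an unstable cone for the inverse maps. -/
def IsCuTangency {c d : ℕ} {r : ℕ∞} (hr : 2 ≤ r) (ν α : ℝ) (ℓ : ℕ) (φ : Fin d → Diffeo c r)
    (B : Set (Euc c)) (Bh : Set (Euc c × Gr ℓ c)) : Prop :=
  ∃ (Dh : Set (Euc c × Gr ℓ c)) (k : ℕ) (C : Set (Euc c)),
    IsCuBlendingRegion ν α (hatEmbedding ℓ c) (fun i => hatPerm hr ℓ (φ i)) Bh Dh k ∧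
    IsUnstableCone ℓ (fun i => ((φ i).symm : Euc c → Euc c)) B C ∧
    Bh ⊆ B ×ˢ {E : Gr ℓ c | (E.1 : Set (Euc c)) ⊆ C}

/-! ## Arcs of diffeomorphisms -/

/-- The family `φ` is continuous in the parameter `ε ≥ 0` for the `C^r` topology (uniform
convergence on compact sets of all derivatives of order at most `r`), and `φ 0 = id`. -/
def IsArcFromId {c : ℕ} {r : ℕ∞} (φ : ℝ≥0 → Diffeo c r) : Prop :=
  (∀ k : ℕ, (k : ℕ∞) ≤ r →
    Continuous fun p : ℝ≥0 × Euc c => iteratedFDeriv ℝ k (φ p.1) p.2) ∧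
  ∀ y, φ 0 y = y

/-! ## The full shift and scalar affine cocycles over it -/

/-! The maps are explicit. In the chart `x + ε • y` each is `y ↦ y + a • W y`, where the compactly
supported field `W` (`globalField`) is affine near the origin and the opposite of a second affine
field near a unit vector `e`. An affine field has rate 2 on the first `ℓ` coordinates, -1 on the
next `n` and 1 on the rest, a translation of size `2δ` along the middle `n`, and a small shear from
the first `ℓ` coordinates to the others. There is one map for each pattern of signs (zero included)
of translation and shear, so `d` depends on `c` only. Near `x` the local model has amplitude `a > 0`
and `n = i₁`; near `x + ε • e` it has amplitude `-a` and `n = c - i₂`, so its `cs`-index is `i₂`.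

Graphs over the first `ℓ` coordinates are moved by an affine diagonal map, so the induced maps are
affine in the graph chart (`hatPerm_hatChart`). Since 2 is the largest rate, graphs are contracted
for `a > 0` and expanded for `a < 0`. The shear vanishes on bounded orbits; what remains are scalar
affine cocycles over the full shift with multiplier different from 1, and each has exactly one
bounded orbit over a symbol sequence, depending continuously on it (`exists_bounded_solution`,
`eq_of_bounded_orbits`). Hence the maximal invariant set is a continuous graph over the full shift,
which makes it compact, transitive and isolated; the invariant family of planes conjugates the
derivative cocycle to a constant diagonal map, which makes it hyperbolic
(`IsCodedSystem.isBlendingFrame`).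

The covering properties come from choosing the signs of the point itself: translation and shear then
push towards the centre faster than the weak hyperbolicity pushes away (`exists_preimage_model`,
`exists_image_model`). Dominance of the rate 2 also gives the cones (`modelLin_cone_pos`,
`modelLin_cone_neg`). The map with all signs zero preserves the axis from `x` to `x + ε • e` and the
plane of the first `ℓ` coordinates, and pushes points along the axis from the first region to the
second (`hasTransition_globalField`).

The amplitude is flat at `ε = 0`, which beats every negative power of `ε` produced by rescaling and
gives an arc in any `C^r` (`exists_arc`); it is uniformly small, which gives partial hyperbolicity
and fibre bunching, also on the Grassmann bundle (`hasPHBounds_of_near_id`). -/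

theorem shiftPerm_apply {d : ℕ} (ξ : ℤ → Fin d) (i : ℤ) : shiftPerm d ξ i = ξ (i + 1) := rfl

theorem shiftPerm_pow_apply {d : ℕ} (n : ℕ) (ξ : ℤ → Fin d) (i : ℤ) :
    (shiftPerm d ^ n) ξ i = ξ (i + n) := by
  induction n generalizing i with
  | zero => simp
  | succ n ih =>
    rw [pow_succ', Equiv.Perm.mul_apply, shiftPerm_apply, ih]
    congr 1; push_cast; ring

theorem shiftPerm_zpow_apply {d : ℕ} (n : ℤ) (ξ : ℤ → Fin d) (i : ℤ) :
    (shiftPerm d ^ n) ξ i = ξ (i + n) := by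
  obtain ⟨m, rfl | rfl⟩ := n.eq_nat_or_neg
  · simpa using shiftPerm_pow_apply m ξ i
  · have h := shiftPerm_pow_apply m ((shiftPerm d ^ (-(m : ℤ))) ξ) (i + -m)
    rw [← zpow_natCast, ← Equiv.Perm.mul_apply, ← zpow_add] at h
    simpa using h.symm

/-- The full shift has a dense forward orbit. -/
theorem exists_dense_shift_orbit (d : ℕ) [Nonempty (Fin d)] :
    ∃ ζ : ℤ → Fin d, Dense (range fun n : ℕ => (shiftPerm d ^ n) ζ) := by
  classical
  let a : Fin d := Classical.arbitrary _
  let word : ℕ → List (Fin d) := fun k => (Encodable.decode k).getD []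
  -- On the dyadic block `[2^k, 2^(k+1))` the sequence spells the word with code `k`, padded by `a`.
  -- Entries at negative times play no role.
  let ζ : ℤ → Fin d := fun i =>
    (word (Nat.log 2 i.toNat)).getD (i.toNat - 2 ^ Nat.log 2 i.toNat) a
  refine ⟨ζ, fun ξ => ?_⟩
  have key : ∀ N : ℕ, ∃ n : ℕ, ∀ i : ℤ, |i| ≤ N → ζ (i + n) = ξ i := by
    intro N
    let w : List (Fin d) := List.ofFn fun j : Fin (2 * N + 1) => ξ ((j : ℤ) - N)
    let k := Encodable.encode w
    have hwlen : w.length = 2 * N + 1 := by simp [w]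
    -- A word is no longer than its code, so it fits into the block of length `2^k`.
    have hk : 2 * N + 1 ≤ k := hwlen ▸ Encodable.length_le_encode w
    have hkk : k < 2 ^ k := Nat.lt_two_pow_self
    refine ⟨2 ^ k + N, fun i hi => ?_⟩
    have hi' := abs_le.1 hi
    obtain ⟨j, hj⟩ : ∃ j : ℕ, (j : ℤ) = i + N := ⟨(i + N).toNat, Int.toNat_of_nonneg (by omega)⟩
    have hj2 : j < 2 * N + 1 := by omega
    have hto : (i + ((2 ^ k + N : ℕ) : ℤ)).toNat = 2 ^ k + j := by omega
    have hlog : Nat.log 2 (2 ^ k + j) = k := by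
      rw [Nat.log_eq_iff (Or.inr ⟨by norm_num, by positivity⟩)]
      constructor
      · omega
      · rw [pow_succ]; omega
    have hw : word k = w := by simp [word, k]
    show (word (Nat.log 2 _)).getD _ a = _
    rw [hto, hlog, hw, Nat.add_sub_cancel_left, List.getD_eq_getElem _ _ (by omega)]
    simp only [w, List.getElem_ofFn]
    congr 1; omega
  choose n hn using key
  refine mem_closure_of_tendsto (f := fun N => (shiftPerm d ^ (n N)) ζ) (b := Filter.atTop) ?_
    (Filter.Eventually.of_forall fun N => mem_range_self _)
  rw [tendsto_pi_nhds]
  intro i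
  refine tendsto_const_nhds.congr' ?_
  filter_upwards [Filter.eventually_ge_atTop i.natAbs] with N hN
  rw [shiftPerm_pow_apply]
  exact (hn N i (by rw [Int.abs_eq_natAbs]; exact_mod_cast hN)).symm

/-- The bounded solution of `v (τ ξ) = m v(ξ) + b (ξ₀)`. -/
theorem exists_bounded_solution {d : ℕ} {m β : ℝ} (hm0 : 0 < m) (hm1 : m ≠ 1)
    (b : Fin d → ℝ) (hb : ∀ i, |b i| ≤ β * |1 - m|) :
    ∃ s : (ℤ → Fin d) → ℝ, Continuous s ∧
      (∀ ξ, s (shiftPerm d ξ) = m * s ξ + b (ξ 0)) ∧ ∀ ξ, |s ξ| ≤ β := by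
  rcases lt_or_gt_of_ne hm1 with h | h
  -- Contracting case: the series runs over the past symbols.
  · have hg := summable_geometric_of_lt_one hm0.le h
    have hbd : ∀ (k : ℕ) (ξ : ℤ → Fin d), ‖m ^ k * b (ξ (-1 - k))‖ ≤ m ^ k * (β * |1 - m|) := by
      intro k ξ
      rw [Real.norm_eq_abs, abs_mul, abs_of_pos (pow_pos hm0 k)]
      exact mul_le_mul_of_nonneg_left (hb _) (pow_pos hm0 k).le
    have hsum : ∀ ξ : ℤ → Fin d, Summable fun k : ℕ => m ^ k * b (ξ (-1 - k)) := fun ξ =>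
      Summable.of_norm_bounded (hg.mul_right _) (hbd · ξ)
    refine ⟨fun ξ => ∑' k : ℕ, m ^ k * b (ξ (-1 - k)), ?_, fun ξ => ?_, fun ξ => ?_⟩
    · refine continuous_tsum (fun k => ?_) (hg.mul_right (β * |1 - m|)) hbd
      exact continuous_const.mul
        ((continuous_of_discreteTopology (f := b)).comp (continuous_apply (-1 - (k : ℤ))))
    · dsimp only
      rw [(hsum (shiftPerm d ξ)).tsum_eq_zero_add, ← tsum_mul_left, add_comm]
      congr 1
      · refine tsum_congr fun k => ?_
        rw [shiftPerm_apply, pow_succ', mul_assoc]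
        congr 4; push_cast; ring
      · simp [shiftPerm_apply]
    · rw [← Real.norm_eq_abs]
      refine (tsum_of_norm_bounded ((hasSum_geometric_of_lt_one hm0.le h).mul_right _)
        (hbd · ξ)).trans (le_of_eq ?_)
      rw [abs_of_pos (by linarith)]
      field_simp [(by linarith : (1 : ℝ) - m ≠ 0)]
  -- Expanding case: solve the equation for `v ξ` instead, which gives a series over the symbols
  -- from time zero on. In both cases the geometric sum cancels the factor `|1 - m|`.
  · have hi0 : 0 < m⁻¹ := inv_pos.2 hm0
    have hi1 : m⁻¹ < 1 := inv_lt_one_of_one_lt₀ h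
    have hg := summable_geometric_of_lt_one hi0.le hi1
    have hbd : ∀ (k : ℕ) (ξ : ℤ → Fin d),
        ‖m⁻¹ ^ k * (-m⁻¹ * b (ξ k))‖ ≤ m⁻¹ ^ k * (m⁻¹ * (β * |1 - m|)) := by
      intro k ξ
      rw [Real.norm_eq_abs, abs_mul, abs_of_pos (pow_pos hi0 k), abs_mul, abs_neg, abs_of_pos hi0]
      exact mul_le_mul_of_nonneg_left (mul_le_mul_of_nonneg_left (hb _) hi0.le) (pow_pos hi0 k).le
    have hsum : ∀ ξ : ℤ → Fin d, Summable fun k : ℕ => m⁻¹ ^ k * (-m⁻¹ * b (ξ k)) := fun ξ =>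
      Summable.of_norm_bounded (hg.mul_right _) (hbd · ξ)
    refine ⟨fun ξ => ∑' k : ℕ, m⁻¹ ^ k * (-m⁻¹ * b (ξ k)), ?_, fun ξ => ?_, fun ξ => ?_⟩
    · refine continuous_tsum (fun k => ?_) (hg.mul_right (m⁻¹ * (β * |1 - m|))) hbd
      exact continuous_const.mul (continuous_const.mul
        ((continuous_of_discreteTopology (f := b)).comp (continuous_apply (k : ℤ))))
    · dsimp only
      rw [(hsum ξ).tsum_eq_zero_add, mul_add, ← tsum_mul_left]
      have : ∀ k : ℕ, m * (m⁻¹ ^ (k + 1) * (-m⁻¹ * b (ξ (k + 1 : ℕ)))) =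
          m⁻¹ ^ k * (-m⁻¹ * b (shiftPerm d ξ k)) := by
        intro k
        rw [shiftPerm_apply, pow_succ']
        push_cast
        field_simp
      simp_rw [this]
      field_simp
      simp
    · rw [← Real.norm_eq_abs]
      refine (tsum_of_norm_bounded ((hasSum_geometric_of_lt_one hi0.le hi1).mul_right _)
        (hbd · ξ)).trans (le_of_eq ?_)
      rw [abs_of_neg (by linarith)]
      have : m - 1 ≠ 0 := by linarith
      have : 1 - m⁻¹ ≠ 0 := by linarith
      field_simp
      ring

/-- A bounded two-sided orbit of `v ↦ m v`, with `m ≠ 1`, vanishes. -/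
theorem eq_zero_of_bounded_orbit {m C : ℝ} (hm0 : 0 < m) (hm1 : m ≠ 1) (v : ℤ → ℝ)
    (hv : ∀ n, v (n + 1) = m * v n) (hC : ∀ n, |v n| ≤ C) (n : ℤ) : v n = 0 := by
  by_contra hne
  have hpos : 0 < |v n| := abs_pos.2 hne
  rcases lt_or_gt_of_ne hm1 with h | h
  -- A contraction blows up backwards in time, an expansion forwards.
  · have hk : ∀ k : ℕ, |v (n - k)| = m⁻¹ ^ k * |v n| := by
      intro k
      induction k with
      | zero => simp
      | succ k ih =>
        have h1 := hv (n - (k + 1 : ℕ))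
        have h2 : n - ((k + 1 : ℕ) : ℤ) + 1 = n - k := by push_cast; ring
        rw [h2] at h1
        rw [h1, abs_mul, abs_of_pos hm0] at ih
        rw [pow_succ', mul_assoc, ← ih]
        field_simp
    obtain ⟨k, hk'⟩ := pow_unbounded_of_one_lt (C / |v n|) ((one_lt_inv₀ hm0).2 h)
    have := hC (n - k)
    rw [hk k] at this
    rw [div_lt_iff₀ hpos] at hk'
    linarith
  · have hk : ∀ k : ℕ, |v (n + k)| = m ^ k * |v n| := by
      intro k
      induction k with
      | zero => simp
      | succ k ih =>
        have h1 := hv (n + k)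
        push_cast
        rw [← add_assoc, h1, abs_mul, abs_of_pos hm0, ih, pow_succ', mul_assoc]
    obtain ⟨k, hk'⟩ := pow_unbounded_of_one_lt (C / |v n|) h
    have := hC (n + k)
    rw [hk k] at this
    rw [div_lt_iff₀ hpos] at hk'
    linarith

/-- Bounded two-sided orbits of a scalar affine cocycle are unique. -/
theorem eq_of_bounded_orbits {m C C' : ℝ} (hm0 : 0 < m) (hm1 : m ≠ 1) (b v w : ℤ → ℝ)
    (hv : ∀ n, v (n + 1) = m * v n + b n) (hw : ∀ n, w (n + 1) = m * w n + b n)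
    (hC : ∀ n, |v n| ≤ C) (hC' : ∀ n, |w n| ≤ C') (n : ℤ) : v n = w n := by
  have := eq_zero_of_bounded_orbit hm0 hm1 (fun n => v n - w n) (C := C + C')
    (fun n => by rw [hv, hw]; ring)
    (fun n => (abs_sub _ _).trans (add_le_add (hC n) (hC' n))) n
  linarith

/-! ## Hyperbolic sets coded by the full shift -/

/-- `ψ` parametrizes an open piece of `M`, smoothly for the embedding `e`, and `q` is a smooth
retraction that inverts it. -/
structure IsChart {Y M V : Type*} [NormedAddCommGroup Y] [NormedSpace ℝ Y]
    [NormedAddCommGroup V] [NormedSpace ℝ V] (e : M → V) (ψ : Y → M) (q : V → Y) : Prop where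
  contDiff : ContDiff ℝ 1 (e ∘ ψ)
  contDiffAt : ∀ y, ContDiffAt ℝ 1 q (e (ψ y))
  left_inv : ∀ y, q (e (ψ y)) = y
  right_inv : ∀ y, ∀ᶠ w in 𝓝 (e (ψ y)), ∀ m, e m = w → ψ (q w) = m

namespace IsChart

variable {Y M V : Type*} [NormedAddCommGroup Y] [NormedSpace ℝ Y]
    [NormedAddCommGroup V] [NormedSpace ℝ V] {e : M → V} {ψ : Y → M} {q : V → Y}

theorem injective (hc : IsChart e ψ q) : Function.Injective ψ := fun y y' h => by
  rw [← hc.left_inv y, h, hc.left_inv]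

/-- The derivative of the chart. -/
noncomputable def deriv (e : M → V) (ψ : Y → M) (y : Y) : Y →L[ℝ] V := fderiv ℝ (e ∘ ψ) y

/-- The derivative of the retraction. -/
noncomputable def retr (e : M → V) (ψ : Y → M) (q : V → Y) (y : Y) : V →L[ℝ] Y :=
  fderiv ℝ q (e (ψ y))

theorem hasFDerivAt (hc : IsChart e ψ q) (y : Y) : HasFDerivAt (e ∘ ψ) (deriv e ψ y) y :=
  (hc.contDiff.differentiable one_ne_zero y).hasFDerivAt

theorem hasFDerivAt_retr (hc : IsChart e ψ q) (y : Y) :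
    HasFDerivAt q (retr e ψ q y) (e (ψ y)) :=
  ((hc.contDiffAt y).differentiableAt one_ne_zero).hasFDerivAt

theorem continuous_deriv (hc : IsChart e ψ q) : Continuous (deriv e ψ) :=
  hc.contDiff.continuous_fderiv one_ne_zero

theorem continuous_retr (hc : IsChart e ψ q) : Continuous (retr e ψ q) := by
  rw [continuous_iff_continuousAt]
  intro y
  have h1 : ContinuousAt (fderiv ℝ q) (e (ψ y)) :=
    ((hc.contDiffAt y).fderiv_right (m := 0) (by norm_num)).continuousAt
  exact ContinuousAt.comp (f := e ∘ ψ) h1 hc.contDiff.continuous.continuousAt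

theorem retr_deriv (hc : IsChart e ψ q) (y w : Y) :
    retr e ψ q y (deriv e ψ y w) = w := by
  have h := HasFDerivAt.comp (g := q) (f := e ∘ ψ) y (hc.hasFDerivAt_retr y) (hc.hasFDerivAt y)
  have h2 : q ∘ (e ∘ ψ) = id := funext hc.left_inv
  rw [h2] at h
  exact congrArg (fun L : Y →L[ℝ] Y => L w) (h.unique (hasFDerivAt_id y))

/-- A curve through `ψ y` that is differentiable in `V` is differentiable in the chart. -/
theorem exists_lift (hc : IsChart e ψ q) {y : Y} {g : ℝ → M} {v : V} (hg0 : g 0 = ψ y)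
    (hg : HasDerivAt (fun t => e (g t)) v 0) :
    HasDerivAt (fun t => q (e (g t))) (retr e ψ q y v) 0 ∧
      ∀ᶠ t in 𝓝 (0 : ℝ), g t = ψ (q (e (g t))) := by
  constructor
  · have := hc.hasFDerivAt_retr y
    rw [← hg0] at this
    exact HasFDerivAt.comp_hasDerivAt (f := fun t => e (g t)) 0 this hg
  · have h1 := hg.continuousAt.tendsto
    rw [hg0] at h1
    filter_upwards [h1.eventually (hc.right_inv y)] with t ht
    exact (ht _ rfl).symm

/-- Near `ψ y` a curve in `M` is its own image under `ψ ∘ q ∘ e`, so the chain rule puts its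
velocity in the range of the derivative of the chart; straight lines in `Y` give the converse. -/
theorem tangentSet_eq (hc : IsChart e ψ q) (y : Y) :
    tangentSet e (ψ y) = range (deriv e ψ y) := by
  ext v
  constructor
  · rintro ⟨g, hg0, hg⟩
    obtain ⟨h1, h2⟩ := hc.exists_lift hg0 hg
    have hq0 : q (e (g 0)) = y := by rw [hg0, hc.left_inv]
    have h3 : HasDerivAt (fun t => e (ψ (q (e (g t))))) (deriv e ψ y (retr e ψ q y v)) 0 := by
      have := hc.hasFDerivAt y
      rw [← hq0] at this
      have := HasFDerivAt.comp_hasDerivAt (f := fun t => q (e (g t))) 0 this h1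
      rwa [hq0] at this
    have h4 : HasDerivAt (fun t => e (g t)) (deriv e ψ y (retr e ψ q y v)) 0 :=
      h3.congr_of_eventuallyEq (h2.mono fun t ht => congrArg e ht)
    exact ⟨_, (hg.unique h4).symm⟩
  · rintro ⟨w, rfl⟩
    refine ⟨fun t => ψ (y + t • w), by simp, ?_⟩
    have h1 : HasDerivAt (fun t : ℝ => y + t • w) w 0 := by
      simpa using ((hasDerivAt_id (0 : ℝ)).smul_const w).const_add y
    have h2 := hc.hasFDerivAt y
    have h3 : HasFDerivAt (e ∘ ψ) (deriv e ψ y) (y + (0 : ℝ) • w) := by simpa using h2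
    exact HasFDerivAt.comp_hasDerivAt (f := fun t : ℝ => y + t • w) 0 h3 h1

theorem hasTangentMapAt (hc : IsChart e ψ q) {f : M → M} {G : Y → Y} {A : Y →L[ℝ] Y} {y : Y}
    (hf : ∀ᶠ y' in 𝓝 y, f (ψ y') = ψ (G y')) (hG : HasFDerivAt G A y) :
    HasTangentMapAt e f ((deriv e ψ (G y)).comp (A.comp (retr e ψ q y))) (ψ y) := by
  intro g v hg0 hg
  obtain ⟨h1, h2⟩ := hc.exists_lift hg0 hg
  have hq0 : q (e (g 0)) = y := by rw [hg0, hc.left_inv]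
  have hc1 : Filter.Tendsto (fun t => q (e (g t))) (𝓝 0) (𝓝 y) := by
    have := h1.continuousAt.tendsto
    rwa [hq0] at this
  have h3 : HasDerivAt (fun t => G (q (e (g t)))) (A (retr e ψ q y v)) 0 := by
    rw [← hq0] at hG
    have := HasFDerivAt.comp_hasDerivAt (f := fun t => q (e (g t))) 0 hG h1
    exact this
  have h4 : HasDerivAt (fun t => e (ψ (G (q (e (g t))))))
      (deriv e ψ (G y) (A (retr e ψ q y v))) 0 := by
    have := hc.hasFDerivAt (G y)
    rw [← hq0] at this
    have := HasFDerivAt.comp_hasDerivAt (f := fun t => G (q (e (g t)))) 0 this h3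
    rwa [hq0] at this
  refine h4.congr_of_eventuallyEq ?_
  filter_upwards [h2, hc1.eventually hf] with t ht1 ht2
  conv_lhs => rw [ht1, ht2]

variable [MetricSpace M]

theorem continuous (hc : IsChart e ψ q) (he : Isometry e) : Continuous ψ :=
  he.isEmbedding.isInducing.continuous_iff.2 hc.contDiff.continuous

/-- The local right inverse shows that every point of `M` near `ψ y` is hit by `ψ`, at a parameter
close to `y`. -/
theorem isOpen_image (hc : IsChart e ψ q) (he : Isometry e) {U : Set Y} (hU : IsOpen U) :
    IsOpen (ψ '' U) := by
  rw [isOpen_iff_mem_nhds]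
  rintro _ ⟨y, hy, rfl⟩
  have h1 : ∀ᶠ w in 𝓝 (e (ψ y)), q w ∈ U := by
    refine (hc.contDiffAt y).continuousAt.eventually ?_
    rw [hc.left_inv]
    exact hU.mem_nhds hy
  filter_upwards [he.continuous.continuousAt.eventually (h1.and (hc.right_inv y))] with m hm
  exact ⟨q (e m), hm.1, hm.2 m rfl⟩

end IsChart

theorem skewProduct_zpow_coded {d : ℕ} {M : Type*} {φ : Fin d → Equiv.Perm M}
    {p : (ℤ → Fin d) → M} (hp : ∀ ξ, φ (ξ 0) (p ξ) = p (shiftPerm d ξ)) (n : ℤ)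
    (ξ : ℤ → Fin d) :
    (skewProduct φ ^ n) (ξ, p ξ) = ((shiftPerm d ^ n) ξ, p ((shiftPerm d ^ n) ξ)) := by
  have h1 : ∀ ξ, skewProduct φ (ξ, p ξ) = (shiftPerm d ξ, p (shiftPerm d ξ)) := fun ξ =>
    Prod.ext rfl (hp ξ)
  have h2 : ∀ (n : ℕ) ξ, (skewProduct φ ^ n) (ξ, p ξ) =
      ((shiftPerm d ^ n) ξ, p ((shiftPerm d ^ n) ξ)) := by
    intro n
    induction n with
    | zero => intro ξ; simp
    | succ n ih => intro ξ; rw [pow_succ, Equiv.Perm.mul_apply, h1, ih]; rfl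
  obtain ⟨m, rfl | rfl⟩ := n.eq_nat_or_neg
  · simpa using h2 m ξ
  · have := h2 m ((shiftPerm d ^ (-(m : ℤ))) ξ)
    have h3 : (shiftPerm d ^ m) ((shiftPerm d ^ (-(m : ℤ))) ξ) = ξ := by
      rw [← zpow_natCast, ← Equiv.Perm.mul_apply, ← zpow_add]; simp
    rw [h3] at this
    rw [← this, zpow_neg, zpow_natCast]
    exact Equiv.symm_apply_apply _ _

theorem mem_maxInvariantSet_iff {d : ℕ} {M : Type*} [MetricSpace M] {φ : Fin d → Equiv.Perm M}
    {D : Set M} {z : (ℤ → Fin d) × M} :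
    z ∈ maxInvariantSet φ D ↔ ∀ n : ℤ, ((skewProduct φ ^ n) z).2 ∈ closure D := by
  simp only [maxInvariantSet, mem_iInter, mem_image, mem_prod, mem_univ, true_and]
  constructor
  · intro h n
    obtain ⟨w, hw, rfl⟩ := h (-n)
    rw [← Equiv.Perm.mul_apply, ← zpow_add]
    simpa using hw
  · intro h n
    refine ⟨(skewProduct φ ^ (-n)) z, h _, ?_⟩
    rw [← Equiv.Perm.mul_apply, ← zpow_add]
    simp

theorem skewProduct_zpow_fst {d : ℕ} {M : Type*} (φ : Fin d → Equiv.Perm M) (n : ℤ)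
    (z : (ℤ → Fin d) × M) : ((skewProduct φ ^ n) z).1 = (shiftPerm d ^ n) z.1 := by
  have h2 : ∀ (n : ℕ) z, ((skewProduct φ ^ n) z).1 = (shiftPerm d ^ n) z.1 := by
    intro n
    induction n with
    | zero => intro ξ; simp
    | succ n ih => intro ξ; rw [pow_succ, Equiv.Perm.mul_apply, ih]; rfl
  obtain ⟨m, rfl | rfl⟩ := n.eq_nat_or_neg
  · simpa using h2 m z
  · have := h2 m ((skewProduct φ ^ (-(m : ℤ))) z)
    rw [← Equiv.Perm.mul_apply, ← zpow_natCast, ← zpow_add] at this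
    simp only [add_neg_cancel, zpow_zero, Equiv.Perm.coe_one, id] at this
    rw [this, ← Equiv.Perm.mul_apply, ← zpow_natCast, ← zpow_add]
    simp

/-- A family of maps which is affine and hyperbolic in a chart, and whose bounded orbits are coded
by the full shift. -/
structure IsCodedSystem {d : ℕ} {Y : Type*} [NormedAddCommGroup Y] [NormedSpace ℝ Y]
    (A : Fin d → Y →L[ℝ] Y) (b : Fin d → Y) (U K : Set Y) (T : Y →L[ℝ] Y)
    (Ys Yu : Submodule ℝ Y) : Prop where
  exists_coding : ∃ S : (ℤ → Fin d) → Y, Continuous S ∧ (∀ ξ, S ξ ∈ U) ∧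
    (∀ ξ, S (shiftPerm d ξ) = A (ξ 0) (S ξ) + b (ξ 0)) ∧
    ∀ (ξ : ℤ → Fin d) (y : ℤ → Y), (∀ n, y (n + 1) = A (ξ n) (y n) + b (ξ n)) →
      (∀ n, y n ∈ K) → y 0 = S ξ
  exists_conj : ∃ h h' : (ℤ → Fin d) → Y →L[ℝ] Y, Continuous h ∧ Continuous h' ∧
    (∀ ξ v, h' ξ (h ξ v) = v) ∧ (∀ ξ v, h ξ (h' ξ v) = v) ∧
    ∀ ξ v, A (ξ 0) (h ξ v) = h (shiftPerm d ξ) (T v)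
  isCompl : IsCompl Ys Yu
  map_stable : Ys.map (T : Y →ₗ[ℝ] Y) = Ys
  map_unstable : Yu.map (T : Y →ₗ[ℝ] Y) = Yu
  bounds : ∃ ρ : ℝ, 0 < ρ ∧ ρ < 1 ∧ (∀ v ∈ Ys, ‖T v‖ ≤ ρ * ‖v‖) ∧ ∀ v ∈ Yu, ‖v‖ ≤ ρ * ‖T v‖

/-- The maximal invariant set is the graph of `ψ ∘ S` over the full shift, and the skew-product
restricted to it is the shift. Topological properties are inherited from the shift, and
hyperbolicity from the constant map `T` through a conjugacy that is bounded because the shift space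
is compact. -/
theorem IsCodedSystem.isBlendingFrame {d : ℕ} [Nonempty (Fin d)] {Y M V : Type*}
    [NormedAddCommGroup Y] [NormedSpace ℝ Y] [FiniteDimensional ℝ Y]
    [NormedAddCommGroup V] [NormedSpace ℝ V] [MetricSpace M] {ν α : ℝ}
    {e : M → V} {ψ : Y → M} {q : V → Y} (he : Isometry e) (hc : IsChart e ψ q)
    {A : Fin d → Y →L[ℝ] Y} {b : Fin d → Y} {T : Y →L[ℝ] Y} {Ys Yu : Submodule ℝ Y}
    {UB KB UD KD W : Set Y} (hs : IsCodedSystem A b UD KD T Ys Yu)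
    (hUB : IsOpen UB) (hUBn : UB.Nonempty) (hUD : IsOpen UD) (hW : IsOpen W)
    (hKB : IsCompact KB) (hKD : IsCompact KD)
    (h1 : UB ⊆ KB) (h2 : KB ⊆ UD) (h3 : UD ⊆ KD) (h4 : KD ⊆ W)
    {φ : Fin d → Equiv.Perm M} (hφ : ∀ i, ∀ y ∈ W, φ i (ψ y) = ψ (A i y + b i))
    (hPH : IsPHS ν α φ) :
    IsBlendingFrame ν α e φ (ψ '' UB) (ψ '' UD) (Module.finrank ℝ Ys) (Module.finrank ℝ Yu) := by
  obtain ⟨S, hS, hSU, hSA, hSu⟩ := hs.exists_coding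
  obtain ⟨h, h', hh, hh', hl, hr, hconj⟩ := hs.exists_conj
  obtain ⟨ρ, hρ0, hρ1, hρs, hρu⟩ := hs.bounds
  have hψ := hc.continuous he
  have hcl : closure (ψ '' UD) ⊆ ψ '' KD :=
    closure_minimal (image_mono h3) (hKD.image hψ).isClosed
  have hp : ∀ ξ, φ (ξ 0) (ψ (S ξ)) = ψ (S (shiftPerm d ξ)) := fun ξ => by
    rw [hφ _ _ (h4 (h3 (hSU ξ))), hSA]
  -- An orbit that stays in the closure of `D` is read in the chart as an orbit of the affine system
  -- in `KD`, where the coding is unique.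
  have hΓ : maxInvariantSet φ (ψ '' UD) = range fun ξ => (ξ, ψ (S ξ)) := by
    ext z
    rw [mem_maxInvariantSet_iff]
    constructor
    · intro hz
      choose y hyK hy using fun n => hcl (hz n)
      refine ⟨z.1, Prod.ext rfl ?_⟩
      have : y 0 = S z.1 := by
        refine hSu z.1 y (fun n => ?_) hyK
        apply hc.injective
        rw [hy, zpow_add, zpow_one, ← (Commute.zpow_self (skewProduct φ) n).eq.symm,
          Equiv.Perm.mul_apply, ← hφ _ _ (h4 (hyK n)), hy]
        have hf := congrFun (skewProduct_zpow_fst φ n z) 0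
        rw [shiftPerm_zpow_apply, zero_add] at hf
        rw [← hf]
        rfl
      have h0 := hy 0
      rw [this] at h0
      simpa using h0
    · rintro ⟨ξ, rfl⟩ n
      rw [skewProduct_zpow_coded (p := fun ξ => ψ (S ξ)) hp]
      exact subset_closure (mem_image_of_mem _ (hSU _))
  have hcont : Continuous fun ξ => (ξ, ψ (S ξ)) := continuous_id.prodMk (hψ.comp hS)
  have hclB : closure (ψ '' UB) ⊆ ψ '' KB :=
    closure_minimal (image_mono h1) (hKB.image hψ).isClosed
  refine ⟨hPH, hc.isOpen_image he hUB, hUBn.image _,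
    (hKB.image hψ).isBounded.subset (image_mono h1), hc.isOpen_image he hUD,
    (hKD.image hψ).isBounded.subset (image_mono h3), hclB.trans (image_mono h2), ?_, ?_, ?_⟩
  · rw [hΓ]
    refine ⟨isCompact_range hcont, ?_, ?_⟩
    · ext z
      constructor
      · rintro ⟨_, ⟨ξ, rfl⟩, rfl⟩
        exact ⟨shiftPerm d ξ, Prod.ext rfl (hp ξ).symm⟩
      · rintro ⟨ξ, rfl⟩
        refine ⟨_, ⟨(shiftPerm d).symm ξ, rfl⟩, ?_⟩
        refine Prod.ext ((shiftPerm d).apply_symm_apply ξ) ?_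
        exact (hp ((shiftPerm d).symm ξ)).trans (by simp)
    -- `H ξ` identifies `Y` with the tangent space at the coded point, in coordinates where the
    -- derivative cocycle is `T`; `R ξ` is a left inverse.
    · let H : (ℤ → Fin d) → Y →L[ℝ] V := fun ξ => (IsChart.deriv e ψ (S ξ)).comp (h ξ)
      let R : (ℤ → Fin d) → V →L[ℝ] Y := fun ξ => (h' ξ).comp (IsChart.retr e ψ q (S ξ))
      have hH : Continuous H := (hc.continuous_deriv.comp hS).clm_comp hh
      have hR : Continuous R := hh'.clm_comp (hc.continuous_retr.comp hS)
      have hRH : ∀ ξ w, R ξ (H ξ w) = w := fun ξ w => by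
        simp [H, R, hc.retr_deriv, hl]
      obtain ⟨K1, hK1⟩ := (isCompact_univ (X := ℤ → Fin d)).exists_bound_of_continuousOn
        hH.continuousOn
      obtain ⟨K2, hK2⟩ := (isCompact_univ (X := ℤ → Fin d)).exists_bound_of_continuousOn
        hR.continuousOn
      let K := max 1 (max K1 K2)
      have hK0 : 0 < K := lt_of_lt_of_le one_pos (le_max_left _ _)
      have hKH : ∀ ξ w, ‖H ξ w‖ ≤ K * ‖w‖ := fun ξ w => (H ξ).le_of_opNorm_le
        ((hK1 ξ (mem_univ _)).trans ((le_max_left _ _).trans (le_max_right _ _))) w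
      have hKR : ∀ ξ v, ‖R ξ v‖ ≤ K * ‖v‖ := fun ξ w => (R ξ).le_of_opNorm_le
        ((hK2 ξ (mem_univ _)).trans ((le_max_right _ _).trans (le_max_right _ _))) w
      have hKw : ∀ ξ w, ‖w‖ ≤ K * ‖H ξ w‖ := fun ξ w => by
        simpa only [hRH] using hKR ξ (H ξ w)
      -- The differential is extended to all of `V` by the derivative of the retraction.
      let At : (ℤ → Fin d) × M → V →L[ℝ] V := fun z =>
        (IsChart.deriv e ψ (S (shiftPerm d z.1))).comp
          ((A (z.1 0)).comp (IsChart.retr e ψ q (S z.1)))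
      have hAH : ∀ z w, At z (H z.1 w) = H (shiftPerm d z.1) (T w) := fun z w => by
        simp [At, H, hc.retr_deriv, hconj]
      have hcoc : ∀ (n : ℕ) z w, cocycle (skewProduct φ) At n z (H z.1 w) =
          H ((shiftPerm d ^ n) z.1) ((T ^ n) w) := by
        intro n
        induction n with
        | zero => intro z w; simp [cocycle]
        | succ n ih =>
          intro z w
          rw [cocycle, ContinuousLinearMap.comp_apply, hAH]
          have := ih (skewProduct φ z) (T w)
          rw [show (skewProduct φ z).1 = shiftPerm d z.1 from rfl] at this
          rw [this, pow_succ, pow_succ, Equiv.Perm.mul_apply]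
          rfl
      have hinj : ∀ ξ, Function.Injective (H ξ : Y →ₗ[ℝ] V) := fun ξ w w' hw => by
        have : H ξ w = H ξ w' := hw
        rw [← hRH ξ w, this, hRH]
      have hTs : ∀ (n : ℕ), ∀ v ∈ Ys, (T ^ n) v ∈ Ys ∧ ‖(T ^ n) v‖ ≤ ρ ^ n * ‖v‖ := by
        intro n v hv
        induction n with
        | zero => simpa using hv
        | succ n ih =>
          rw [pow_succ']
          refine ⟨?_, ?_⟩
          · rw [← hs.map_stable]; exact Submodule.mem_map_of_mem ih.1
          · refine (hρs _ ih.1).trans ?_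
            rw [pow_succ', mul_assoc]
            exact mul_le_mul_of_nonneg_left ih.2 hρ0.le
      have hTu : ∀ (n : ℕ), ∀ v ∈ Yu, (T ^ n) v ∈ Yu ∧ ‖v‖ ≤ ρ ^ n * ‖(T ^ n) v‖ := by
        intro n v hv
        induction n with
        | zero => simpa using hv
        | succ n ih =>
          rw [pow_succ']
          refine ⟨?_, ?_⟩
          · rw [← hs.map_unstable]; exact Submodule.mem_map_of_mem ih.1
          · refine ih.2.trans ?_
            rw [pow_succ, mul_assoc]
            exact mul_le_mul_of_nonneg_left (hρu _ ih.1) (pow_pos hρ0 n).le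
      refine ⟨At, fun z => Ys.map (H z.1 : Y →ₗ[ℝ] V), fun z => Yu.map (H z.1 : Y →ₗ[ℝ] V),
        -- One factor `K` for entering the model coordinates and one for leaving them.
        K * K, ρ, mul_pos hK0 hK0, hρ0, hρ1, ?_⟩
      have hmap : ∀ z (P : Submodule ℝ Y), P.map (T : Y →ₗ[ℝ] Y) = P →
          (P.map (H z.1 : Y →ₗ[ℝ] V)).map (At z : V →ₗ[ℝ] V) =
            P.map (H (shiftPerm d z.1) : Y →ₗ[ℝ] V) := by
        intro z P hP
        conv_rhs => rw [← hP]
        rw [← Submodule.map_comp, ← Submodule.map_comp]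
        congr 1
        ext w
        exact hAH z w
      rintro _ ⟨ξ, rfl⟩
      refine ⟨?_, ?_, ?_, ?_, ?_, ?_, ?_, hmap _ _ hs.map_stable, hmap _ _ hs.map_unstable,
        fun n => ⟨?_, ?_⟩⟩
      · have := hc.hasTangentMapAt (f := φ (ξ 0)) (G := fun y => A (ξ 0) y + b (ξ 0))
          (A := A (ξ 0)) (y := S ξ)
          (Filter.mem_of_superset (hW.mem_nhds (h4 (h3 (hSU ξ)))) (hφ (ξ 0)))
          ((A (ξ 0)).hasFDerivAt.add_const _)
        simpa only [At, hSA] using this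
      · show ((Ys.map _ ⊔ Yu.map _ : Submodule ℝ V) : Set V) = _
        rw [← Submodule.map_sup, hs.isCompl.sup_eq_top, hc.tangentSet_eq]
        ext v
        constructor
        · rintro ⟨w, -, rfl⟩; exact ⟨h ξ w, rfl⟩
        · rintro ⟨w, rfl⟩; exact ⟨h' ξ w, trivial, by simp [H, hr]⟩
      · exact Submodule.disjoint_map (hinj ξ) hs.isCompl.disjoint
      · infer_instance
      · exact (Submodule.equivMapOfInjective _ (hinj ξ) Ys).finrank_eq.symm
      · infer_instance
      · exact (Submodule.equivMapOfInjective _ (hinj ξ) Yu).finrank_eq.symm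
      · rintro _ ⟨w, hw, rfl⟩
        have e1 := hcoc n (ξ, ψ (S ξ)) w
        have e2 := hKH ((shiftPerm d ^ n) ξ) ((T ^ n) w)
        have e3 := (hTs n w hw).2
        have e4 := hKw ξ w
        show ‖cocycle _ _ _ _ (H ξ w)‖ ≤ _ * ‖H ξ w‖
        rw [e1]
        calc _ ≤ K * ‖(T ^ n) w‖ := e2
          _ ≤ K * (ρ ^ n * (K * ‖H ξ w‖)) := by gcongr; exact e3.trans (by gcongr)
          _ = _ := by ring
      · rintro _ ⟨w, hw, rfl⟩
        have e1 := hcoc n (ξ, ψ (S ξ)) w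
        have e2 := hKw ((shiftPerm d ^ n) ξ) ((T ^ n) w)
        have e3 := (hTu n w hw).2
        have e4 := hKH ξ w
        show ‖H ξ w‖ ≤ _ * ‖cocycle _ _ _ _ (H ξ w)‖
        rw [e1]
        calc _ ≤ K * ‖w‖ := e4
          _ ≤ K * (ρ ^ n * (K * ‖H ((shiftPerm d ^ n) ξ) ((T ^ n) w)‖)) := by
            gcongr; exact e3.trans (by gcongr)
          _ = _ := by ring
  · obtain ⟨ζ, hζ⟩ := exists_dense_shift_orbit d
    rw [hΓ]
    refine ⟨_, ⟨ζ, rfl⟩, ?_⟩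
    have h5 : (fun n : ℕ => (skewProduct φ ^ n) (ζ, ψ (S ζ))) =
        (fun ξ => (ξ, ψ (S ξ))) ∘ fun n : ℕ => (shiftPerm d ^ n) ζ := by
      funext n
      simpa using skewProduct_zpow_coded (p := fun ξ => ψ (S ξ)) hp n ζ
    show _ ⊆ closure (range fun n : ℕ => (skewProduct φ ^ n) (ζ, ψ (S ζ)))
    rw [h5, range_comp]
    exact hcont.range_subset_closure_image_dense hζ
  · rw [hΓ]
    rintro _ ⟨ξ, rfl⟩
    exact ⟨mem_univ _, mem_image_of_mem _ (hSU ξ)⟩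

/-! ## The gap metric -/

section Gap

variable {c : ℕ}

theorem norm_sub_starProjection_le (E : Submodule ℝ (Euc c)) (v : Euc c) {w : Euc c}
    (hw : w ∈ E) : ‖v - E.starProjection v‖ ≤ ‖v - w‖ := by
  rw [Submodule.starProjection_minimal]
  exact ciInf_le (f := fun x : E => ‖v - x‖) ⟨0, by rintro _ ⟨x, rfl⟩; exact norm_nonneg _⟩ ⟨w, hw⟩

/-- Write `v = x + y` with `y = P_F v`. Then `(P_E - P_F) v = P_E x - (y - P_E y)` is a sum of
orthogonal vectors, so it suffices to bound each by `r` times the norm of `x` or `y`. For `p = P_E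
x` this is duality: `⟪p, p⟫ = ⟪p, x⟫ = ⟪p - P_F p, x⟫`. -/
theorem norm_starProjection_sub_le {E F : Submodule ℝ (Euc c)} {r : ℝ} (hr : 0 ≤ r)
    (hE : ∀ v ∈ E, ‖v - F.starProjection v‖ ≤ r * ‖v‖)
    (hF : ∀ v ∈ F, ‖v - E.starProjection v‖ ≤ r * ‖v‖) :
    ‖E.starProjection - F.starProjection‖ ≤ r := by
  refine ContinuousLinearMap.opNorm_le_bound _ hr fun v => ?_
  set y := F.starProjection v with hy
  set x := v - y with hx
  have hyF : y ∈ F := Submodule.starProjection_apply_mem _ _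
  have hxF : x ∈ Fᗮ := Submodule.sub_starProjection_mem_orthogonal v
  set p := E.starProjection x with hp
  have hpE : p ∈ E := Submodule.starProjection_apply_mem _ _
  have hxp : x - p ∈ Eᗮ := Submodule.sub_starProjection_mem_orthogonal x
  set s := y - E.starProjection y with hs
  have hsE : s ∈ Eᗮ := Submodule.sub_starProjection_mem_orthogonal y
  have hsn : ‖s‖ ≤ r * ‖y‖ := hF y hyF
  have hvxy : v = x + y := by rw [hx]; abel
  have hdec : (E.starProjection - F.starProjection) v = p - s := by
    rw [sub_apply, ← hy, hp, hs]
    conv_lhs => rw [hvxy]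
    rw [map_add]; abel
  have hpn : ‖p‖ ≤ r * ‖x‖ := by
    have h1 : inner ℝ p p = inner ℝ p x := by
      have : inner ℝ p (x - p) = 0 := hxp p hpE
      rw [inner_sub_right] at this; linarith
    have h2 : inner ℝ p x = inner ℝ (p - F.starProjection p) x := by
      have : inner ℝ (F.starProjection p) x = 0 :=
        hxF _ (Submodule.starProjection_apply_mem _ _)
      rw [inner_sub_left, this, sub_zero]
    have h3 := real_inner_le_norm (p - F.starProjection p) x
    rw [← h2, ← h1, real_inner_self_eq_norm_sq] at h3
    have h4 := hE p hpE
    by_contra hlt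
    push Not at hlt
    have h5 : 0 < ‖p‖ := lt_of_le_of_lt (by positivity) hlt
    have h6 : ‖p‖ ^ 2 ≤ (r * ‖x‖) * ‖p‖ := by
      calc _ ≤ _ := h3
        _ ≤ (r * ‖p‖) * ‖x‖ := by gcongr
        _ = _ := by ring
    nlinarith
  have hps : inner ℝ p s = 0 := hsE p hpE
  have hxy : inner ℝ y x = 0 := hxF y hyF
  have e1 : ‖p - s‖ ^ 2 = ‖p‖ ^ 2 + ‖s‖ ^ 2 := by
    rw [norm_sub_sq_real, hps]; ring
  have e2 : ‖v‖ ^ 2 = ‖x‖ ^ 2 + ‖y‖ ^ 2 := by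
    rw [hvxy, norm_add_sq_real, real_inner_comm, hxy]; ring
  rw [hdec]
  refine abs_le_of_sq_le_sq' ?_ (by positivity) |>.2
  rw [e1, mul_pow, e2]
  have := pow_le_pow_left₀ (norm_nonneg p) hpn 2
  have := pow_le_pow_left₀ (norm_nonneg s) hsn 2
  nlinarith

/-- The gap of the images of two subspaces under two linear maps. -/
theorem norm_starProjection_map_sub_le {E F : Submodule ℝ (Euc c)} {A A' : Euc c →L[ℝ] Euc c}
    {a β κ g : ℝ} (ha : 0 ≤ a) (hβ : 0 ≤ β) (hκ : 0 ≤ κ) (hA : ‖A‖ ≤ a) (hA' : ‖A'‖ ≤ a)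
    (hB : ∀ v, ‖v‖ ≤ β * ‖A v‖) (hB' : ∀ v, ‖v‖ ≤ β * ‖A' v‖) (hAA : ‖A - A'‖ ≤ κ)
    (hg : ‖E.starProjection - F.starProjection‖ ≤ g) :
    ‖(E.map (A : Euc c →ₗ[ℝ] Euc c)).starProjection -
      (F.map (A' : Euc c →ₗ[ℝ] Euc c)).starProjection‖ ≤ (a * g + κ) * β := by
  have hg0 : 0 ≤ g := (norm_nonneg _).trans hg
  have key : ∀ (E F : Submodule ℝ (Euc c)) (A A' : Euc c →L[ℝ] Euc c), ‖A‖ ≤ a →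
      (∀ v, ‖v‖ ≤ β * ‖A v‖) → ‖A - A'‖ ≤ κ →
      ‖E.starProjection - F.starProjection‖ ≤ g →
      ∀ v ∈ E.map (A : Euc c →ₗ[ℝ] Euc c),
        ‖v - (F.map (A' : Euc c →ₗ[ℝ] Euc c)).starProjection v‖ ≤ (a * g + κ) * β * ‖v‖ := by
    intro E F A A' hA hB hAA hg
    rintro _ ⟨u, hu, rfl⟩
    -- The distance from `A u` to the other image is tested on the image of the projection of `u`.
    have hw : A' (F.starProjection u) ∈ F.map (A' : Euc c →ₗ[ℝ] Euc c) :=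
      Submodule.mem_map_of_mem (Submodule.starProjection_apply_mem F u)
    refine (norm_sub_starProjection_le _ _ hw).trans ?_
    show ‖A u - A' (F.starProjection u)‖ ≤ _ * ‖A u‖
    have h1 : A u - A' (F.starProjection u) =
        A ((E.starProjection - F.starProjection) u) + (A - A') (F.starProjection u) := by
      rw [sub_apply, sub_apply, map_sub,
        Submodule.starProjection_eq_self_iff.2 hu]
      abel
    rw [h1]
    calc _ ≤ ‖A ((E.starProjection - F.starProjection) u)‖ + ‖(A - A') (F.starProjection u)‖ :=
          norm_add_le _ _
      _ ≤ a * (g * ‖u‖) + κ * ‖u‖ := by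
          gcongr
          · exact A.le_of_opNorm_le_of_le hA (ContinuousLinearMap.le_of_opNorm_le _ hg u)
          · exact ContinuousLinearMap.le_of_opNorm_le_of_le _ hAA (F.norm_starProjection_apply_le u)
      _ = (a * g + κ) * ‖u‖ := by ring
      _ ≤ (a * g + κ) * (β * ‖A u‖) := by gcongr; exact hB u
      _ = _ := by ring
  refine norm_starProjection_sub_le (by positivity) (key E F A A' hA hB hAA hg) ?_
  exact key F E A' A hA' hB' (by rwa [norm_sub_rev]) (by rwa [norm_sub_rev])

theorem Gr.dist_eq {ℓ : ℕ} (E F : Gr ℓ c) : dist E F = ‖E.1.starProjection - F.1.starProjection‖ :=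
  dist_eq_norm (Gr.proj E) (Gr.proj F)

theorem isometry_hatEmbedding (ℓ : ℕ) : Isometry (hatEmbedding ℓ c) := by
  refine Isometry.of_dist_eq fun z w => ?_
  rw [Prod.dist_eq, Prod.dist_eq]
  rfl

/-- A Lipschitz estimate for the map induced by a diffeomorphism on the Grassmann bundle. -/
theorem dist_hatFun_le {r : ℕ∞} (hr : 2 ≤ r) (ℓ : ℕ) (f : Diffeo c r) {κ Λ : ℝ}
    (hκ0 : 0 ≤ κ) (hκ : κ < 1) (h1 : ∀ x, ‖fderiv ℝ f x - ContinuousLinearMap.id ℝ _‖ ≤ κ)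
    (h2 : ∀ x y, ‖fderiv ℝ f x - fderiv ℝ f y‖ ≤ κ * ‖x - y‖)
    (h3 : ∀ x y, dist (f x) (f y) ≤ Λ * dist x y)
    (hΛ : (1 + 2 * κ) / (1 - κ) ≤ Λ) (z w : Euc c × Gr ℓ c) :
    dist (hatFun hr ℓ f z) (hatFun hr ℓ f w) ≤ Λ * dist z w := by
  have hΛ0 : 0 ≤ Λ := le_trans (div_nonneg (by linarith) (by linarith)) hΛ
  rw [Prod.dist_eq]
  refine max_le ((h3 _ _).trans (mul_le_mul_of_nonneg_left (le_max_left _ _) hΛ0)) ?_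
  have hn : ∀ x, ‖fderiv ℝ f x‖ ≤ 1 + κ := fun x => by
    have := norm_add_le (ContinuousLinearMap.id ℝ (Euc c))
      (fderiv ℝ f x - ContinuousLinearMap.id ℝ _)
    rw [add_sub_cancel] at this
    refine this.trans (add_le_add ContinuousLinearMap.norm_id_le (h1 x))
  have hi : ∀ x v, ‖v‖ ≤ (1 - κ)⁻¹ * ‖fderiv ℝ f x v‖ := fun x v => by
    rw [inv_mul_eq_div, le_div_iff₀ (by linarith)]
    have e1 := ContinuousLinearMap.le_of_opNorm_le _ (h1 x) v
    rw [sub_apply, ContinuousLinearMap.id_apply] at e1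
    have e2 := norm_sub_norm_le v (v - fderiv ℝ f x v)
    rw [sub_sub_cancel, norm_sub_rev v] at e2
    linarith
  rw [Gr.dist_eq]
  -- Change of plane costs `1 + κ`, change of derivative `κ`, and inversion `(1 - κ)⁻¹`.
  refine (norm_starProjection_map_sub_le (a := 1 + κ) (β := (1 - κ)⁻¹) (κ := κ * dist z w)
    (g := dist z w) (by linarith) (inv_nonneg.2 (by linarith)) (by positivity) (hn _) (hn _) (hi _)
    (hi _) ((h2 _ _).trans ?_) ?_).trans ?_
  · rw [← dist_eq_norm]
    exact mul_le_mul_of_nonneg_left (le_max_left _ _) hκ0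
  · rw [← Gr.dist_eq]
    exact le_max_right _ _
  · calc _ = (1 + 2 * κ) / (1 - κ) * dist z w := by rw [div_eq_mul_inv]; ring
      _ ≤ _ := by gcongr

end Gap

/-! ## Coordinate subspaces and the graph chart of the Grassmannian -/

/-- The operator on the Euclidean space with a given matrix. -/
noncomputable def opM {c : ℕ} (M : Matrix (Fin c) (Fin c) ℝ) : Euc c →L[ℝ] Euc c :=
  Matrix.toEuclideanCLM (𝕜 := ℝ) M

theorem opM_apply {c : ℕ} (M : Matrix (Fin c) (Fin c) ℝ) (v : Euc c) (k : Fin c) :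
    opM M v k = ∑ j, M k j * v j := rfl

/-- The subspace of vectors supported on the coordinates that satisfy `p`. -/
def coordSub {c : ℕ} (p : Fin c → Prop) : Submodule ℝ (Euc c) where
  carrier := {v | ∀ k, ¬ p k → v k = 0}
  add_mem' := fun hv hw k hk => by simp [hv k hk, hw k hk]
  zero_mem' := fun k _ => rfl
  smul_mem' := fun t v hv k hk => by simp [hv k hk]

theorem finrank_coordSub {c : ℕ} (p : Fin c → Prop) [DecidablePred p] :
    Module.finrank ℝ (coordSub p) = (Finset.univ.filter p).card := by
  let f : coordSub p ≃ₗ[ℝ] ({k // p k} → ℝ) :=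
    { toFun := fun v k => v.1 k
      map_add' := fun _ _ => rfl
      map_smul' := fun _ _ => rfl
      invFun := fun w => ⟨WithLp.toLp 2 fun k => if h : p k then w ⟨k, h⟩ else 0, fun k hk => by
        simp [hk]⟩
      left_inv := fun v => by
        ext k
        by_cases h : p k
        · simp [h]
        · simp [h, v.2 k h]
      right_inv := fun w => by
        ext k
        simp [k.2] }
  rw [f.finrank_eq, Module.finrank_pi, Fintype.card_subtype]

theorem isCompl_coordSub {c : ℕ} (p q : Fin c → Prop) (h : ∀ k, q k ↔ ¬ p k) :
    IsCompl (coordSub p) (coordSub q) := by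
  classical
  constructor
  · rw [Submodule.disjoint_def]
    intro v hv hw
    ext k
    by_cases hk : p k
    · exact hw k (by rw [h]; tauto)
    · exact hv k hk
  · rw [codisjoint_iff, eq_top_iff]
    intro v _
    rw [Submodule.mem_sup]
    refine ⟨WithLp.toLp 2 fun k => if p k then v k else 0, fun k hk => by simp [hk],
      WithLp.toLp 2 fun k => if p k then 0 else v k, fun k hk => ?_, ?_⟩
    · rw [h, not_not] at hk
      simp [hk]
    · ext k
      by_cases hk : p k <;> simp [hk]

/-- The index type of the graph chart of `G(ℓ, c)`. -/
abbrev GrIdx (ℓ c : ℕ) : Type := {p : Fin c × Fin c // ℓ ≤ (p.1 : ℕ) ∧ (p.2 : ℕ) < ℓ}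

section GrChart

variable {ℓ c : ℕ}

/-- The matrix with a given lower left block, as a linear map. -/
def matL (ℓ c : ℕ) : (GrIdx ℓ c → ℝ) →ₗ[ℝ] Matrix (Fin c) (Fin c) ℝ where
  toFun L := Matrix.of fun k j => if h : ℓ ≤ (k : ℕ) ∧ (j : ℕ) < ℓ then L ⟨(k, j), h⟩ else 0
  map_add' L L' := by
    ext k j
    by_cases h : ℓ ≤ (k : ℕ) ∧ (j : ℕ) < ℓ <;> simp [h]
  map_smul' t L := by
    ext k j
    by_cases h : ℓ ≤ (k : ℕ) ∧ (j : ℕ) < ℓ <;> simp [h]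

theorem matL_apply (L : GrIdx ℓ c → ℝ) (k j : Fin c) :
    matL ℓ c L k j = if h : ℓ ≤ (k : ℕ) ∧ (j : ℕ) < ℓ then L ⟨(k, j), h⟩ else 0 := rfl

theorem matL_apply_top (L : GrIdx ℓ c → ℝ) {k : Fin c} (hk : (k : ℕ) < ℓ) (j : Fin c) :
    matL ℓ c L k j = 0 := by
  rw [matL_apply, dif_neg (by omega)]

theorem matL_apply_right (L : GrIdx ℓ c → ℝ) (k : Fin c) {j : Fin c} (hj : ℓ ≤ (j : ℕ)) :
    matL ℓ c L k j = 0 := by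
  rw [matL_apply, dif_neg (by omega)]

/-- The operator whose graph over the first `ℓ` coordinates is a point of the chart. -/
noncomputable def calL (L : GrIdx ℓ c → ℝ) : Euc c →L[ℝ] Euc c := opM (matL ℓ c L)

/-- The transpose of `calL`. -/
noncomputable def calLt (L : GrIdx ℓ c → ℝ) : Euc c →L[ℝ] Euc c := opM (matL ℓ c L).transpose

theorem contDiff_opM_comp {E : Type*} [NormedAddCommGroup E] [NormedSpace ℝ E]
    [FiniteDimensional ℝ E] (f : E →ₗ[ℝ] Matrix (Fin c) (Fin c) ℝ) {n : WithTop ℕ∞} :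
    ContDiff ℝ n fun x => opM (f x) := by
  let g : E →ₗ[ℝ] (Euc c →L[ℝ] Euc c) :=
    { toFun := fun x => opM (f x)
      map_add' := fun x y => by simp [opM]
      map_smul' := fun t x => by simp [opM] }
  exact (LinearMap.toContinuousLinearMap g).contDiff

theorem contDiff_calL {n : WithTop ℕ∞} : ContDiff ℝ n (calL : (GrIdx ℓ c → ℝ) → _) :=
  contDiff_opM_comp (matL ℓ c)

theorem contDiff_calLt {n : WithTop ℕ∞} : ContDiff ℝ n (calLt : (GrIdx ℓ c → ℝ) → _) :=
  contDiff_opM_comp ((Matrix.transposeLinearEquiv (Fin c) (Fin c) ℝ ℝ).toLinearMap.comp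
    (matL ℓ c))

theorem inner_eq_sum (v w : Euc c) : inner ℝ v w = ∑ k, v k * w k := by
  simp [PiLp.inner_apply, mul_comm]

theorem inner_calL_left (L : GrIdx ℓ c → ℝ) (v w : Euc c) :
    inner ℝ (calL L v) w = inner ℝ v (calLt L w) := by
  simp only [inner_eq_sum, calL, calLt, opM_apply, Finset.sum_mul, Finset.mul_sum,
    Matrix.transpose_apply]
  rw [Finset.sum_comm]
  exact Finset.sum_congr rfl fun i _ => Finset.sum_congr rfl fun j _ => by ring

theorem calL_apply_top (L : GrIdx ℓ c → ℝ) (v : Euc c) {k : Fin c} (hk : (k : ℕ) < ℓ) :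
    calL L v k = 0 := by
  rw [calL, opM_apply]
  exact Finset.sum_eq_zero fun j _ => by rw [matL_apply_top L hk, zero_mul]

theorem calL_eq_of_top (L : GrIdx ℓ c → ℝ) {v w : Euc c}
    (h : ∀ k : Fin c, (k : ℕ) < ℓ → v k = w k) : calL L v = calL L w := by
  ext k
  rw [calL, opM_apply, opM_apply]
  refine Finset.sum_congr rfl fun j _ => ?_
  by_cases hj : (j : ℕ) < ℓ
  · rw [h j hj]
  · rw [matL_apply_right L k (not_lt.1 hj), zero_mul, zero_mul]

/-- The range has vanishing first `ℓ` coordinates, and only those are read. Hence `id + calL L` and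
`id - calL L` are inverse to each other. -/
theorem calL_calL (L L' : GrIdx ℓ c → ℝ) (v : Euc c) : calL L (calL L' v) = 0 := by
  have : calL L (calL L' v) = calL L 0 := calL_eq_of_top L fun k hk => calL_apply_top L' v hk
  rw [this, map_zero]

/-- The span of the first `ℓ` coordinates. -/
abbrev botSub (ℓ c : ℕ) : Submodule ℝ (Euc c) := coordSub fun k : Fin c => (k : ℕ) < ℓ

theorem finrank_botSub (h : ℓ ≤ c) : Module.finrank ℝ (botSub ℓ c) = ℓ := by
  rw [botSub, finrank_coordSub]
  have := Fin.card_filter_val_lt (n := c) (m := ℓ)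
  simpa [h] using this

/-- The projection to the first `ℓ` coordinates. -/
noncomputable def projTop (ℓ c : ℕ) : Euc c →L[ℝ] Euc c :=
  opM (Matrix.diagonal fun k : Fin c => if (k : ℕ) < ℓ then 1 else 0)

theorem opM_diagonal_apply (m : Fin c → ℝ) (v : Euc c) (k : Fin c) :
    opM (Matrix.diagonal m) v k = m k * v k := by
  rw [opM_apply, Finset.sum_eq_single k]
  · simp
  · intro j _ hj; rw [Matrix.diagonal_apply_ne' _ hj, zero_mul]
  · simp

theorem projTop_apply (v : Euc c) (k : Fin c) :
    projTop ℓ c v k = if (k : ℕ) < ℓ then v k else 0 := by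
  rw [projTop, opM_diagonal_apply]; split_ifs <;> simp

theorem calL_projTop (L : GrIdx ℓ c → ℝ) (v : Euc c) : calL L (projTop ℓ c v) = calL L v :=
  calL_eq_of_top L fun k hk => by simp [projTop_apply, hk]

/-- The graph of `calL L` over the first `ℓ` coordinates. -/
noncomputable def graphSub (L : GrIdx ℓ c → ℝ) : Submodule ℝ (Euc c) :=
  (botSub ℓ c).map ((ContinuousLinearMap.id ℝ (Euc c) + calL L : Euc c →L[ℝ] Euc c) :
    Euc c →ₗ[ℝ] Euc c)

theorem mem_graphSub {L : GrIdx ℓ c → ℝ} {v : Euc c} :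
    v ∈ graphSub L ↔ ∃ u ∈ botSub ℓ c, v = u + calL L u := by
  constructor
  · rintro ⟨u, hu, rfl⟩; exact ⟨u, hu, rfl⟩
  · rintro ⟨u, hu, rfl⟩; exact ⟨u, hu, rfl⟩

theorem finrank_graphSub (h : ℓ ≤ c) (L : GrIdx ℓ c → ℝ) :
    Module.finrank ℝ (graphSub L) = ℓ := by
  refine Eq.trans ?_ (finrank_botSub h)
  refine (Submodule.equivMapOfInjective _ ?_ (botSub ℓ c)).finrank_eq.symm
  intro v w hvw
  have h0 : v + calL L v = w + calL L w := hvw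
  have h1 := congrArg (calL L) h0
  rw [map_add, map_add, calL_calL, calL_calL, add_zero, add_zero] at h1
  rw [h1] at h0
  exact add_right_cancel h0

/-- The graph chart of the Grassmannian. -/
noncomputable def graphGr (h : ℓ ≤ c) (L : GrIdx ℓ c → ℝ) : Gr ℓ c :=
  ⟨graphSub L, finrank_graphSub h L⟩

/-- The map that sends the coordinate splitting to the graph and its orthogonal complement. -/
noncomputable def twist (L : GrIdx ℓ c → ℝ) : Euc c →L[ℝ] Euc c := 1 + (calL L - calLt L)

theorem twist_apply (L : GrIdx ℓ c → ℝ) (v : Euc c) :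
    twist L v = v + (calL L v - calLt L v) := rfl

theorem isUnit_of_injective {T : Euc c →L[ℝ] Euc c} (h : ∀ v, T v = 0 → v = 0) : IsUnit T := by
  rw [ContinuousLinearMap.isUnit_iff_bijective]
  have hi : Function.Injective (T : Euc c →ₗ[ℝ] Euc c) :=
    (injective_iff_map_eq_zero _).2 h
  exact ⟨hi, LinearMap.injective_iff_surjective.1 hi⟩

/-- The perturbation of the identity is skew-symmetric, so `⟪v, twist L v⟫ = ‖v‖²`. -/
theorem isUnit_twist (L : GrIdx ℓ c → ℝ) : IsUnit (twist L) := by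
  refine isUnit_of_injective fun v hv => ?_
  have h1 : inner ℝ v (twist L v) = inner ℝ v v := by
    rw [twist_apply, inner_add_right, inner_sub_right, ← inner_calL_left, real_inner_comm,
      real_inner_comm v (calL L v)]
    ring
  rw [hv, inner_zero_right] at h1
  exact inner_self_eq_zero.1 h1.symm

theorem twist_inverse (L : GrIdx ℓ c → ℝ) (v : Euc c) :
    twist L (Ring.inverse (twist L) v) = v :=
  congrArg (fun T : Euc c →L[ℝ] Euc c => T v) (Ring.mul_inverse_cancel _ (isUnit_twist L))

/-- `twist L` carries the first `ℓ` coordinates to the graph and the other coordinates to its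
orthogonal complement, so it conjugates the two projections. The formula is smooth in `L`. -/
theorem starProjection_graphSub (L : GrIdx ℓ c → ℝ) :
    (graphSub L).starProjection = twist L * projTop ℓ c * Ring.inverse (twist L) := by
  ext1 v
  set w := Ring.inverse (twist L) v with hw
  have hv : v = twist L w := (twist_inverse L v).symm
  show _ = twist L (projTop ℓ c w)
  have hp : projTop ℓ c w ∈ botSub ℓ c := fun k hk => by simp [projTop_apply, hk]
  have h0 : ∀ u ∈ botSub ℓ c, calLt L u = 0 := by
    intro u hu
    ext k
    rw [calLt, opM_apply]
    refine Finset.sum_eq_zero fun j _ => ?_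
    by_cases hj : (j : ℕ) < ℓ
    · rw [Matrix.transpose_apply, matL_apply_top L hj, zero_mul]
    · rw [hu j hj, mul_zero]
  refine Submodule.eq_starProjection_of_mem_orthogonal ?_ ?_
  · rw [mem_graphSub]
    exact ⟨_, hp, by rw [twist_apply, h0 _ hp, sub_zero]⟩
  · rw [Submodule.mem_orthogonal]
    intro x hx
    obtain ⟨u, hu, rfl⟩ := mem_graphSub.1 hx
    rw [hv, ← map_sub]
    set y := w - projTop ℓ c w with hy
    have hy0 : ∀ k : Fin c, (k : ℕ) < ℓ → y k = 0 := fun k hk => by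
      simp [hy, projTop_apply, hk]
    have h1 : calL L y = 0 := by
      rw [calL_eq_of_top L (w := 0) fun k hk => by rw [hy0 k hk]; rfl, map_zero]
    have h2 : inner ℝ u y = 0 := by
      rw [inner_eq_sum]
      refine Finset.sum_eq_zero fun k _ => ?_
      by_cases hk : (k : ℕ) < ℓ
      · rw [hy0 k hk, mul_zero]
      · rw [hu k hk, zero_mul]
    have h3 : inner ℝ (calL L u) (calLt L y) = 0 := by
      rw [← inner_calL_left, calL_calL, inner_zero_left]
    rw [twist_apply, h1, zero_sub, inner_add_left, inner_add_right, inner_add_right,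
      inner_neg_right, inner_neg_right, h2, h3, inner_calL_left]
    ring

/-- The operator that has to be inverted to read the graph off from the projection. -/
noncomputable def topBlock (ℓ : ℕ) (P : Euc c →L[ℝ] Euc c) : Euc c →L[ℝ] Euc c :=
  projTop ℓ c * P * projTop ℓ c + (1 - projTop ℓ c)

/-- The coordinates of a subspace in the graph chart, in terms of the projection to it. -/
noncomputable def readGraph (ℓ : ℕ) (P : Euc c →L[ℝ] Euc c) : GrIdx ℓ c → ℝ := fun p =>
  (P * projTop ℓ c * Ring.inverse (topBlock ℓ P)) (EuclideanSpace.single p.1.2 1) p.1.1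

theorem topBlock_apply (P : Euc c →L[ℝ] Euc c) (v : Euc c) (k : Fin c) :
    topBlock ℓ P v k = if (k : ℕ) < ℓ then P (projTop ℓ c v) k else v k := by
  have : topBlock ℓ P v = projTop ℓ c (P (projTop ℓ c v)) + (v - projTop ℓ c v) := rfl
  rw [this, PiLp.add_apply, PiLp.sub_apply, projTop_apply, projTop_apply]
  split_ifs <;> simp

theorem sum_single_eq (v : Euc c) : v = ∑ j, v j • EuclideanSpace.single j (1 : ℝ) := by
  ext k
  simp [Finset.sum_apply, Pi.single_apply]

theorem calL_readGraph {P : Euc c →L[ℝ] Euc c} {u : Euc c} (hu : u ∈ botSub ℓ c) {k : Fin c}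
    (hk : ℓ ≤ (k : ℕ)) : calL (readGraph ℓ P) u k =
      P (projTop ℓ c (Ring.inverse (topBlock ℓ P) u)) k := by
  have h1 : P (projTop ℓ c (Ring.inverse (topBlock ℓ P) u)) =
    (P * projTop ℓ c * Ring.inverse (topBlock ℓ P)) u := rfl
  rw [h1]
  conv_rhs => rw [sum_single_eq u]
  rw [calL, opM_apply, map_sum, WithLp.ofLp_sum, Finset.sum_apply]
  refine Finset.sum_congr rfl fun j _ => ?_
  by_cases hj : (j : ℕ) < ℓ
  · rw [matL_apply, dif_pos ⟨hk, hj⟩, map_smul, PiLp.smul_apply, smul_eq_mul, mul_comm]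
    rfl
  · simp [hu j hj]

/-- When the top block is invertible, every `u` in the first `ℓ` coordinates is the top part of a
vector `P u'` of `E`, and `readGraph` records the bottom part. So the graph lies in `E`, and the
dimensions agree. -/
theorem graphSub_readGraph (hℓ : ℓ ≤ c) {E : Gr ℓ c} (hE : IsUnit (topBlock ℓ E.proj)) :
    graphGr hℓ (readGraph ℓ E.proj) = E := by
  apply Subtype.ext
  have hle : graphSub (readGraph ℓ E.proj) ≤ E.1 := by
    intro v hv
    obtain ⟨u, hu, rfl⟩ := mem_graphSub.1 hv
    set u' := Ring.inverse (topBlock ℓ E.proj) u with hu'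
    have h1 : topBlock ℓ E.proj u' = u :=
      congrArg (fun T : Euc c →L[ℝ] Euc c => T u) (Ring.mul_inverse_cancel _ hE)
    have h2 : u + calL (readGraph ℓ E.proj) u = E.proj (projTop ℓ c u') := by
      ext k
      rw [PiLp.add_apply]
      by_cases hk : (k : ℕ) < ℓ
      · rw [calL_apply_top _ _ hk, add_zero]
        conv_lhs => rw [← h1]
        rw [topBlock_apply, if_pos hk]
      · rw [calL_readGraph hu (not_lt.1 hk), hu k hk, zero_add]
    rw [h2]
    exact Submodule.starProjection_apply_mem _ _
  exact Submodule.eq_of_le_of_finrank_eq hle ((finrank_graphSub hℓ _).trans E.2.symm)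

/-- A kernel vector `v` lies in the first `ℓ` coordinates and `P v` has no component there, so `‖P
v‖² = ⟪P v, v⟫ = 0`. Then `v` is orthogonal to the graph, in particular to `v + calL L v`, whose
inner product with `v` is `‖v‖²`. -/
theorem isUnit_topBlock (hℓ : ℓ ≤ c) (L : GrIdx ℓ c → ℝ) :
    IsUnit (topBlock ℓ (graphGr hℓ L).proj) := by
  refine isUnit_of_injective fun v hv => ?_
  have hk := fun k => congrArg (fun w : Euc c => w k) hv
  simp only [topBlock_apply] at hk
  have hbot : v ∈ botSub ℓ c := fun k h => by simpa [h] using hk k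
  have hpv : projTop ℓ c v = v := by
    ext k
    rw [projTop_apply]
    split_ifs with h
    · rfl
    · exact (hbot k h).symm
  have h1 : inner ℝ ((graphGr hℓ L).proj v) v = 0 := by
    rw [inner_eq_sum]
    refine Finset.sum_eq_zero fun k _ => ?_
    by_cases h : (k : ℕ) < ℓ
    · have := hk k
      rw [if_pos h, hpv] at this
      rw [this]; simp
    · rw [hbot k h, mul_zero]
  have h2 : v ∈ (graphSub L)ᗮ := by
    rw [← Submodule.starProjection_apply_eq_zero_iff]
    have h3 : inner ℝ ((graphSub L).starProjection v) ((graphSub L).starProjection v) =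
        inner ℝ ((graphSub L).starProjection v) v := by
      have := Submodule.sub_starProjection_mem_orthogonal (K := graphSub L) v _
        (Submodule.starProjection_apply_mem _ v)
      rw [inner_sub_right] at this
      linarith
    exact inner_self_eq_zero.1 (h3.trans h1)
  have h4 : inner ℝ (v + calL L v) v = 0 := h2 _ (mem_graphSub.2 ⟨v, hbot, rfl⟩)
  have h5 : inner ℝ (calL L v) v = 0 := by
    rw [inner_eq_sum]
    refine Finset.sum_eq_zero fun k _ => ?_
    by_cases h : (k : ℕ) < ℓ
    · rw [calL_apply_top L v h, zero_mul]
    · rw [hbot k h, mul_zero]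
  rw [inner_add_left, h5, add_zero] at h4
  exact inner_self_eq_zero.1 h4

/-- `P u'` belongs to the graph and its top part is the basis vector `u`; its bottom part is
therefore `calL L u`. -/
theorem readGraph_graphGr (hℓ : ℓ ≤ c) (L : GrIdx ℓ c → ℝ) :
    readGraph ℓ (graphGr hℓ L).proj = L := by
  set P := (graphGr hℓ L).proj with hP
  funext p
  obtain ⟨⟨k, j⟩, hk, hj⟩ := p
  dsimp only at hk hj
  set u : Euc c := EuclideanSpace.single j 1 with hu
  set u' := Ring.inverse (topBlock ℓ P) u with hu'
  have h1 : topBlock ℓ P u' = u :=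
    congrArg (fun T : Euc c →L[ℝ] Euc c => T u)
      (Ring.mul_inverse_cancel _ (isUnit_topBlock hℓ L))
  show P (projTop ℓ c u') k = _
  obtain ⟨w, hw, hPw⟩ := mem_graphSub.1
    (Submodule.starProjection_apply_mem (graphSub L) (projTop ℓ c u'))
  have hPw' : P (projTop ℓ c u') = w + calL L w := hPw
  have hwu : calL L w = calL L u := by
    refine calL_eq_of_top L fun i hi => ?_
    have h2 := congrArg (fun v : Euc c => v i) h1
    simp only [topBlock_apply, if_pos hi] at h2
    rw [← h2, hPw', PiLp.add_apply, calL_apply_top L w hi, add_zero]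
  rw [hPw', hwu, PiLp.add_apply, hw k (by omega), zero_add, calL, opM_apply,
    Finset.sum_eq_single j]
  · rw [matL_apply, dif_pos ⟨hk, hj⟩]; simp [hu]
  · intro i _ hi
    simp [hu, hi]
  · simp

theorem contDiff_proj_graphGr (hℓ : ℓ ≤ c) :
    ContDiff ℝ 1 fun L : GrIdx ℓ c → ℝ => (graphGr hℓ L).proj := by
  have h1 : (fun L : GrIdx ℓ c → ℝ => (graphGr hℓ L).proj) =
      fun L => twist L * projTop ℓ c * Ring.inverse (twist L) :=
    funext starProjection_graphSub
  have h2 : ContDiff ℝ 1 (twist : (GrIdx ℓ c → ℝ) → _) :=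
    contDiff_const.add (contDiff_calL.sub contDiff_calLt)
  rw [h1, contDiff_iff_contDiffAt]
  intro L
  refine (h2.contDiffAt.mul contDiffAt_const).mul ?_
  have h3 := contDiffAt_ringInverse ℝ (n := 1) (isUnit_twist L).unit
  exact ContDiffAt.comp L h3 h2.contDiffAt

theorem contDiff_topBlock (ℓ : ℕ) :
    ContDiff ℝ 1 (topBlock ℓ : (Euc c →L[ℝ] Euc c) → _) :=
  ((contDiff_const.mul contDiff_id).mul contDiff_const).add contDiff_const

theorem contDiffAt_readGraph (hℓ : ℓ ≤ c) (L : GrIdx ℓ c → ℝ) :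
    ContDiffAt ℝ 1 (readGraph ℓ) (graphGr hℓ L).proj := by
  rw [contDiffAt_pi]
  intro p
  have h3 := contDiffAt_ringInverse ℝ (n := 1) (isUnit_topBlock hℓ L).unit
  have h4 : ContDiffAt ℝ 1 (fun P => Ring.inverse (topBlock ℓ P)) (graphGr hℓ L).proj :=
    ContDiffAt.comp (g := Ring.inverse) (graphGr hℓ L).proj h3 (contDiff_topBlock ℓ).contDiffAt
  have h5 : ContDiffAt ℝ 1 (fun P => P * projTop ℓ c * Ring.inverse (topBlock ℓ P))
      (graphGr hℓ L).proj := (contDiffAt_id.mul contDiffAt_const).mul h4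
  exact ((EuclideanSpace.proj p.1.1 : Euc c →L[ℝ] ℝ).contDiff.contDiffAt).comp _
    (h5.clm_apply contDiffAt_const)

/-- The chart of `ℝ^c × G(ℓ, c)`: a similarity in the first factor, graphs in the second. -/
noncomputable def hatChart (hℓ : ℓ ≤ c) (p : Euc c) (s : ℝ) (y : Euc c × (GrIdx ℓ c → ℝ)) :
    Euc c × Gr ℓ c := (p + s • y.1, graphGr hℓ y.2)

/-- The inverse of `hatChart`. -/
noncomputable def hatRetr (ℓ : ℕ) (p : Euc c) (s : ℝ) (w : Euc c × (Euc c →L[ℝ] Euc c)) :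
    Euc c × (GrIdx ℓ c → ℝ) := (s⁻¹ • (w.1 - p), readGraph ℓ w.2)

theorem isChart_similarity (p : Euc c) {s : ℝ} (hs : s ≠ 0) :
    IsChart (id : Euc c → Euc c) (fun y => p + s • y) fun w => s⁻¹ • (w - p) where
  contDiff := contDiff_const.add (contDiff_id.const_smul s)
  contDiffAt _ := (contDiffAt_id.sub contDiffAt_const).const_smul _
  left_inv y := by simp [hs]
  right_inv y := Filter.Eventually.of_forall fun w m hm => by simp [← hm, hs]

theorem isChart_hatChart (hℓ : ℓ ≤ c) (p : Euc c) {s : ℝ} (hs : s ≠ 0) :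
    IsChart (hatEmbedding ℓ c) (hatChart hℓ p s) (hatRetr ℓ p s) where
  contDiff := (contDiff_const.add (contDiff_fst.const_smul s)).prodMk
    ((contDiff_proj_graphGr hℓ).comp contDiff_snd)
  contDiffAt y := by
    refine ContDiffAt.prodMk ((contDiffAt_fst.sub contDiffAt_const).const_smul _) ?_
    exact ContDiffAt.comp (g := readGraph ℓ)
      (hatEmbedding ℓ c (hatChart hℓ p s y)) (contDiffAt_readGraph hℓ y.2) contDiffAt_snd
  left_inv y := by
    refine Prod.ext ?_ (readGraph_graphGr hℓ y.2)
    simp [hatRetr, hatEmbedding, hatChart, hs]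
  right_inv y := by
    have h1 : ∀ᶠ P in 𝓝 (graphGr hℓ y.2).proj, IsUnit (topBlock ℓ P) :=
      (contDiff_topBlock ℓ).continuous.continuousAt.eventually
        ((Units.isOpen (R := Euc c →L[ℝ] Euc c)).mem_nhds (isUnit_topBlock hℓ y.2))
    have h2 : ∀ᶠ w : Euc c × (Euc c →L[ℝ] Euc c) in
        𝓝 (hatEmbedding ℓ c (hatChart hℓ p s y)), IsUnit (topBlock ℓ w.2) :=
      (continuous_snd.tendsto (hatEmbedding ℓ c (hatChart hℓ p s y))).eventually h1
    filter_upwards [h2] with w hw m hm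
    rw [← hm] at hw ⊢
    refine Prod.ext ?_ (graphSub_readGraph hℓ hw)
    simp [hatRetr, hatEmbedding, hatChart, hs]

end GrChart

/-! ## The local model -/

/-- In the chart, base point and plane evolve independently, because the derivative of the local
model does not depend on the base point. This reduces the Grassmann bundle to its two factors. -/
theorem IsCodedSystem.prodMap {d : ℕ} {Y Y' : Type*} [NormedAddCommGroup Y] [NormedSpace ℝ Y]
    [NormedAddCommGroup Y'] [NormedSpace ℝ Y']
    {A : Fin d → Y →L[ℝ] Y} {b : Fin d → Y} {U K : Set Y} {T : Y →L[ℝ] Y} {Ys Yu : Submodule ℝ Y}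
    {A' : Fin d → Y' →L[ℝ] Y'} {b' : Fin d → Y'} {U' K' : Set Y'} {T' : Y' →L[ℝ] Y'}
    {Ys' Yu' : Submodule ℝ Y'}
    (h : IsCodedSystem A b U K T Ys Yu) (h' : IsCodedSystem A' b' U' K' T' Ys' Yu') :
    IsCodedSystem (fun i => (A i).prodMap (A' i)) (fun i => (b i, b' i)) (U ×ˢ U') (K ×ˢ K')
      (T.prodMap T') (Ys.prod Ys') (Yu.prod Yu') where
  exists_coding := by
    obtain ⟨S, h1, h2, h3, h4⟩ := h.exists_coding
    obtain ⟨S', h1', h2', h3', h4'⟩ := h'.exists_coding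
    refine ⟨fun ξ => (S ξ, S' ξ), h1.prodMk h1', fun ξ => ⟨h2 ξ, h2' ξ⟩,
      fun ξ => Prod.ext (h3 ξ) (h3' ξ), fun ξ y hy hK => Prod.ext ?_ ?_⟩
    · exact h4 ξ (fun n => (y n).1) (fun n => congrArg Prod.fst (hy n)) fun n => (hK n).1
    · exact h4' ξ (fun n => (y n).2) (fun n => congrArg Prod.snd (hy n)) fun n => (hK n).2
  exists_conj := by
    obtain ⟨g, k, h1, h2, h3, h4, h5⟩ := h.exists_conj
    obtain ⟨g', k', h1', h2', h3', h4', h5'⟩ := h'.exists_conj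
    exact ⟨fun ξ => (g ξ).prodMap (g' ξ), fun ξ => (k ξ).prodMap (k' ξ), h1.prod_mapL ℝ h1',
      h2.prod_mapL ℝ h2', fun ξ v => Prod.ext (h3 ξ v.1) (h3' ξ v.2),
      fun ξ v => Prod.ext (h4 ξ v.1) (h4' ξ v.2), fun ξ v => Prod.ext (h5 ξ v.1) (h5' ξ v.2)⟩
  isCompl := by
    constructor
    · rw [disjoint_iff, Submodule.prod_inf_prod, h.isCompl.inf_eq_bot, h'.isCompl.inf_eq_bot,
        Submodule.prod_bot]
    · rw [codisjoint_iff, Submodule.prod_sup_prod, h.isCompl.sup_eq_top, h'.isCompl.sup_eq_top,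
        Submodule.prod_top]
  map_stable := by
    conv_rhs => rw [← h.map_stable, ← h'.map_stable]
    ext ⟨x, y⟩
    constructor
    · rintro ⟨v, hv, h⟩
      obtain ⟨rfl, rfl⟩ := Prod.ext_iff.1 h
      exact ⟨⟨v.1, hv.1, rfl⟩, ⟨v.2, hv.2, rfl⟩⟩
    · rintro ⟨⟨v, hv, rfl⟩, ⟨w, hw, rfl⟩⟩
      exact ⟨(v, w), ⟨hv, hw⟩, rfl⟩
  map_unstable := by
    conv_rhs => rw [← h.map_unstable, ← h'.map_unstable]
    ext ⟨x, y⟩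
    constructor
    · rintro ⟨v, hv, h⟩
      obtain ⟨rfl, rfl⟩ := Prod.ext_iff.1 h
      exact ⟨⟨v.1, hv.1, rfl⟩, ⟨v.2, hv.2, rfl⟩⟩
    · rintro ⟨⟨v, hv, rfl⟩, ⟨w, hw, rfl⟩⟩
      exact ⟨(v, w), ⟨hv, hw⟩, rfl⟩
  bounds := by
    obtain ⟨ρ, h1, h2, h3, h4⟩ := h.bounds
    obtain ⟨ρ', h1', h2', h3', h4'⟩ := h'.bounds
    have h0 : 0 ≤ max ρ ρ' := h1.le.trans (le_max_left _ _)
    refine ⟨max ρ ρ', lt_of_lt_of_le h1 (le_max_left _ _), max_lt h2 h2', ?_, ?_⟩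
    · rintro v ⟨hv, hv'⟩
      exact max_le ((h3 _ hv).trans (mul_le_mul (le_max_left _ _) (norm_fst_le v)
        (norm_nonneg _) h0)) ((h3' _ hv').trans (mul_le_mul (le_max_right _ _) (norm_snd_le v)
        (norm_nonneg _) h0))
    · rintro v ⟨hv, hv'⟩
      have e1 := norm_fst_le (T.prodMap T' v)
      have e2 := norm_snd_le (T.prodMap T' v)
      exact max_le ((h4 _ hv).trans (mul_le_mul (le_max_left _ _) e1
        (norm_nonneg _) h0)) ((h4' _ hv').trans (mul_le_mul (le_max_right _ _) e2
        (norm_nonneg _) h0))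

theorem norm_le_of_abs_le {c : ℕ} {ρ : ℝ} (hρ : 0 ≤ ρ) {v w : Euc c}
    (h : ∀ k, |w k| ≤ ρ * |v k|) : ‖w‖ ≤ ρ * ‖v‖ := by
  refine abs_le_of_sq_le_sq' ?_ (by positivity) |>.2
  rw [mul_pow, EuclideanSpace.norm_sq_eq, EuclideanSpace.norm_sq_eq, Finset.mul_sum]
  refine Finset.sum_le_sum fun k _ => ?_
  rw [Real.norm_eq_abs, Real.norm_eq_abs, ← mul_pow]
  exact pow_le_pow_left₀ (abs_nonneg _) (h k) 2

theorem map_diagonal_coordSub {c : ℕ} (m : Fin c → ℝ) (hm : ∀ k, m k ≠ 0) (p : Fin c → Prop) :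
    (coordSub p).map (opM (Matrix.diagonal m) : Euc c →ₗ[ℝ] Euc c) = coordSub p := by
  ext v
  constructor
  · rintro ⟨w, hw, rfl⟩ k hk
    show opM _ w k = 0
    rw [opM_diagonal_apply, hw k hk, mul_zero]
  · intro hv
    refine ⟨WithLp.toLp 2 fun k => (m k)⁻¹ * v k, fun k hk => by simp [hv k hk], ?_⟩
    ext k
    show opM _ _ k = v k
    rw [opM_diagonal_apply]
    exact mul_inv_cancel_left₀ (hm k) _

/-- Sign patterns; they index the maps of the family. -/
abbrev Signs (c : ℕ) : Type := (Fin c → SignType) × (Fin c → Fin c → SignType)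

section LocalModel

variable {c : ℕ}

/-- The rates of the local model. -/
def rate (ℓ n : ℕ) (k : Fin c) : ℝ :=
  if (k : ℕ) < ℓ then 2 else if (k : ℕ) < ℓ + n then -1 else 1

/-- The shear of the local model. -/
def shear (ℓ n : ℕ) (σ : Signs c) : GrIdx ℓ c → ℝ := fun p =>
  (2 - rate ℓ n p.1.1) * (σ.2 p.1.1 p.1.2 : ℝ)

/-- The translation of the local model. -/
noncomputable def transl (ℓ n : ℕ) (σ : Signs c) : Euc c :=
  WithLp.toLp 2 fun k => if ℓ ≤ (k : ℕ) ∧ (k : ℕ) < ℓ + n then (σ.1 k : ℝ) else 0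

/-- The linear part of the vector field of the local model. -/
noncomputable def fieldLin (ℓ n : ℕ) (η : ℝ) (σ : Signs c) : Euc c →L[ℝ] Euc c :=
  opM (Matrix.diagonal (rate ℓ n)) + (2 * η) • calL (shear ℓ n σ)

/-- The affine vector field of the local model. -/
noncomputable def field (ℓ n : ℕ) (η δ : ℝ) (σ : Signs c) (y : Euc c) : Euc c :=
  fieldLin ℓ n η σ y + (2 * δ) • transl ℓ n σ

/-- The linear part of the local model. -/
noncomputable def modelLin (ℓ n : ℕ) (η a : ℝ) (σ : Signs c) : Euc c →L[ℝ] Euc c :=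
  ContinuousLinearMap.id ℝ _ + a • fieldLin ℓ n η σ

/-- The multipliers of the local model. -/
def mult (ℓ n : ℕ) (a : ℝ) (k : Fin c) : ℝ := 1 + a * rate ℓ n k

/-- The multipliers of the action of the local model on graphs. -/
noncomputable def grMult (ℓ n : ℕ) (a : ℝ) (p : GrIdx ℓ c) : ℝ :=
  mult ℓ n a p.1.1 / (1 + 2 * a)

/-- The diagonal part of the action of the local model on graphs. -/
noncomputable def grLin (ℓ n : ℕ) (a : ℝ) : (GrIdx ℓ c → ℝ) →L[ℝ] (GrIdx ℓ c → ℝ) :=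
  ContinuousLinearMap.pi fun p => grMult ℓ n a p • ContinuousLinearMap.proj p

/-- The translation part of the action of the local model on graphs. -/
noncomputable def grTransl (ℓ n : ℕ) (η a : ℝ) (σ : Signs c) : GrIdx ℓ c → ℝ := fun p =>
  a * (2 * η) * shear ℓ n σ p / (1 + 2 * a)

/-- An open box. -/
def box {ι : Type*} (r : ℝ) : Set (ι → ℝ) := {y | ∀ k, |y k| < r}

/-- A closed box. -/
def cbox {ι : Type*} (r : ℝ) : Set (ι → ℝ) := {y | ∀ k, |y k| ≤ r}

/-- An open box in the Euclidean space. -/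
def ebox (c : ℕ) (r : ℝ) : Set (Euc c) := {y | ∀ k, |y k| < r}

/-- A closed box in the Euclidean space. -/
def ecbox (c : ℕ) (r : ℝ) : Set (Euc c) := {y | ∀ k, |y k| ≤ r}

variable {ℓ n : ℕ} {η δ a : ℝ}

theorem rate_of_lt {k : Fin c} (h : (k : ℕ) < ℓ) : rate ℓ n k = 2 := if_pos h

theorem rate_of_mem {k : Fin c} (h : ℓ ≤ (k : ℕ) ∧ (k : ℕ) < ℓ + n) : rate ℓ n k = -1 := by
  rw [rate, if_neg (by omega), if_pos h.2]

theorem rate_of_le {k : Fin c} (h : ℓ + n ≤ (k : ℕ)) : rate ℓ n k = 1 := by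
  rw [rate, if_neg (by omega), if_neg (by omega)]

theorem rate_cases (ℓ n : ℕ) (k : Fin c) :
    ((k : ℕ) < ℓ ∧ rate ℓ n k = 2) ∨ ((ℓ ≤ (k : ℕ) ∧ (k : ℕ) < ℓ + n) ∧ rate ℓ n k = -1) ∨
      (ℓ + n ≤ (k : ℕ) ∧ rate ℓ n k = 1) := by
  rcases lt_or_ge (k : ℕ) ℓ with h | h
  · exact Or.inl ⟨h, rate_of_lt h⟩
  rcases lt_or_ge (k : ℕ) (ℓ + n) with h' | h'
  · exact Or.inr (Or.inl ⟨⟨h, h'⟩, rate_of_mem ⟨h, h'⟩⟩)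
  · exact Or.inr (Or.inr ⟨h', rate_of_le h'⟩)

theorem rate_of_ge {k : Fin c} (h : ℓ ≤ (k : ℕ)) : rate ℓ n k = -1 ∨ rate ℓ n k = 1 := by
  rcases rate_cases ℓ n k with h' | h' | h'
  · omega
  · exact Or.inl h'.2
  · exact Or.inr h'.2

theorem abs_sign_le (s : SignType) : |(s : ℝ)| ≤ 1 := by
  cases s <;> simp

theorem mult_pos (ha : |a| < 1 / 16) (k : Fin c) : 0 < mult ℓ n a k := by
  rw [abs_lt] at ha
  rcases rate_cases ℓ n k with h | h | h <;> rw [mult, h.2] <;> linarith [ha.1, ha.2]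

theorem mult_ne_one (ha0 : a ≠ 0) (k : Fin c) : mult ℓ n a k ≠ 1 := by
  rcases rate_cases ℓ n k with h | h | h <;> rw [mult, h.2] <;> intro h' <;>
    exact ha0 (by linarith)

theorem grMult_pos (ha : |a| < 1 / 16) (p : GrIdx ℓ c) : 0 < grMult ℓ n a p := by
  have := mult_pos (ℓ := ℓ) (n := n) ha p.1.1
  rw [abs_lt] at ha
  exact div_pos this (by linarith)

/-- As `2 - rate` is 1 or 3 on the rows of the chart, the sign is that of `a`: this is where the
dominance of the first `ℓ` rates makes graphs contract for `a > 0` and expand for `a < 0`. -/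
theorem one_sub_grMult (ha : |a| < 1 / 16) (p : GrIdx ℓ c) :
    1 - grMult ℓ n a p = a * (2 - rate ℓ n p.1.1) / (1 + 2 * a) := by
  rw [abs_lt] at ha
  have : 1 + 2 * a ≠ 0 := by linarith
  rw [grMult, mult, eq_div_iff this, sub_mul, div_mul_cancel₀ _ this]
  ring

theorem grMult_ne_one (ha : |a| < 1 / 16) (ha0 : a ≠ 0) (p : GrIdx ℓ c) :
    grMult ℓ n a p ≠ 1 := by
  intro h
  have h1 := one_sub_grMult (n := n) ha p
  rw [h, sub_self, eq_comm, div_eq_zero_iff] at h1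
  rw [abs_lt] at ha
  rcases rate_of_ge (n := n) p.2.1 with h2 | h2 <;> rw [h2] at h1 <;> rcases h1 with h1 | h1 <;>
    exact ha0 (by linarith)

/-- The factor `2 - rate` in `shear` is chosen to cancel the same factor in `1 - grMult`, so that
the bounded solutions stay within `2 * η` for all rates. -/
theorem abs_grTransl_le (ha : |a| < 1 / 16) (hη : 0 ≤ η) (σ : Signs c) (p : GrIdx ℓ c) :
    |grTransl ℓ n η a σ p| ≤ 2 * η * |1 - grMult ℓ n a p| := by
  rw [one_sub_grMult ha]
  have h1 : grTransl ℓ n η a σ p =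
      (2 * η) * (a * (2 - rate ℓ n p.1.1) / (1 + 2 * a)) * (σ.2 p.1.1 p.1.2 : ℝ) := by
    rw [grTransl, shear]; ring
  rw [h1, abs_mul, abs_mul, abs_of_nonneg (by positivity : 0 ≤ 2 * η)]
  exact mul_le_of_le_one_right (by positivity) (abs_sign_le _)

theorem grLin_apply (L : GrIdx ℓ c → ℝ) (p : GrIdx ℓ c) :
    grLin ℓ n a L p = grMult ℓ n a p * L p := rfl

theorem modelLin_apply (σ : Signs c) (v : Euc c) (k : Fin c) :
    modelLin ℓ n η a σ v k = mult ℓ n a k * v k + a * (2 * η) * calL (shear ℓ n σ) v k := by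
  have : modelLin ℓ n η a σ v = v + a • (opM (Matrix.diagonal (rate ℓ n)) v +
    (2 * η) • calL (shear ℓ n σ) v) := rfl
  rw [this]
  simp only [PiLp.add_apply, PiLp.smul_apply, smul_eq_mul, opM_diagonal_apply, mult]
  ring

theorem transl_apply (σ : Signs c) (k : Fin c) :
    transl ℓ n σ k = if ℓ ≤ (k : ℕ) ∧ (k : ℕ) < ℓ + n then (σ.1 k : ℝ) else 0 := rfl

theorem exists_grCoding {d : ℕ} (σ : Fin d → Signs c) (ha : |a| < 1 / 16) (ha0 : a ≠ 0)
    (hη : 0 ≤ η) :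
    ∃ Λ : (ℤ → Fin d) → GrIdx ℓ c → ℝ, Continuous Λ ∧
      (∀ ξ, Λ (shiftPerm d ξ) = grLin ℓ n a (Λ ξ) + grTransl ℓ n η a (σ (ξ 0))) ∧
      ∀ ξ p, |Λ ξ p| ≤ 2 * η := by
  choose s h1 h2 h3 using fun p : GrIdx ℓ c => exists_bounded_solution (d := d)
    (grMult_pos (n := n) ha p) (grMult_ne_one ha ha0 p) (fun i => grTransl ℓ n η a (σ i) p)
    (fun i => abs_grTransl_le ha hη (σ i) p)
  exact ⟨fun ξ p => s p ξ, continuous_pi h1, fun ξ => funext fun p => h2 p ξ, fun ξ p => h3 p ξ⟩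

theorem exists_grBounds_pos (ha : |a| < 1 / 16) (hpos : 0 < a) (L : GrIdx ℓ c → ℝ) :
    ‖grLin ℓ n a L‖ ≤ (1 - |a| / 2) * ‖L‖ := by
  rw [abs_of_pos hpos] at *
  refine (pi_norm_le_iff_of_nonneg (mul_nonneg (by linarith) (norm_nonneg _))).2 fun p => ?_
  rw [grLin_apply, norm_mul, Real.norm_of_nonneg (grMult_pos (by rwa [abs_of_pos hpos]) p).le]
  refine mul_le_mul ?_ (norm_le_pi_norm L p) (norm_nonneg _) (by linarith)
  rw [grMult, mult, div_le_iff₀ (by linarith)]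
  rcases rate_of_ge (n := n) p.2.1 with h | h <;> rw [h] <;> nlinarith

theorem exists_grBounds_neg (ha : |a| < 1 / 16) (hneg : a < 0) (L : GrIdx ℓ c → ℝ) :
    ‖L‖ ≤ (1 - |a| / 2) * ‖grLin ℓ n a L‖ := by
  rw [abs_of_neg hneg] at *
  refine (pi_norm_le_iff_of_nonneg (mul_nonneg (by linarith) (norm_nonneg _))).2 fun p => ?_
  refine le_trans ?_ (mul_le_mul_of_nonneg_left (norm_le_pi_norm (grLin ℓ n a L) p) (by linarith))
  rw [grLin_apply, norm_mul, Real.norm_of_nonneg (grMult_pos (by rwa [abs_of_neg hneg]) p).le,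
    ← mul_assoc]
  refine le_mul_of_one_le_left (norm_nonneg _) ?_
  rw [grMult, mult, mul_div_assoc', one_le_div (by linarith)]
  rcases rate_of_ge (n := n) p.2.1 with h | h <;> rw [h] <;> nlinarith

theorem isUnit_grLin_map (ha : |a| < 1 / 16) :
    (⊤ : Submodule ℝ (GrIdx ℓ c → ℝ)).map 
      (grLin (c := c) ℓ n a : (GrIdx ℓ c → ℝ) →ₗ[ℝ] (GrIdx ℓ c → ℝ)) = ⊤ := by
  rw [eq_top_iff]
  intro L _
  refine ⟨fun p => (grMult ℓ n a p)⁻¹ * L p, trivial, ?_⟩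
  funext p
  exact mul_inv_cancel_left₀ (grMult_pos ha p).ne' _

/-- The action of the local model on graphs is coded by the full shift. -/
theorem isCodedSystem_gr {d : ℕ} (σ : Fin d → Signs c) (ha : |a| < 1 / 16) (ha0 : a ≠ 0)
    (hη : 0 < η) {P Q : Submodule ℝ (GrIdx ℓ c → ℝ)}
    (hPQ : (0 < a ∧ P = ⊤ ∧ Q = ⊥) ∨ (a < 0 ∧ P = ⊥ ∧ Q = ⊤)) :
    IsCodedSystem (fun _ : Fin d => grLin ℓ n a) (fun i => grTransl ℓ n η a (σ i))
      (box (3 * η)) (cbox (3 * η)) (grLin ℓ n a) P Q where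
  exists_coding := by
    obtain ⟨Λ, h1, h2, h3⟩ := exists_grCoding (ℓ := ℓ) (n := n) σ ha ha0 hη.le
    refine ⟨Λ, h1, fun ξ p => lt_of_le_of_lt (h3 ξ p) (by linarith), h2, fun ξ y hy hK => ?_⟩
    funext p
    have := eq_of_bounded_orbits (grMult_pos (n := n) ha p) (grMult_ne_one ha ha0 p)
      (fun n' => grTransl ℓ n η a (σ (ξ n')) p) (fun n' => y n' p)
      (fun n' => Λ ((shiftPerm d ^ n') ξ) p) (fun n' => congrFun (hy n') p) (fun n' => ?_)
      (fun n' => hK n' p) (fun n' => h3 _ p) 0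
    · simpa using this
    · rw [add_comm n', zpow_add, zpow_one, Equiv.Perm.mul_apply, h2, shiftPerm_zpow_apply,
        zero_add]
      rfl
  exists_conj := ⟨fun _ => ContinuousLinearMap.id ℝ _, fun _ => ContinuousLinearMap.id ℝ _,
    continuous_const, continuous_const, fun _ _ => rfl, fun _ _ => rfl, fun _ _ => rfl⟩
  isCompl := by
    rcases hPQ with ⟨-, rfl, rfl⟩ | ⟨-, rfl, rfl⟩
    · exact isCompl_top_bot
    · exact isCompl_bot_top
  map_stable := by
    rcases hPQ with ⟨-, rfl, rfl⟩ | ⟨-, rfl, rfl⟩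
    · exact isUnit_grLin_map ha
    · exact Submodule.map_bot _
  map_unstable := by
    rcases hPQ with ⟨-, rfl, rfl⟩ | ⟨-, rfl, rfl⟩
    · exact Submodule.map_bot _
    · exact isUnit_grLin_map ha
  bounds := by
    refine ⟨1 - |a| / 2, by linarith, by linarith [abs_pos.2 ha0], fun v hv => ?_, fun v hv => ?_⟩
    · rcases hPQ with ⟨h, rfl, rfl⟩ | ⟨h, rfl, rfl⟩
      · exact exists_grBounds_pos ha h v
      · rw [(Submodule.mem_bot ℝ).1 hv]; simp
    · rcases hPQ with ⟨h, rfl, rfl⟩ | ⟨h, rfl, rfl⟩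
      · rw [(Submodule.mem_bot ℝ).1 hv]; simp
      · exact exists_grBounds_neg ha h v

theorem calL_eq_zero (L : GrIdx ℓ c → ℝ) {v : Euc c} (h : ∀ k : Fin c, (k : ℕ) < ℓ → v k = 0) :
    calL L v = 0 := by
  rw [calL_eq_of_top L (w := 0) fun k hk => by rw [h k hk]; rfl, map_zero]

/-- The local model is coded by the full shift. -/
theorem isCodedSystem_model {d : ℕ} (σ : Fin d → Signs c) (ha : |a| < 1 / 16) (ha0 : a ≠ 0)
    (hη : 0 ≤ η) (hδ : 0 < δ) :
    IsCodedSystem (fun i => modelLin ℓ n η a (σ i)) (fun i => (a * (2 * δ)) • transl ℓ n (σ i))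
      (ebox c (3 * δ)) (ecbox c (3 * δ)) (opM (Matrix.diagonal (mult ℓ n a)))
      (coordSub fun k => a * rate ℓ n k < 0) (coordSub fun k => 0 < a * rate ℓ n k) where
  exists_coding := by
    choose s h1 h2 h3 using fun k : Fin c => exists_bounded_solution (d := d)
      (mult_pos (ℓ := ℓ) (n := n) ha k) (mult_ne_one ha0 k)
      -- There is no translation in the first `ℓ` coordinates; bound 0 forces the coded points to
      -- vanish there, so the shear does not act on them.
      (β := if (k : ℕ) < ℓ then 0 else 2 * δ)
      (fun i => a * (2 * δ) * transl ℓ n (σ i) k) (fun i => by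
        rw [transl_apply]
        split_ifs with hk hk' hk'
        · omega
        · have h4 : |1 - mult ℓ n a k| = |a| := by rw [mult, rate_of_mem hk]; congr 1; ring
          rw [abs_mul, abs_mul, abs_of_pos (by positivity : 0 < 2 * δ), h4, mul_comm |a|]
          exact mul_le_of_le_one_right (by positivity) (abs_sign_le _)
        · simp
        · rw [mul_zero, abs_zero]; positivity)
    have h3' : ∀ ξ k, |s k ξ| ≤ 2 * δ := fun ξ k => (h3 k ξ).trans (by
      split_ifs
      · positivity
      · exact le_rfl)
    have h0 : ∀ ξ (k : Fin c), (k : ℕ) < ℓ → s k ξ = 0 := fun ξ k hk => by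
      have := h3 k ξ
      rw [if_pos hk] at this
      exact abs_nonpos_iff.1 this
    refine ⟨fun ξ => WithLp.toLp 2 fun k => s k ξ,
      (PiLp.continuous_toLp 2 _).comp (continuous_pi h1),
      fun ξ k => lt_of_le_of_lt (h3' ξ k) (by linarith), fun ξ => ?_, fun ξ y hy hK => ?_⟩
    · ext k
      rw [PiLp.add_apply, modelLin_apply, calL_eq_zero _ (h0 ξ), PiLp.smul_apply]
      show s k _ = _ * s k ξ + _ * 0 + _
      rw [h2, smul_eq_mul, mul_zero, add_zero]
    · have hy' : ∀ n' k, y (n' + 1) k = mult ℓ n a k * y n' k +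
          a * (2 * η) * calL (shear ℓ n (σ (ξ n'))) (y n') k +
            a * (2 * δ) * transl ℓ n (σ (ξ n')) k := by
        intro n' k
        rw [hy, PiLp.add_apply, modelLin_apply]
        rfl
      -- The first `ℓ` coordinates obey a linear recursion of their own, so they vanish on bounded
      -- orbits. The shear term then drops out and the other coordinates decouple.
      have hy0 : ∀ n' (k : Fin c), (k : ℕ) < ℓ → y n' k = 0 := by
        intro n' k hk
        refine eq_zero_of_bounded_orbit (mult_pos (ℓ := ℓ) (n := n) ha k) (mult_ne_one ha0 k)
          (fun n' => y n' k) (fun n' => ?_) (fun n' => hK n' k) n'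
        rw [hy', calL_apply_top _ _ hk, transl_apply, if_neg (by omega), mul_zero, mul_zero,
          add_zero, add_zero]
      ext k
      have := eq_of_bounded_orbits (mult_pos (ℓ := ℓ) (n := n) ha k) (mult_ne_one ha0 k)
        (fun n' => a * (2 * δ) * transl ℓ n (σ (ξ n')) k) (fun n' => y n' k)
        (fun n' => s k ((shiftPerm d ^ n') ξ)) (fun n' => ?_) (fun n' => ?_)
        (fun n' => hK n' k) (fun n' => h3' _ k) 0
      · simpa using this
      · rw [hy', calL_eq_zero _ (hy0 n')]
        simp
      · rw [add_comm n', zpow_add, zpow_one, Equiv.Perm.mul_apply, h2, shiftPerm_zpow_apply,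
          zero_add]
  exists_conj := by
    -- The invariant planes are the graphs of `Λ ξ`. The unipotent map `id + calL (Λ ξ)` sends the
    -- coordinate plane to them and removes the shear from the cocycle.
    obtain ⟨Λ, h1, h2, h3⟩ := exists_grCoding (ℓ := ℓ) (n := n) σ ha ha0 hη
    have hc : Continuous fun ξ => calL (Λ ξ) := (contDiff_calL (n := 0)).continuous.comp h1
    refine ⟨fun ξ => ContinuousLinearMap.id ℝ _ + calL (Λ ξ),
      fun ξ => ContinuousLinearMap.id ℝ _ - calL (Λ ξ), continuous_const.add hc,
      continuous_const.sub hc, fun ξ v => ?_, fun ξ v => ?_, fun ξ v => ?_⟩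
    · show v + calL (Λ ξ) v - calL (Λ ξ) (v + calL (Λ ξ) v) = v
      rw [map_add, calL_calL]; abel
    · show v - calL (Λ ξ) v + calL (Λ ξ) (v - calL (Λ ξ) v) = v
      rw [map_sub, calL_calL]; abel
    · show modelLin ℓ n η a (σ (ξ 0)) (v + calL (Λ ξ) v) =
        opM _ v + calL (Λ (shiftPerm d ξ)) (opM _ v)
      ext k
      rw [modelLin_apply, map_add, calL_calL, add_zero, PiLp.add_apply, PiLp.add_apply,
        opM_diagonal_apply, mul_add, add_assoc]
      congr 1
      rw [calL, calL, calL, opM_apply, opM_apply, opM_apply, Finset.mul_sum, Finset.mul_sum,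
        ← Finset.sum_add_distrib]
      refine Finset.sum_congr rfl fun j _ => ?_
      rw [opM_diagonal_apply, matL_apply, matL_apply, matL_apply]
      split_ifs with hkj
      · rw [h2]
        have h4 : mult ℓ n a j = 1 + 2 * a := by rw [mult, rate_of_lt hkj.2]; ring
        have h5 : 1 + 2 * a ≠ 0 := by rw [abs_lt] at ha; linarith
        rw [h4, Pi.add_apply, grLin_apply, grMult, grTransl]
        dsimp only
        generalize 1 + 2 * a = w at h5
        field_simp
      · simp
  isCompl := isCompl_coordSub _ _ fun k => by
    have : a * rate ℓ n k ≠ 0 := by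
      rcases rate_cases ℓ n k with h | h | h <;> rw [h.2] <;> simpa using ha0
    rw [not_lt]
    exact ⟨fun h => h.le, fun h => lt_of_le_of_ne h this.symm⟩
  map_stable := map_diagonal_coordSub _ (fun k => (mult_pos ha k).ne') _
  map_unstable := map_diagonal_coordSub _ (fun k => (mult_pos ha k).ne') _
  bounds := by
    have ha1 := abs_pos.2 ha0
    refine ⟨1 - |a| / 2, by linarith, by linarith, fun v hv => ?_, fun v hv => ?_⟩
    · refine norm_le_of_abs_le (by linarith) fun k => ?_
      by_cases hk : a * rate ℓ n k < 0
      · rw [opM_diagonal_apply, abs_mul, abs_of_pos (mult_pos ha k)]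
        refine mul_le_mul_of_nonneg_right ?_ (abs_nonneg _)
        have : |a| ≤ |a * rate ℓ n k| := by
          rcases rate_cases ℓ n k with h | h | h <;> rw [h.2, abs_mul] <;> norm_num
          linarith
        rw [abs_of_neg hk] at this
        rw [mult]; linarith
      · rw [opM_diagonal_apply, hv k hk]; simp
    · refine norm_le_of_abs_le (by linarith) fun k => ?_
      by_cases hk : 0 < a * rate ℓ n k
      · rw [opM_diagonal_apply, abs_mul, abs_of_pos (mult_pos ha k), ← mul_assoc]
        refine le_mul_of_one_le_left (abs_nonneg _) ?_
        have : |a| ≤ |a * rate ℓ n k| := by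
          rcases rate_cases ℓ n k with h | h | h <;> rw [h.2, abs_mul] <;> norm_num
          linarith
        rw [abs_of_pos hk] at this
        rw [mult]; nlinarith
      · rw [opM_diagonal_apply, hv k hk]; simp

end LocalModel

/-! ### Diffeomorphisms that realize the local model: frames and coverings. -/

section LocalModel

variable {c : ℕ} {ℓ n : ℕ} {η δ a : ℝ}

theorem isOpen_ebox (r : ℝ) : IsOpen (ebox c r) := by
  have : ebox c r = ⋂ k, {y : Euc c | |y k| < r} := by ext; simp [ebox]
  rw [this]
  exact isOpen_iInter_of_finite fun k =>
    isOpen_lt (by fun_prop) continuous_const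

theorem isOpen_box {ι : Type*} [Finite ι] (r : ℝ) : IsOpen (box r : Set (ι → ℝ)) := by
  have : (box r : Set (ι → ℝ)) = ⋂ k, {y : ι → ℝ | |y k| < r} := by ext; simp [box]
  rw [this]
  exact isOpen_iInter_of_finite fun k =>
    isOpen_lt (by fun_prop) continuous_const

theorem isCompact_cbox {ι : Type*} (r : ℝ) : IsCompact (cbox r : Set (ι → ℝ)) := by
  have : (cbox r : Set (ι → ℝ)) = univ.pi fun _ => Icc (-r) r := by
    ext
    simp only [cbox, abs_le, mem_ofPred_eq, mem_univ_pi, mem_Icc]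
  rw [this]
  exact isCompact_univ_pi fun _ => isCompact_Icc

theorem isCompact_ecbox (r : ℝ) : IsCompact (ecbox c r) := by
  have : ecbox c r = (WithLp.toLp 2) '' (cbox r : Set (Fin c → ℝ)) := by
    ext y
    constructor
    · intro hy; exact ⟨fun k => y k, hy, rfl⟩
    · rintro ⟨z, hz, rfl⟩; exact hz
  rw [this]
  exact (isCompact_cbox r).image (PiLp.continuous_toLp 2 _)

/-- In the similarity chart with centre `p` and scale `s`, the map `f` is the local model. -/
def IsLocalModel (ℓ n : ℕ) (η δ a : ℝ) (p : Euc c) (s : ℝ) (f : Euc c → Euc c)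
    (σ : Signs c) : Prop :=
  ∀ y ∈ ebox c (4 * δ), f (p + s • y) = p + s • (y + a • field ℓ n η δ σ y)

theorem IsLocalModel.apply {p : Euc c} {s : ℝ} {f : Euc c → Euc c} {σ : Signs c}
    (h : IsLocalModel ℓ n η δ a p s f σ) {y : Euc c} (hy : y ∈ ebox c (4 * δ)) :
    f (p + s • y) = p + s • (modelLin ℓ n η a σ y + (a * (2 * δ)) • transl ℓ n σ) := by
  rw [h y hy, field, smul_add a, ← mul_smul, ← add_assoc]
  rfl

theorem IsLocalModel.hasFDerivAt {p : Euc c} {s : ℝ} (hs : s ≠ 0) {f : Euc c → Euc c}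
    {σ : Signs c} (h : IsLocalModel ℓ n η δ a p s f σ) {y : Euc c} (hy : y ∈ ebox c (4 * δ)) :
    HasFDerivAt f (modelLin ℓ n η a σ) (p + s • y) := by
  have h1 : HasFDerivAt (fun x => p + s • (modelLin ℓ n η a σ (s⁻¹ • (x - p)) +
      (a * (2 * δ)) • transl ℓ n σ)) (s • (modelLin ℓ n η a σ).comp
        (s⁻¹ • ContinuousLinearMap.id ℝ (Euc c))) (p + s • y) := by
    refine HasFDerivAt.const_add _ (HasFDerivAt.const_smul (HasFDerivAt.add_const _ ?_) s)
    exact (ContinuousLinearMap.hasFDerivAt _).comp _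
      (((hasFDerivAt_id _).sub_const p).const_smul s⁻¹)
  have h2 : s • (modelLin ℓ n η a σ).comp (s⁻¹ • ContinuousLinearMap.id ℝ (Euc c)) =
      modelLin ℓ n η a σ := by
    ext1 v
    simp [hs]
  rw [h2] at h1
  refine h1.congr_of_eventuallyEq ?_
  have h3 : ∀ᶠ x in 𝓝 (p + s • y), s⁻¹ • (x - p) ∈ ebox c (4 * δ) := by
    have : Continuous fun x : Euc c => s⁻¹ • (x - p) := by fun_prop
    refine this.continuousAt.eventually ((isOpen_ebox _).mem_nhds ?_)
    simpa [hs] using hy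
  filter_upwards [h3] with x hx
  have := h.apply hx
  rw [← this]
  simp [hs]

/-- The top part `u` of a graph vector becomes `(1 + 2 * a) • u`; dividing the new bottom part by
this factor gives the affine action on `L`. -/
theorem map_modelLin_graphSub (ha : |a| < 1 / 16) (σ : Signs c)
    (L : GrIdx ℓ c → ℝ) :
    (graphSub L).map (modelLin ℓ n η a σ : Euc c →ₗ[ℝ] Euc c) ≤
      graphSub (grLin ℓ n a L + grTransl ℓ n η a σ) := by
  rintro _ ⟨v, hv, rfl⟩
  obtain ⟨u, hu, rfl⟩ := mem_graphSub.1 hv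
  have h5 : 1 + 2 * a ≠ 0 := by rw [abs_lt] at ha; linarith
  rw [mem_graphSub]
  refine ⟨(1 + 2 * a) • u, Submodule.smul_mem _ _ hu, ?_⟩
  ext k
  show modelLin ℓ n η a σ (u + calL L u) k = _
  rw [modelLin_apply, map_add, calL_calL, add_zero, PiLp.add_apply, PiLp.add_apply,
    PiLp.smul_apply, map_smul, PiLp.smul_apply, smul_eq_mul, smul_eq_mul]
  by_cases hk : (k : ℕ) < ℓ
  · rw [calL_apply_top _ _ hk, calL_apply_top _ _ hk, calL_apply_top _ _ hk, mult, rate_of_lt hk]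
    ring
  · rw [hu k hk, zero_add, mul_zero, zero_add]
    rw [calL, calL, calL, opM_apply, opM_apply, opM_apply, Finset.mul_sum, Finset.mul_sum,
      Finset.mul_sum, ← Finset.sum_add_distrib]
    refine Finset.sum_congr rfl fun j _ => ?_
    rw [matL_apply, matL_apply, matL_apply]
    split_ifs with hkj
    · rw [Pi.add_apply, grLin_apply, grMult, grTransl]
      dsimp only
      generalize 1 + 2 * a = w at h5
      field_simp
    · simp

theorem hatPerm_hatChart {r : ℕ∞} (hr : 2 ≤ r) (hℓ : ℓ ≤ c) {p : Euc c} {s : ℝ} (hs : s ≠ 0)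
    (ha : |a| < 1 / 16) {f : Diffeo c r} {σ : Signs c} (h : IsLocalModel ℓ n η δ a p s f σ)
    {y : Euc c × (GrIdx ℓ c → ℝ)} (hy : y.1 ∈ ebox c (4 * δ)) :
    hatPerm hr ℓ f (hatChart hℓ p s y) = hatChart hℓ p s
      ((modelLin ℓ n η a σ).prodMap (grLin ℓ n a) y +
        ((a * (2 * δ)) • transl ℓ n σ, grTransl ℓ n η a σ)) := by
  refine Prod.ext (h.apply hy) (Subtype.ext ?_)
  show (graphSub y.2).map _ = graphSub _
  have hf : fderiv ℝ f (hatChart hℓ p s y).1 = modelLin ℓ n η a σ :=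
    (h.hasFDerivAt hs hy).fderiv
  rw [hf]
  refine Submodule.eq_of_le_of_finrank_eq (map_modelLin_graphSub ha σ y.2) ?_
  rw [finrank_graphSub hℓ, ← hf, Diffeo.finrank_map_fderiv hr,
    finrank_graphSub hℓ]

theorem ebox_subset_ecbox {r r' : ℝ} (h : r ≤ r') : ebox c r ⊆ ecbox c r' :=
  fun _ hy k => (hy k).le.trans h

theorem ecbox_subset_ebox {r r' : ℝ} (h : r < r') : ecbox c r ⊆ ebox c r' :=
  fun _ hy k => lt_of_le_of_lt (hy k) h

theorem box_subset_cbox {ι : Type*} {r r' : ℝ} (h : r ≤ r') : (box r : Set (ι → ℝ)) ⊆ cbox r' :=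
  fun _ hy k => (hy k).le.trans h

theorem cbox_subset_box {ι : Type*} {r r' : ℝ} (h : r < r') : (cbox r : Set (ι → ℝ)) ⊆ box r' :=
  fun _ hy k => lt_of_le_of_lt (hy k) h

theorem zero_mem_ebox {r : ℝ} (h : 0 < r) : (0 : Euc c) ∈ ebox c r := fun k => by simpa using h

theorem zero_mem_box {ι : Type*} {r : ℝ} (h : 0 < r) : (0 : ι → ℝ) ∈ box r :=
  fun k => by simpa using h

variable {d : ℕ} [Nonempty (Fin d)] {r : ℕ∞} {φ : Fin d → Diffeo c r} {σ : Fin d → Signs c}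
  {p : Euc c} {s ν α : ℝ}

/-- The coded orbits stay within `2 * δ`, hence inside the box of radius `3 * δ` that serves as `D`,
while the model is valid up to `4 * δ`. -/
theorem isBlendingFrame_model (hs : s ≠ 0) (ha : |a| < 1 / 16) (ha0 : a ≠ 0) (hη : 0 < η)
    (hδ : 0 < δ) (h : ∀ i, IsLocalModel ℓ n η δ a p s (φ i) (σ i))
    (hPH : IsPHS ν α fun i => (φ i).toEquiv) :
    IsBlendingFrame ν α (id : Euc c → Euc c) (fun i => (φ i).toEquiv)
      ((fun y => p + s • y) '' ebox c δ) ((fun y => p + s • y) '' ebox c (3 * δ))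
      (Finset.univ.filter fun k : Fin c => a * rate ℓ n k < 0).card
      (Finset.univ.filter fun k : Fin c => 0 < a * rate ℓ n k).card := by
  have := (isCodedSystem_model (ℓ := ℓ) (n := n) σ ha ha0 hη.le hδ).isBlendingFrame
    isometry_id (isChart_similarity p hs) (isOpen_ebox δ) ⟨0, zero_mem_ebox hδ⟩
    (isOpen_ebox (3 * δ)) (isOpen_ebox (4 * δ)) (isCompact_ecbox δ) (isCompact_ecbox (3 * δ))
    (ebox_subset_ecbox le_rfl) (ecbox_subset_ebox (by linarith)) (ebox_subset_ecbox le_rfl)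
    (ecbox_subset_ebox (by linarith)) (φ := fun i => (φ i).toEquiv)
    (fun i y hy => (h i).apply hy) hPH
  rwa [finrank_coordSub, finrank_coordSub] at this

theorem isBlendingFrame_hatModel (hr : 2 ≤ r) (hℓ : ℓ ≤ c) (hs : s ≠ 0) (ha : |a| < 1 / 16)
    (ha0 : a ≠ 0) (hη : 0 < η) (hδ : 0 < δ) (h : ∀ i, IsLocalModel ℓ n η δ a p s (φ i) (σ i))
    (hPH : IsPHS ν α fun i => hatPerm hr ℓ (φ i)) {P Q : Submodule ℝ (GrIdx ℓ c → ℝ)}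
    (hPQ : (0 < a ∧ P = ⊤ ∧ Q = ⊥) ∨ (a < 0 ∧ P = ⊥ ∧ Q = ⊤)) :
    IsBlendingFrame ν α (hatEmbedding ℓ c) (fun i => hatPerm hr ℓ (φ i))
      (hatChart hℓ p s '' (ebox c δ ×ˢ box η)) (hatChart hℓ p s '' (ebox c (3 * δ) ×ˢ box (3 * η)))
      (Module.finrank ℝ ((coordSub fun k : Fin c => a * rate ℓ n k < 0).prod P))
      (Module.finrank ℝ ((coordSub fun k : Fin c => 0 < a * rate ℓ n k).prod Q)) :=
  ((isCodedSystem_model (ℓ := ℓ) (n := n) σ ha ha0 hη.le hδ).prodMap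
    (isCodedSystem_gr (ℓ := ℓ) (n := n) σ ha ha0 hη hPQ)).isBlendingFrame
    (isometry_hatEmbedding ℓ) (isChart_hatChart hℓ p hs)
    ((isOpen_ebox δ).prod (isOpen_box η)) ⟨0, zero_mem_ebox hδ, zero_mem_box hη⟩
    ((isOpen_ebox (3 * δ)).prod (isOpen_box (3 * η))) ((isOpen_ebox (4 * δ)).prod isOpen_univ)
    ((isCompact_ecbox δ).prod (isCompact_cbox η))
    ((isCompact_ecbox (3 * δ)).prod (isCompact_cbox (3 * η)))
    (prod_mono (ebox_subset_ecbox le_rfl) (box_subset_cbox le_rfl))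
    (prod_mono (ecbox_subset_ebox (by linarith)) (cbox_subset_box (by linarith)))
    (prod_mono (ebox_subset_ecbox le_rfl) (box_subset_cbox le_rfl))
    (prod_mono (ecbox_subset_ebox (by linarith)) (subset_univ _))
    (fun i y hy => hatPerm_hatChart hr hℓ hs ha (h i) hy.1) hPH

theorem norm_le_sum_abs (v : Euc c) : ‖v‖ ≤ ∑ k, |v k| := by
  conv_lhs => rw [sum_single_eq v]
  refine (norm_sum_le _ _).trans (Finset.sum_le_sum fun k _ => ?_)
  rw [norm_smul, PiLp.norm_single, norm_one, mul_one, Real.norm_eq_abs]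

theorem abs_apply_le_norm (v : Euc c) (k : Fin c) : |v k| ≤ ‖v‖ := PiLp.norm_apply_le v k

theorem abs_calL_apply_le {L : GrIdx ℓ c → ℝ} {B ρ : ℝ} (hB : 0 ≤ B) (hL : ∀ p, |L p| ≤ B)
    {w : Euc c} (hw : ∀ j, |w j| ≤ ρ) (k : Fin c) : |calL L w k| ≤ c * (B * ρ) := by
  have hρ : 0 ≤ ρ := (abs_nonneg _).trans (hw k)
  rw [calL, opM_apply]
  refine (Finset.abs_sum_le_sum_abs _ _).trans ?_
  have : ∀ j ∈ (Finset.univ : Finset (Fin c)), |matL ℓ c L k j * w j| ≤ B * ρ := by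
    intro j _
    rw [abs_mul, matL_apply]
    refine mul_le_mul ?_ (hw j) (abs_nonneg _) hB
    split_ifs
    · exact hL _
    · simpa using hB
  refine (Finset.sum_le_card_nsmul _ _ _ this).trans (le_of_eq ?_)
  simp

theorem norm_calL_le {L : GrIdx ℓ c → ℝ} {B : ℝ} (hB : 0 ≤ B) (hL : ∀ p, |L p| ≤ B)
    (w : Euc c) : ‖calL L w‖ ≤ c ^ 2 * B * ‖w‖ := by
  refine (norm_le_sum_abs _).trans ?_
  refine (Finset.sum_le_card_nsmul _ _ _ fun k _ =>
    abs_calL_apply_le hB hL (fun j => abs_apply_le_norm w j) k).trans (le_of_eq ?_)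
  simp
  ring

theorem abs_shear_le (σ : Signs c) (q : GrIdx ℓ c) : |shear ℓ n σ q| ≤ 3 := by
  rw [shear, abs_mul]
  have h1 := abs_sign_le (σ.2 q.1.1 q.1.2)
  have h2 : |2 - rate ℓ n q.1.1| ≤ 3 := by
    rcases rate_of_ge (n := n) q.2.1 with h | h <;> rw [h] <;> norm_num
  nlinarith [abs_nonneg (2 - rate ℓ n q.1.1), abs_nonneg (σ.2 q.1.1 q.1.2 : ℝ)]

/-- The entries of the shear are at most 3, so the left side is at most `6 * c ^ 2 * η * ‖w‖`. -/
theorem norm_shear_le (hη : 0 ≤ η) (hη' : 60 * (c : ℝ) ^ 2 * η ≤ 1) (σ : Signs c) (w : Euc c) :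
    ‖(2 * η) • calL (shear ℓ n σ) w‖ ≤ ‖w‖ / 10 := by
  rw [norm_smul, Real.norm_of_nonneg (by positivity)]
  have := norm_calL_le (by norm_num) (abs_shear_le (ℓ := ℓ) (n := n) σ) w
  have h2 := mul_le_mul_of_nonneg_left this (by positivity : 0 ≤ 2 * η)
  nlinarith [norm_nonneg w]

theorem abs_shear_apply_le (hη : 0 ≤ η) (hη' : 60 * (c : ℝ) ^ 2 * η ≤ 1) (σ : Signs c)
    {w : Euc c} {ρ : ℝ} (hw : ∀ j, |w j| ≤ ρ) (k : Fin c) :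
    |a * (2 * η) * calL (shear ℓ n σ) w k| ≤ |a| * (ρ / 10) := by
  have hρ : 0 ≤ ρ := (abs_nonneg _).trans (hw k)
  have hc : (1 : ℝ) ≤ c := by
    have : 0 < c := k.pos
    exact_mod_cast this
  have := abs_calL_apply_le (by norm_num) (abs_shear_le (ℓ := ℓ) (n := n) σ) hw k
  rw [mul_assoc, abs_mul, abs_mul, abs_of_nonneg (by positivity : 0 ≤ 2 * η)]
  refine mul_le_mul_of_nonneg_left ?_ (abs_nonneg _)
  have h2 := mul_le_mul_of_nonneg_left this (by positivity : 0 ≤ 2 * η)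
  have h3 : 60 * c * η ≤ 1 := by nlinarith [mul_nonneg (by positivity : (0:ℝ) ≤ c) hη]
  nlinarith

/-- The sign of a real number, with the convention that zero is positive. -/
noncomputable def sgn (t : ℝ) : SignType := if 0 ≤ t then 1 else -1

/-- The sign pattern that moves a point of the box towards the centre. -/
noncomputable def signsOf (y : Euc c) (L : GrIdx ℓ c → ℝ) : Signs c :=
  (fun k => sgn (y k), fun k j =>
    if h : ℓ ≤ (k : ℕ) ∧ (j : ℕ) < ℓ then sgn (L ⟨(k, j), h⟩) else 0)

theorem shear_signsOf (y : Euc c) (L : GrIdx ℓ c → ℝ) (q : GrIdx ℓ c) :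
    shear ℓ n (signsOf y L) q = (2 - rate ℓ n q.1.1) * (sgn (L q) : ℝ) := by
  rw [shear, signsOf]
  dsimp only
  rw [dif_pos q.2]

theorem sgn_cases (t : ℝ) : (0 ≤ t ∧ (sgn t : ℝ) = 1) ∨ (t < 0 ∧ (sgn t : ℝ) = -1) := by
  rcases le_or_gt 0 t with h | h
  · left; simp [sgn, h]
  · right; simp [sgn, h, not_le.2 h]

/-- Expanding coordinates shrink under the inverse with room for the shear. In a contracting
coordinate the inverse stretches by about `1 + a`, but a translation by `2 * a * δ` with the sign of
the coordinate first moves the point inwards; graph coordinates are treated alike by the shear. The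
signs for position and plane are chosen independently. -/
theorem exists_preimage_model (ha0 : 0 < a) (ha : a < 1 / 16) (hη : 0 < η)
    (hη' : 60 * (c : ℝ) ^ 2 * η ≤ 1) (hδ : 0 < δ)
    {y : Euc c} (hy : y ∈ ecbox c δ) {L : GrIdx ℓ c → ℝ} (hL : L ∈ cbox η) :
    ∃ σ : Signs c, ∃ y' ∈ ebox c δ, ∃ L' ∈ (box η : Set (GrIdx ℓ c → ℝ)),
      modelLin ℓ n η a σ y' + (a * (2 * δ)) • transl ℓ n σ = y ∧
      grLin ℓ n a L' + grTransl ℓ n η a σ = L := by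
  have haa : |a| < 1 / 16 := by rwa [abs_of_pos ha0]
  set σ := signsOf y L with hσ
  -- The shear reads only the first `ℓ` coordinates of the preimage, which are already known to be
  -- those of `w`; this makes the formula for `y'` explicit.
  set w : Euc c := WithLp.toLp 2 fun k => y k / (1 + 2 * a) with hw
  have hwδ : ∀ j, |w j| ≤ δ := fun j => by
    show |y j / (1 + 2 * a)| ≤ δ
    rw [abs_div, abs_of_pos (by linarith : 0 < 1 + 2 * a), div_le_iff₀ (by linarith)]
    have := hy j
    nlinarith
  set y' : Euc c := WithLp.toLp 2 fun k => (y k - a * (2 * η) * calL (shear ℓ n σ) w k -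
    a * (2 * δ) * transl ℓ n σ k) / mult ℓ n a k with hy'
  have hcal : calL (shear ℓ n σ) y' = calL (shear ℓ n σ) w := by
    refine calL_eq_of_top _ fun k hk => ?_
    show (_ - _ - _) / _ = y k / _
    rw [calL_apply_top _ _ hk, transl_apply, if_neg (by omega), mult, rate_of_lt hk]
    ring_nf
  refine ⟨σ, y', fun k => ?_, fun q => (L q - grTransl ℓ n η a σ q) / grMult ℓ n a q,
    fun q => ?_, ?_, ?_⟩
  · show |(y k - a * (2 * η) * calL (shear ℓ n σ) w k -
      a * (2 * δ) * transl ℓ n σ k) / mult ℓ n a k| < δ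
    have h1 := abs_shear_apply_le (a := a) (ℓ := ℓ) (n := n) hη.le hη' σ hwδ k
    rw [abs_of_pos ha0] at h1
    set t := a * (2 * η) * calL (shear ℓ n σ) w k with ht
    have h2 := abs_le.1 (hy k)
    have h3 := abs_le.1 h1
    rw [abs_div, abs_of_pos (mult_pos haa k), div_lt_iff₀ (mult_pos haa k), transl_apply, mult,
      abs_lt]
    rcases rate_cases ℓ n k with ⟨h, hr⟩ | ⟨h, hr⟩ | ⟨h, hr⟩
    · have ht0 : t = 0 := by rw [ht, calL_apply_top _ _ h, mul_zero]
      rw [hr, if_neg (by omega), ht0]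
      constructor <;> nlinarith
    · rw [hr, if_pos h]
      rcases sgn_cases (y k) with ⟨h4, h5⟩ | ⟨h4, h5⟩ <;> simp only [hσ, signsOf, h5] <;>
        constructor <;> nlinarith
    · rw [hr, if_neg (by omega)]
      constructor <;> nlinarith
  · have hw0 : 0 < 1 + 2 * a := by linarith
    have hm := mult_pos (ℓ := ℓ) (n := n) haa q.1.1
    have heq : (L q - grTransl ℓ n η a σ q) / grMult ℓ n a q =
        (L q * (1 + 2 * a) - a * (2 * η) * shear ℓ n σ q) / mult ℓ n a q.1.1 := by
      rw [grTransl, grMult]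
      generalize 1 + 2 * a = w at hw0
      field_simp
    dsimp only
    rw [heq, abs_div, abs_of_pos hm, div_lt_iff₀ hm, hσ, shear_signsOf, mult, abs_lt]
    have h2 := abs_le.1 (hL q)
    rcases rate_of_ge (n := n) q.2.1 with h | h <;> rw [h] <;>
      rcases sgn_cases (L q) with ⟨h4, h5⟩ | ⟨h4, h5⟩ <;> rw [h5] <;>
        constructor <;> nlinarith
  · ext k
    rw [PiLp.add_apply, modelLin_apply, hcal, PiLp.smul_apply, smul_eq_mul]
    show mult ℓ n a k * (_ / mult ℓ n a k) + _ + _ = _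
    rw [mul_div_cancel₀ _ (mult_pos haa k).ne']
    ring
  · funext q
    rw [Pi.add_apply, grLin_apply, mul_div_cancel₀ _ (grMult_pos haa q).ne']
    ring

/-- For `a < 0` the rates 2 and 1 contract, and the middle coordinates and the graphs expand;
translation and shear with the signs of the point bring the expanded coordinates back inside. -/
theorem exists_image_model (ha0 : a < 0) (ha : -(1 / 16) < a) (hη : 0 < η)
    (hη' : 60 * (c : ℝ) ^ 2 * η ≤ 1) (hδ : 0 < δ)
    {y : Euc c} (hy : y ∈ ecbox c δ) {L : GrIdx ℓ c → ℝ} (hL : L ∈ cbox η) :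
    ∃ σ : Signs c, modelLin ℓ n η a σ y + (a * (2 * δ)) • transl ℓ n σ ∈ ebox c δ ∧
      grLin ℓ n a L + grTransl ℓ n η a σ ∈ (box η : Set (GrIdx ℓ c → ℝ)) := by
  set σ := signsOf y L with hσ
  refine ⟨σ, fun k => ?_, fun q => ?_⟩
  · rw [PiLp.add_apply, modelLin_apply, PiLp.smul_apply, smul_eq_mul]
    have h1 := abs_shear_apply_le (a := a) (ℓ := ℓ) (n := n) hη.le hη' σ hy k
    rw [abs_of_neg ha0] at h1
    set t := a * (2 * η) * calL (shear ℓ n σ) y k with ht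
    have h2 := abs_le.1 (hy k)
    have h3 := abs_le.1 h1
    rw [transl_apply, mult, abs_lt]
    rcases rate_cases ℓ n k with ⟨h, hr⟩ | ⟨h, hr⟩ | ⟨h, hr⟩
    · have ht0 : t = 0 := by rw [ht, calL_apply_top _ _ h, mul_zero]
      rw [hr, if_neg (by omega), ht0]
      constructor <;> nlinarith
    · rw [hr, if_pos h]
      rcases sgn_cases (y k) with ⟨h4, h5⟩ | ⟨h4, h5⟩ <;> simp only [hσ, signsOf, h5] <;>
        constructor <;> nlinarith
    · rw [hr, if_neg (by omega)]
      constructor <;> nlinarith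
  · rw [Pi.add_apply, grLin_apply, grTransl, hσ, shear_signsOf, grMult, mult, div_mul_eq_mul_div,
      ← add_div, abs_div, abs_of_pos (by linarith : 0 < 1 + 2 * a), div_lt_iff₀ (by linarith),
      abs_lt]
    have h2 := abs_le.1 (hL q)
    rcases rate_of_ge (n := n) q.2.1 with h | h <;> rw [h] <;>
      rcases sgn_cases (L q) with ⟨h4, h5⟩ | ⟨h4, h5⟩ <;> rw [h5] <;>
        constructor <;> nlinarith

end LocalModel

/-! ### Cones, indices, and the blending regions with their tangencies. -/

section LocalModel

variable {c : ℕ} {ℓ n : ℕ} {η δ a : ℝ}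

/-- `X` and `Y` are the norms of the top and bottom parts of a cone vector, and `Z` is the bottom
norm of its image. The gain of about `4 * a * X ^ 2` in the top part outweighs the possible loss in
the bottom part because `Y ≤ X / 2`. -/
theorem cone_expansion_pos {a X Y Z : ℝ} (ha0 : 0 < a) (ha : a < 1 / 16) (hX : 0 ≤ X)
    (hY : 0 ≤ Y) (hYX : Y ≤ 1 / 2 * X) (h : -(a * (Y + X / 10)) ≤ Z - Y) :
    (1 + a / 2) ^ 2 * (X ^ 2 + Y ^ 2) ≤ ((1 + 2 * a) * X) ^ 2 + Z ^ 2 := by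
  have e1 : X * Y ≤ X ^ 2 / 2 := by
    have := mul_le_mul_of_nonneg_left hYX hX
    linarith
  have e2 : Y ^ 2 ≤ X ^ 2 / 4 := by
    have := pow_le_pow_left₀ hY hYX 2
    linarith
  have e3 := mul_le_mul_of_nonneg_left e1 ha0.le
  have e4 := mul_le_mul_of_nonneg_left e2 ha0.le
  have e5 : 0 ≤ a * a * (X * Y) := by positivity
  have e6 : 0 ≤ a * a * X ^ 2 := by positivity
  have e7 : 0 ≤ a * a * Y ^ 2 := by positivity
  have e8 : a * (a * X ^ 2) ≤ 1 / 16 * (a * X ^ 2) :=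
    mul_le_mul_of_nonneg_right ha.le (by positivity)
  have e9 : a * (a * Y ^ 2) ≤ 1 / 16 * (a * Y ^ 2) :=
    mul_le_mul_of_nonneg_right ha.le (by positivity)
  have e10 : 0 ≤ a * Y ^ 2 := by positivity
  -- The lower bound for `Z` can be squared only if it is nonnegative; otherwise the left side is
  -- already nonpositive.
  have hZ : Y ^ 2 - 2 * a * Y ^ 2 - a * X ^ 2 / 10 ≤ Z ^ 2 := by
    rcases le_or_gt 0 ((1 - a) * Y - a * X / 10) with h' | h'
    · have : ((1 - a) * Y - a * X / 10) ^ 2 ≤ Z ^ 2 := pow_le_pow_left₀ h' (by linarith) 2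
      linarith
    · have e11 := mul_nonneg (neg_nonneg.2 h'.le) hY
      linarith [sq_nonneg Z]
  linarith

/-- Here the vector with parts `X`, `Y` is the source and `Z` is the bottom norm of its image under
the model of amplitude `-b`: the top part loses about `4 * b * X ^ 2`, more than the bottom part can
gain. -/
theorem cone_expansion_neg {b X Y Z : ℝ} (hb0 : 0 < b) (hb : b < 1 / 16) (hX : 0 ≤ X)
    (hY : 0 ≤ Y) (hZ0 : 0 ≤ Z) (hYX : Y ≤ 1 / 2 * X) (h : Z - Y ≤ b * (Y + X / 10)) :
    (1 + b / 2) ^ 2 * (((1 + 2 * -b) * X) ^ 2 + Z ^ 2) ≤ X ^ 2 + Y ^ 2 := by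
  have e1 : X * Y ≤ X ^ 2 / 2 := by
    have := mul_le_mul_of_nonneg_left hYX hX
    linarith
  have e2 : Y ^ 2 ≤ X ^ 2 / 4 := by
    have := pow_le_pow_left₀ hY hYX 2
    linarith
  have hsq : ∀ T : ℝ, 0 ≤ T → b * T ≤ 1 / 16 * T := fun T hT =>
    mul_le_mul_of_nonneg_right hb.le hT
  have e3 := hsq _ (sq_nonneg X)
  have e4 := hsq _ (sq_nonneg Y)
  have e5 := hsq _ (mul_nonneg hX hY)
  have hZ : Z ^ 2 ≤ Y ^ 2 + 3 / 4 * (b * X ^ 2) := by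
    have e6 : Z ^ 2 ≤ ((1 + b) * Y + b * X / 10) ^ 2 := pow_le_pow_left₀ hZ0 (by linarith) 2
    have e7 : ((1 + b) * Y + b * X / 10) ^ 2 = Y ^ 2 + b * ((2 + b) * Y ^ 2 +
      (1 + b) / 5 * (X * Y) + b * X ^ 2 / 100) := by ring
    have e8 : (2 + b) * Y ^ 2 + (1 + b) / 5 * (X * Y) + b * X ^ 2 / 100 ≤ 3 / 4 * X ^ 2 := by
      linarith [sq_nonneg X]
    have := mul_le_mul_of_nonneg_left e8 hb0.le
    linarith
  have e6 := hsq _ (by positivity : 0 ≤ b * X ^ 2)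
  have e7 : ((1 + 2 * -b) * X) ^ 2 + Z ^ 2 ≤ (1 - 3 * b) * X ^ 2 + Y ^ 2 := by linarith
  have e8 : (1 + b / 2) ^ 2 ≤ 1 + 17 / 16 * b := by
    linarith [hsq b hb0.le]
  have e9 := mul_le_mul_of_nonneg_left e2 hb0.le
  have e10 : 0 ≤ b * b * X ^ 2 := by positivity
  have e11 : 0 ≤ b * X ^ 2 := by positivity
  calc _ ≤ (1 + 17 / 16 * b) * ((1 - 3 * b) * X ^ 2 + Y ^ 2) :=
        mul_le_mul e8 e7 (by positivity) (by positivity)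
    _ ≤ X ^ 2 + Y ^ 2 := by linarith

theorem norm_sq_eq_add (ℓ : ℕ) (v : Euc c) :
    ‖v‖ ^ 2 = ‖projTop ℓ c v‖ ^ 2 + ‖v - projTop ℓ c v‖ ^ 2 := by
  rw [EuclideanSpace.norm_sq_eq, EuclideanSpace.norm_sq_eq, EuclideanSpace.norm_sq_eq,
    ← Finset.sum_add_distrib]
  refine Finset.sum_congr rfl fun k _ => ?_
  rw [PiLp.sub_apply, projTop_apply]
  split_ifs <;> simp

/-- The cone of aperture `1 / 2` around the first `ℓ` coordinates. -/
def topCone (ℓ c : ℕ) : Set (Euc c) := {v | ‖v - projTop ℓ c v‖ ≤ 1 / 2 * ‖projTop ℓ c v‖}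

theorem isConeOfDim_topCone (h : ℓ ≤ c) : IsConeOfDim ℓ (topCone ℓ c) := by
  refine ⟨botSub ℓ c, coordSub fun k => ¬ (k : ℕ) < ℓ, 1 / 2,
    isCompl_coordSub _ _ fun _ => Iff.rfl, finrank_botSub h, by norm_num, ?_⟩
  ext v
  constructor
  · intro hv
    exact ⟨projTop ℓ c v, fun k hk => by simp [projTop_apply, hk], v - projTop ℓ c v,
      fun k hk => by simp [projTop_apply, not_not.1 hk], by abel, hv⟩
  · rintro ⟨u, hu, w, hw, rfl, h⟩
    have : projTop ℓ c (u + w) = u := by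
      ext k
      rw [projTop_apply, PiLp.add_apply]
      split_ifs with hk
      · rw [hw k (not_not.2 hk), add_zero]
      · exact (hu k hk).symm
    show ‖_ - _‖ ≤ _
    rw [this, add_sub_cancel_left]
    exact h

theorem mem_interior_topCone {v : Euc c}
    (hv : ‖v - projTop ℓ c v‖ < 1 / 2 * ‖projTop ℓ c v‖) : v ∈ interior (topCone ℓ c) := by
  have hopen : IsOpen {v : Euc c | ‖v - projTop ℓ c v‖ < 1 / 2 * ‖projTop ℓ c v‖} :=
    isOpen_lt (by fun_prop) (by fun_prop)
  have hsub : {v : Euc c | ‖v - projTop ℓ c v‖ < 1 / 2 * ‖projTop ℓ c v‖} ⊆ topCone ℓ c :=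
    fun w (hw : ‖_‖ < _) => hw.le
  exact interior_maximal hsub hopen hv

theorem projTop_modelLin (σ : Signs c) (v : Euc c) :
    projTop ℓ c (modelLin ℓ n η a σ v) = (1 + 2 * a) • projTop ℓ c v := by
  ext k
  rw [projTop_apply, PiLp.smul_apply, projTop_apply, modelLin_apply]
  split_ifs with hk
  · rw [calL_apply_top _ _ hk, mult, rate_of_lt hk, smul_eq_mul]; ring
  · simp

/-- Outside the first `ℓ` coordinates all rates are `±1`, and the shear adds at most a tenth of the
top part. -/
theorem norm_modelLin_sub_le (hη : 0 ≤ η) (hη' : 60 * (c : ℝ) ^ 2 * η ≤ 1) (σ : Signs c)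
    (v : Euc c) :
    ‖(modelLin ℓ n η a σ v - projTop ℓ c (modelLin ℓ n η a σ v)) - (v - projTop ℓ c v)‖ ≤
      |a| * (‖v - projTop ℓ c v‖ + ‖projTop ℓ c v‖ / 10) := by
  have h1 : (modelLin ℓ n η a σ v - projTop ℓ c (modelLin ℓ n η a σ v)) - (v - projTop ℓ c v) =
      opM (Matrix.diagonal fun k => a * rate ℓ n k) (v - projTop ℓ c v) +
        a • (2 * η) • calL (shear ℓ n σ) (projTop ℓ c v) := by
    rw [calL_projTop]
    ext k
    simp only [PiLp.add_apply, PiLp.sub_apply, PiLp.smul_apply, smul_eq_mul, opM_diagonal_apply,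
      projTop_apply, modelLin_apply]
    split_ifs with hk
    · rw [calL_apply_top _ _ hk]; ring
    · rw [mult]; ring
  have h2 : ‖opM (Matrix.diagonal fun k => a * rate ℓ n k) (v - projTop ℓ c v)‖ ≤
      |a| * ‖v - projTop ℓ c v‖ := by
    refine norm_le_of_abs_le (abs_nonneg _) fun k => ?_
    rw [opM_diagonal_apply, abs_mul]
    by_cases hk : (k : ℕ) < ℓ
    · simp [projTop_apply, hk]
    · refine mul_le_mul_of_nonneg_right ?_ (abs_nonneg _)
      rcases rate_of_ge (n := n) (not_lt.1 hk) with h | h <;> rw [h] <;> simp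
  rw [h1, mul_add]
  refine (norm_add_le _ _).trans (add_le_add h2 ?_)
  rw [norm_smul, Real.norm_eq_abs]
  exact mul_le_mul_of_nonneg_left (norm_shear_le hη hη' σ _) (abs_nonneg _)

/-- With `X`, `Y` the top and bottom norms, the new bottom norm is at most `(1 / 2 + 3 * a / 5) *
X`, whereas half the new top norm is `(1 / 2 + a) * X`. -/
theorem modelLin_cone_pos (ha0 : 0 < a) (ha : a < 1 / 16) (hη : 0 ≤ η)
    (hη' : 60 * (c : ℝ) ^ 2 * η ≤ 1) (σ : Signs c) {v : Euc c} (hv : v ∈ topCone ℓ c)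
    (hv0 : v ≠ 0) : modelLin ℓ n η a σ v ∈ interior (topCone ℓ c) ∧
      (1 + |a| / 2) * ‖v‖ ≤ ‖modelLin ℓ n η a σ v‖ := by
  have h1 := norm_modelLin_sub_le (ℓ := ℓ) (n := n) (a := a) hη hη' σ v
  have h2 : ‖v - projTop ℓ c v‖ ≤ 1 / 2 * ‖projTop ℓ c v‖ := hv
  have h3 := norm_sq_eq_add ℓ v
  have h4 := norm_sq_eq_add ℓ (modelLin ℓ n η a σ v)
  have h5 := abs_norm_sub_norm_le
    (modelLin ℓ n η a σ v - projTop ℓ c (modelLin ℓ n η a σ v)) (v - projTop ℓ c v)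
  have h6 := abs_le.1 (h5.trans h1)
  have h7 : ‖projTop ℓ c (modelLin ℓ n η a σ v)‖ = (1 + 2 * a) * ‖projTop ℓ c v‖ := by
    rw [projTop_modelLin, norm_smul, Real.norm_of_nonneg (by linarith)]
  have hv1 : 0 < ‖v‖ := norm_pos_iff.2 hv0
  rw [abs_of_pos ha0] at *
  have hX0 := norm_nonneg (projTop ℓ c v)
  have hY0 := norm_nonneg (v - projTop ℓ c v)
  have hZ0 := norm_nonneg (modelLin ℓ n η a σ v - projTop ℓ c (modelLin ℓ n η a σ v))
  have hX : 0 < ‖projTop ℓ c v‖ := by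
    rcases hX0.lt_or_eq with h | h
    · exact h
    · rw [← h] at h2 h3
      nlinarith
  constructor
  · refine mem_interior_topCone ?_
    rw [h7]
    nlinarith [mul_pos ha0 hX]
  · refine abs_le_of_sq_le_sq' ?_ (norm_nonneg _) |>.2
    rw [mul_pow, h3, h4, h7]
    generalize ‖projTop ℓ c v‖ = X at *
    generalize ‖v - projTop ℓ c v‖ = Y at *
    generalize ‖modelLin ℓ n η a σ v - projTop ℓ c (modelLin ℓ n η a σ v)‖ = Z at *
    exact cone_expansion_pos ha0 ha hX0 hY0 h2 h6.1

/-- With `a = -b`, the bottom norm `Y` of the source satisfies `(1 - b) * Y ≤ (1 / 2 - 9 * b / 10) *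
X`, which is less than `(1 - b) * X / 2`. -/
theorem modelLin_cone_neg (ha0 : a < 0) (ha : -(1 / 16) < a) (hη : 0 ≤ η)
    (hη' : 60 * (c : ℝ) ^ 2 * η ≤ 1) (σ : Signs c) {v : Euc c}
    (hv : modelLin ℓ n η a σ v ∈ topCone ℓ c) (hv0 : v ≠ 0) : v ∈ interior (topCone ℓ c) ∧
      (1 + |a| / 2) * ‖modelLin ℓ n η a σ v‖ ≤ ‖v‖ := by
  have h1 := norm_modelLin_sub_le (ℓ := ℓ) (n := n) (a := a) hη hη' σ v
  have h2 : ‖modelLin ℓ n η a σ v - projTop ℓ c (modelLin ℓ n η a σ v)‖ ≤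
    1 / 2 * ‖projTop ℓ c (modelLin ℓ n η a σ v)‖ := hv
  have h3 := norm_sq_eq_add ℓ v
  have h4 := norm_sq_eq_add ℓ (modelLin ℓ n η a σ v)
  have h5 := abs_norm_sub_norm_le
    (modelLin ℓ n η a σ v - projTop ℓ c (modelLin ℓ n η a σ v)) (v - projTop ℓ c v)
  have h6 := abs_le.1 (h5.trans h1)
  have h7 : ‖projTop ℓ c (modelLin ℓ n η a σ v)‖ = (1 + 2 * a) * ‖projTop ℓ c v‖ := by
    rw [projTop_modelLin, norm_smul, Real.norm_of_nonneg (by linarith)]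
  have hv1 : 0 < ‖v‖ := norm_pos_iff.2 hv0
  rw [abs_of_neg ha0] at *
  obtain ⟨b, rfl⟩ : ∃ b, a = -b := ⟨-a, by ring⟩
  rw [neg_neg] at *
  have hb0 : 0 < b := by linarith
  rw [h7] at h2
  have hX0 := norm_nonneg (projTop ℓ c v)
  have hY0 := norm_nonneg (v - projTop ℓ c v)
  have hZ0 := norm_nonneg (modelLin ℓ n η (-b) σ v - projTop ℓ c (modelLin ℓ n η (-b) σ v))
  have hY : (1 - b) * ‖v - projTop ℓ c v‖ ≤ (1 / 2 - b + b / 10) * ‖projTop ℓ c v‖ := by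
    linarith [h6.1]
  have hX : 0 < ‖projTop ℓ c v‖ := by
    rcases hX0.lt_or_eq with h | h
    · exact h
    · rw [← h] at hY h3
      nlinarith
  have hlt : ‖v - projTop ℓ c v‖ < 1 / 2 * ‖projTop ℓ c v‖ := by
    nlinarith [mul_pos hb0 hX]
  refine ⟨mem_interior_topCone hlt, ?_⟩
  refine abs_le_of_sq_le_sq' ?_ (norm_nonneg _) |>.2
  rw [mul_pow, h3, h4, h7]
  generalize ‖projTop ℓ c v‖ = X at *
  generalize ‖v - projTop ℓ c v‖ = Y at *
  generalize ‖modelLin ℓ n η (-b) σ v - projTop ℓ c (modelLin ℓ n η (-b) σ v)‖ = Z at *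
  exact cone_expansion_neg hb0 (by linarith) hX0 hY0 hZ0 hlt.le h6.2

theorem graphSub_subset_topCone (hη : 0 ≤ η) (hη' : 60 * (c : ℝ) ^ 2 * η ≤ 1)
    {L : GrIdx ℓ c → ℝ} (hL : L ∈ (box η : Set (GrIdx ℓ c → ℝ))) :
    (graphSub L : Set (Euc c)) ⊆ topCone ℓ c := by
  intro v hv
  obtain ⟨u, hu, rfl⟩ := mem_graphSub.1 hv
  have h1 : projTop ℓ c (u + calL L u) = u := by
    ext k
    rw [projTop_apply, PiLp.add_apply]
    split_ifs with hk
    · rw [calL_apply_top _ _ hk, add_zero]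
    · exact (hu k hk).symm
  show ‖_ - _‖ ≤ _
  rw [h1, add_sub_cancel_left]
  have := norm_calL_le hη (fun q => (hL q).le) u
  nlinarith [norm_nonneg u]

theorem card_rate_neg (hℓ : ℓ + n ≤ c) :
    (Finset.univ.filter fun k : Fin c => rate ℓ n k < 0).card = n := by
  have h1 := Fin.card_filter_val_lt (n := c) (m := ℓ + n)
  have h2 := Fin.card_filter_val_lt (n := c) (m := ℓ)
  have h3 := Finset.card_filter_add_card_filter_not
    (s := Finset.univ.filter fun k : Fin c => (k : ℕ) < ℓ + n) (fun k : Fin c => (k : ℕ) < ℓ)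
  rw [Finset.filter_filter, Finset.filter_filter] at h3
  have h4 : (Finset.univ.filter fun k : Fin c => (k : ℕ) < ℓ + n ∧ (k : ℕ) < ℓ) =
      Finset.univ.filter fun k : Fin c => (k : ℕ) < ℓ := by
    ext k; simp; omega
  have h5 : (Finset.univ.filter fun k : Fin c => (k : ℕ) < ℓ + n ∧ ¬ (k : ℕ) < ℓ) =
      Finset.univ.filter fun k : Fin c => rate ℓ n k < 0 := by
    ext k
    simp only [Finset.mem_filter, Finset.mem_univ, true_and]
    rcases rate_cases ℓ n k with ⟨h, hr⟩ | ⟨h, hr⟩ | ⟨h, hr⟩ <;> rw [hr] <;> norm_num <;> omega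
  rw [h4, h5] at h3
  omega

theorem card_rate_pos (hℓ : ℓ + n ≤ c) :
    (Finset.univ.filter fun k : Fin c => 0 < rate ℓ n k).card = c - n := by
  have h3 := Finset.card_filter_add_card_filter_not
    (s := (Finset.univ : Finset (Fin c))) (fun k : Fin c => rate ℓ n k < 0)
  have h5 : (Finset.univ.filter fun k : Fin c => ¬ rate ℓ n k < 0) =
      Finset.univ.filter fun k : Fin c => 0 < rate ℓ n k := by
    ext k
    simp only [Finset.mem_filter, Finset.mem_univ, true_and]
    rcases rate_cases ℓ n k with ⟨h, hr⟩ | ⟨h, hr⟩ | ⟨h, hr⟩ <;> rw [hr] <;> norm_num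
  rw [card_rate_neg hℓ, h5, Finset.card_univ, Fintype.card_fin] at h3
  omega

variable {d : ℕ} [Nonempty (Fin d)] {r : ℕ∞} {φ : Fin d → Diffeo c r} {σ : Fin d → Signs c}
  {p : Euc c} {s ν α : ℝ}

theorem closure_image_ebox_subset (p : Euc c) (s r : ℝ) :
    closure ((fun y : Euc c => p + s • y) '' ebox c r) ⊆ (fun y => p + s • y) '' ecbox c r :=
  closure_minimal (image_mono (ebox_subset_ecbox le_rfl))
    ((isCompact_ecbox r).image (by fun_prop)).isClosed

theorem closure_image_hatBox_subset (hℓ : ℓ ≤ c) (p : Euc c) {s : ℝ} (hs : s ≠ 0) (r r' : ℝ) :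
    closure (hatChart hℓ p s '' (ebox c r ×ˢ box r')) ⊆
      hatChart hℓ p s '' (ecbox c r ×ˢ cbox r') :=
  closure_minimal (image_mono (prod_mono (ebox_subset_ecbox le_rfl) (box_subset_cbox le_rfl)))
    (((isCompact_ecbox r).prod (isCompact_cbox r')).image
      ((isChart_hatChart hℓ p hs).continuous (isometry_hatEmbedding ℓ))).isClosed

theorem finrank_le_prod (S : Submodule ℝ (Euc c)) (P : Submodule ℝ (GrIdx ℓ c → ℝ)) :
    Module.finrank ℝ S ≤ Module.finrank ℝ (S.prod P) := by
  have h1 := (Submodule.equivMapOfInjective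
    (LinearMap.inl ℝ (Euc c) (GrIdx ℓ c → ℝ)) LinearMap.inl_injective S).finrank_eq
  rw [h1]
  refine Submodule.finrank_mono ?_
  rintro _ ⟨v, hv, rfl⟩
  exact ⟨hv, P.zero_mem⟩

/-- For `a > 0` exactly the `n` coordinates of rate -1 are contracted. -/
theorem isCsBlendingRegion_model (hs : s ≠ 0) (ha0 : 0 < a) (ha : a < 1 / 16) (hη : 0 < η)
    (hη' : 60 * (c : ℝ) ^ 2 * η ≤ 1) (hδ : 0 < δ) (hn : 0 < n) (hℓn : ℓ + n ≤ c)
    (hσ : Function.Surjective σ) (h : ∀ i, IsLocalModel ℓ n η δ a p s (φ i) (σ i))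
    (hPH : IsPHS ν α fun i => (φ i).toEquiv) :
    IsCsBlendingRegion ν α (id : Euc c → Euc c) (fun i => (φ i).toEquiv)
      ((fun y => p + s • y) '' ebox c δ) ((fun y => p + s • y) '' ebox c (3 * δ)) n := by
  have haa : |a| < 1 / 16 := by rwa [abs_of_pos ha0]
  have := isBlendingFrame_model hs haa ha0.ne' hη hδ h hPH
  simp only [mul_neg_iff, not_lt.2 ha0.le, ha0, false_and, true_and, or_false,
    card_rate_neg hℓn] at this
  refine ⟨_, this, hn, (closure_image_ebox_subset p s δ).trans ?_⟩
  rintro _ ⟨y, hy, rfl⟩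
  -- The covering of the base is the joint covering at the plane `L = 0`.
  obtain ⟨τ, y', hy', L', hL', h1, -⟩ := exists_preimage_model (n := n) ha0 ha hη hη' hδ hy
    (L := (0 : GrIdx ℓ c → ℝ)) (fun q => by simpa using hη.le)
  obtain ⟨i, rfl⟩ := hσ τ
  refine mem_iUnion.2 ⟨i, _, ⟨y', hy', rfl⟩, ?_⟩
  exact ((h i).apply fun k => lt_of_lt_of_le (hy' k) (by linarith)).trans (by rw [h1])

/-- All graph directions are contracted, so the Grassmannian factor is stable, and one sign pattern
covers base point and plane simultaneously. -/
theorem isCsTangency_model (hr : 2 ≤ r) (hs : s ≠ 0) (ha0 : 0 < a) (ha : a < 1 / 16)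
    (hη : 0 < η) (hη' : 60 * (c : ℝ) ^ 2 * η ≤ 1) (hδ : 0 < δ) (hn : 0 < n) (hℓ : ℓ ≤ c)
    (hℓn : ℓ + n ≤ c)
    (hσ : Function.Surjective σ) (h : ∀ i, IsLocalModel ℓ n η δ a p s (φ i) (σ i))
    (hPH : IsPHS ν α fun i => hatPerm hr ℓ (φ i)) :
    IsCsTangency hr ν α ℓ φ ((fun y => p + s • y) '' ebox c δ)
      (hatChart hℓ p s '' (ebox c δ ×ˢ box η)) := by
  have haa : |a| < 1 / 16 := by rwa [abs_of_pos ha0]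
  refine ⟨_, _, topCone ℓ c, ⟨_, isBlendingFrame_hatModel hr hℓ hs haa ha0.ne' hη hδ h hPH
    (Or.inl ⟨ha0, rfl, rfl⟩), ?_, (closure_image_hatBox_subset hℓ p hs δ η).trans ?_⟩,
    ⟨isConeOfDim_topCone hℓ, 1 + |a| / 2, by linarith [abs_pos.2 ha0.ne'], ?_⟩, ?_⟩
  · refine lt_of_lt_of_le ?_ (finrank_le_prod _ _)
    simp only [finrank_coordSub, mul_neg_iff, not_lt.2 ha0.le, ha0, false_and, true_and, or_false,
      card_rate_neg hℓn, hn]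
  · rintro _ ⟨⟨y, L⟩, ⟨hy, hL⟩, rfl⟩
    obtain ⟨τ, y', hy', L', hL', h1, h2⟩ := exists_preimage_model (n := n) ha0 ha hη hη' hδ hy hL
    obtain ⟨i, rfl⟩ := hσ τ
    refine mem_iUnion.2 ⟨i, _, ⟨(y', L'), ⟨hy', hL'⟩, rfl⟩, ?_⟩
    rw [hatPerm_hatChart hr hℓ hs haa (h i) fun k => lt_of_lt_of_le (hy' k) (by linarith)]
    exact congrArg _ (Prod.ext h1 h2)
  · rintro i _ ⟨y, hy, rfl⟩ - v hv hv0
    rw [((h i).hasFDerivAt hs fun k => lt_of_lt_of_le (hy k) (by linarith)).fderiv]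
    exact modelLin_cone_pos ha0 ha hη.le hη' _ hv hv0
  · rintro _ ⟨⟨y, L⟩, ⟨hy, hL⟩, rfl⟩
    exact ⟨⟨y, hy, rfl⟩, graphSub_subset_topCone hη.le hη' hL⟩

/-- A negative amplitude reverses the roles: the `n` coordinates of rate -1 expand and the other `c
- n` contract. -/
theorem isCuBlendingRegion_model (hs : s ≠ 0) (ha0 : a < 0) (ha : -(1 / 16) < a) (hη : 0 < η)
    (hη' : 60 * (c : ℝ) ^ 2 * η ≤ 1) (hδ : 0 < δ) (hn : 0 < n) (hℓn : ℓ + n ≤ c)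
    (hσ : Function.Surjective σ) (h : ∀ i, IsLocalModel ℓ n η δ a p s (φ i) (σ i))
    (hPH : IsPHS ν α fun i => (φ i).toEquiv) :
    IsCuBlendingRegion ν α (id : Euc c → Euc c) (fun i => (φ i).toEquiv)
      ((fun y => p + s • y) '' ebox c δ) ((fun y => p + s • y) '' ebox c (3 * δ)) (c - n) := by
  have haa : |a| < 1 / 16 := by rw [abs_of_neg ha0]; linarith
  have := isBlendingFrame_model hs haa ha0.ne hη hδ h hPH
  simp only [mul_neg_iff, not_lt.2 ha0.le, ha0, false_and, true_and, false_or,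
    card_rate_pos hℓn] at this
  refine ⟨_, this, ?_, (closure_image_ebox_subset p s δ).trans ?_⟩
  · simp only [mul_pos_iff, not_lt.2 ha0.le, ha0, false_and, true_and, false_or,
      card_rate_neg hℓn, hn]
  rintro _ ⟨y, hy, rfl⟩
  obtain ⟨τ, h1, -⟩ := exists_image_model (n := n) ha0 ha hη hη' hδ hy
    (L := (0 : GrIdx ℓ c → ℝ)) (fun q => by simpa using hη.le)
  obtain ⟨i, rfl⟩ := hσ τ
  refine mem_iUnion.2 ⟨i, _, ⟨_, h1, rfl⟩, ?_⟩
  rw [Equiv.symm_apply_eq]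
  exact ((h i).apply fun k => lt_of_le_of_lt (hy k) (by linarith)).symm

theorem isCuTangency_model (hr : 2 ≤ r) (hs : s ≠ 0) (ha0 : a < 0) (ha : -(1 / 16) < a)
    (hη : 0 < η) (hη' : 60 * (c : ℝ) ^ 2 * η ≤ 1) (hδ : 0 < δ) (hn : 0 < n) (hℓ : ℓ ≤ c)
    (hℓn : ℓ + n ≤ c)
    (hσ : Function.Surjective σ) (h : ∀ i, IsLocalModel ℓ n η δ a p s (φ i) (σ i))
    (hPH : IsPHS ν α fun i => hatPerm hr ℓ (φ i)) :
    IsCuTangency hr ν α ℓ φ ((fun y => p + s • y) '' ebox c δ)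
      (hatChart hℓ p s '' (ebox c δ ×ˢ box η)) := by
  have haa : |a| < 1 / 16 := by rw [abs_of_neg ha0]; linarith
  refine ⟨_, _, topCone ℓ c, ⟨_, isBlendingFrame_hatModel hr hℓ hs haa ha0.ne hη hδ h hPH
    (Or.inr ⟨ha0, rfl, rfl⟩), ?_, (closure_image_hatBox_subset hℓ p hs δ η).trans ?_⟩,
    ⟨isConeOfDim_topCone hℓ, 1 + |a| / 2, by linarith [abs_pos.2 ha0.ne], ?_⟩, ?_⟩
  · refine lt_of_lt_of_le ?_ (finrank_le_prod _ _)
    simp only [finrank_coordSub, mul_pos_iff, not_lt.2 ha0.le, ha0, false_and, true_and, false_or,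
      card_rate_neg hℓn, hn]
  · rintro _ ⟨⟨y, L⟩, ⟨hy, hL⟩, rfl⟩
    obtain ⟨τ, h1, h2⟩ := exists_image_model (n := n) ha0 ha hη hη' hδ hy hL
    obtain ⟨i, rfl⟩ := hσ τ
    refine mem_iUnion.2 ⟨i, _, ⟨(_, _), ⟨h1, h2⟩, rfl⟩, ?_⟩
    rw [Equiv.symm_apply_eq,
      hatPerm_hatChart hr hℓ hs haa (h i) fun k => lt_of_le_of_lt (hy k) (by linarith)]
    rfl
  -- The derivative of the inverse at `x` inverts the model at the preimage of `x`, which lies in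
  -- the box where the model is valid.
  · rintro i x - ⟨y, hy, hyx⟩ v hv hv0
    have h1 := (h i).hasFDerivAt hs (y := y) fun k => lt_of_lt_of_le (hy k) (by linarith)
    have h2 : p + s • y = (φ i).symm x := hyx
    have h3 := Diffeo.fderiv_symm_comp hr (φ i).symm x
    have h4 : modelLin ℓ n η a (σ i) (fderiv ℝ (φ i).symm x v) = v := by
      rw [← h1.fderiv, h2]
      exact congrArg (fun T : Euc c →L[ℝ] Euc c => T v) h3
    have h5 : fderiv ℝ (φ i).symm x v ≠ 0 := by
      intro h6
      rw [h6, map_zero] at h4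
      exact hv0 h4.symm
    have h6 := modelLin_cone_neg ha0 ha hη.le hη' (σ i) (h4.symm ▸ hv) h5
    rwa [h4] at h6
  · rintro _ ⟨⟨y, L⟩, ⟨hy, hL⟩, rfl⟩
    exact ⟨⟨y, hy, rfl⟩, graphSub_subset_topCone hη.le hη' hL⟩

end LocalModel

/-! ## Perturbations of the identity -/

section NearIdentity

variable {c : ℕ}

theorem norm_sub_sub_le_of_fderiv_near_id {f : Euc c → Euc c} (hf : Differentiable ℝ f) {κ : ℝ}
    (h1 : ∀ x, ‖fderiv ℝ f x - ContinuousLinearMap.id ℝ _‖ ≤ κ) (x y : Euc c) :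
    ‖f x - f y - (x - y)‖ ≤ κ * ‖x - y‖ :=
  Convex.norm_image_sub_le_of_norm_fderiv_le' (φ := ContinuousLinearMap.id ℝ (Euc c))
    (fun x _ => hf x) (fun x _ => h1 x) convex_univ (mem_univ y) (mem_univ x)

theorem Diffeo.differentiable {r : ℕ∞} (hr : 2 ≤ r) (f : Diffeo c r) : Differentiable ℝ f := by
  have hr0 : (r : WithTop ℕ∞) ≠ 0 := by
    have h0 : r ≠ 0 := by rintro rfl; simp at hr
    exact_mod_cast h0
  exact f.contMDiff.contDiff.differentiable hr0

theorem Diffeo.fderiv_comp_symm {r : ℕ∞} (hr : 2 ≤ r) (f : Diffeo c r) (x : Euc c) :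
    (fderiv ℝ f (f.symm x)).comp (fderiv ℝ f.symm x) = ContinuousLinearMap.id ℝ (Euc c) :=
  Diffeo.fderiv_symm_comp hr f.symm x

theorem Diffeo.norm_symm_sub_le {r : ℕ∞} (hr : 2 ≤ r) (f : Diffeo c r) {κ : ℝ}
    (hκ : κ ≤ 1 / 2) (h1 : ∀ x, ‖fderiv ℝ f x - ContinuousLinearMap.id ℝ _‖ ≤ κ) (x y : Euc c) :
    ‖f.symm x - f.symm y‖ ≤ 2 * ‖x - y‖ := by
  have h := norm_sub_sub_le_of_fderiv_near_id (f.differentiable hr) h1 (f.symm x) (f.symm y)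
  rw [f.apply_symm_apply, f.apply_symm_apply] at h
  have h2 := norm_sub_norm_le (f.symm x - f.symm y) (x - y)
  rw [norm_sub_rev] at h
  nlinarith [norm_nonneg (f.symm x - f.symm y)]

theorem Diffeo.norm_fderiv_symm_le {r : ℕ∞} (hr : 2 ≤ r) (f : Diffeo c r) {κ : ℝ}
    (hκ : κ ≤ 1 / 2) (h1 : ∀ x, ‖fderiv ℝ f x - ContinuousLinearMap.id ℝ _‖ ≤ κ) (x : Euc c) :
    ‖fderiv ℝ f.symm x‖ ≤ 2 := by
  refine ContinuousLinearMap.opNorm_le_bound _ (by norm_num) fun v => ?_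
  have h3 := congrArg (fun T : Euc c →L[ℝ] Euc c => T v) (f.fderiv_comp_symm hr x)
  simp only [ContinuousLinearMap.comp_apply, ContinuousLinearMap.id_apply] at h3
  have h4 := ContinuousLinearMap.le_of_opNorm_le _ (h1 (f.symm x)) (fderiv ℝ f.symm x v)
  rw [sub_apply, ContinuousLinearMap.id_apply, h3] at h4
  have h2 := norm_sub_norm_le (fderiv ℝ f.symm x v) v
  rw [norm_sub_rev] at h4
  nlinarith [norm_nonneg (fderiv ℝ f.symm x v)]

theorem Diffeo.norm_fderiv_symm_sub_id_le {r : ℕ∞} (hr : 2 ≤ r) (f : Diffeo c r) {κ : ℝ}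
    (hκ : κ ≤ 1 / 2) (h1 : ∀ x, ‖fderiv ℝ f x - ContinuousLinearMap.id ℝ _‖ ≤ κ) (x : Euc c) :
    ‖fderiv ℝ f.symm x - ContinuousLinearMap.id ℝ _‖ ≤ 2 * κ := by
  have h3 : fderiv ℝ f.symm x - ContinuousLinearMap.id ℝ _ =
      (ContinuousLinearMap.id ℝ _ - fderiv ℝ f (f.symm x)).comp (fderiv ℝ f.symm x) := by
    rw [ContinuousLinearMap.sub_comp, f.fderiv_comp_symm hr, ContinuousLinearMap.id_comp]
  rw [h3]
  refine (ContinuousLinearMap.opNorm_comp_le _ _).trans ?_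
  rw [norm_sub_rev, mul_comm]
  exact mul_le_mul (f.norm_fderiv_symm_le hr hκ h1 x) (h1 _) (norm_nonneg _) (by norm_num)

/-- Resolvent identity `A⁻¹ - B⁻¹ = A⁻¹ (B - A) B⁻¹`: each inverse has norm at most 2, and the
inverse map, at whose values the derivatives are taken, is 2-Lipschitz. -/
theorem Diffeo.norm_fderiv_symm_sub_le {r : ℕ∞} (hr : 2 ≤ r) (f : Diffeo c r) {κ : ℝ}
    (hκ : κ ≤ 1 / 2) (h1 : ∀ x, ‖fderiv ℝ f x - ContinuousLinearMap.id ℝ _‖ ≤ κ)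
    (h2 : ∀ x y, ‖fderiv ℝ f x - fderiv ℝ f y‖ ≤ κ * ‖x - y‖) (x y : Euc c) :
    ‖fderiv ℝ f.symm x - fderiv ℝ f.symm y‖ ≤ 8 * κ * ‖x - y‖ := by
  have hκ0 : 0 ≤ κ := (norm_nonneg _).trans (h1 0)
  have e1 : (fderiv ℝ f.symm x).comp (fderiv ℝ f (f.symm x)) = ContinuousLinearMap.id ℝ _ := by
    have := Diffeo.fderiv_symm_comp hr f (f.symm x)
    rwa [f.apply_symm_apply] at this
  have h3 : fderiv ℝ f.symm x - fderiv ℝ f.symm y = (fderiv ℝ f.symm x).comp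
      ((fderiv ℝ f (f.symm y) - fderiv ℝ f (f.symm x)).comp (fderiv ℝ f.symm y)) := by
    rw [ContinuousLinearMap.sub_comp, ContinuousLinearMap.comp_sub, f.fderiv_comp_symm hr,
      ← ContinuousLinearMap.comp_assoc, e1, ContinuousLinearMap.id_comp,
      ContinuousLinearMap.comp_id]
  rw [h3]
  have hx := f.norm_fderiv_symm_le hr hκ h1 x
  have hy := f.norm_fderiv_symm_le hr hκ h1 y
  have hxy : ‖fderiv ℝ f (f.symm y) - fderiv ℝ f (f.symm x)‖ ≤ κ * (2 * ‖x - y‖) := by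
    refine (h2 _ _).trans (mul_le_mul_of_nonneg_left ?_ hκ0)
    rw [norm_sub_rev]
    exact f.norm_symm_sub_le hr hκ h1 x y
  calc _ ≤ ‖fderiv ℝ f.symm x‖ * (‖fderiv ℝ f (f.symm y) - fderiv ℝ f (f.symm x)‖ *
        ‖fderiv ℝ f.symm y‖) := (ContinuousLinearMap.opNorm_comp_le _ _).trans
          (mul_le_mul_of_nonneg_left (ContinuousLinearMap.opNorm_comp_le _ _) (norm_nonneg _))
    _ ≤ 2 * (κ * (2 * ‖x - y‖) * 2) := by gcongr
    _ = _ := by ring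

theorem dist_le_of_fderiv_near_id {f : Euc c → Euc c} (hf : Differentiable ℝ f) {κ : ℝ}
    (h1 : ∀ x, ‖fderiv ℝ f x - ContinuousLinearMap.id ℝ _‖ ≤ κ) (x y : Euc c) :
    dist (f x) (f y) ≤ (1 + κ) * dist x y := by
  have h := norm_sub_sub_le_of_fderiv_near_id hf h1 x y
  have h2 := norm_sub_norm_le (f x - f y) (x - y)
  rw [dist_eq_norm, dist_eq_norm]
  linarith

/-- Diffeomorphisms that are `C²`-close to the identity generate fibre bunched skew-products, also
on the Grassmann bundle. -/
theorem hasPHBounds_of_near_id {d : ℕ} {r : ℕ∞} (hr : 2 ≤ r) (ℓ : ℕ) (φ : Fin d → Diffeo c r)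
    {q : ℝ} (hq0 : 0 < q) (hq1 : q < 1) {ν α : ℝ} (hq : ν ^ α = q)
    (h1 : ∀ i x, ‖fderiv ℝ (φ i) x - ContinuousLinearMap.id ℝ _‖ ≤ (1 - q) / 200)
    (h2 : ∀ i x y, ‖fderiv ℝ (φ i) x - fderiv ℝ (φ i) y‖ ≤ (1 - q) / 200 * ‖x - y‖) :
    HasPHBounds ν α ((1 + q) / 2) ((1 + q) / 2) (fun i => (φ i).toEquiv) ∧
    HasPHBounds ν α ((1 + q) / 2) ((1 + q) / 2) (fun i => hatPerm hr ℓ (φ i)) := by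
  set κ := (1 - q) / 200 with hκ
  have hκ0 : 0 < κ := by rw [hκ]; linarith
  have hκ1 : κ < 1 / 200 := by rw [hκ]; linarith
  have hγ0 : 0 < (1 + q) / 2 := by linarith
  have hΛ : ∀ κ', 0 ≤ κ' → κ' ≤ 8 * κ → (1 + 2 * κ') / (1 - κ') ≤ ((1 + q) / 2)⁻¹ := by
    intro κ' h0 h8
    -- Thus `(1 + q) / 2 = 1 - 100 * κ`, and the claim reduces to `(1 + 2 * κ') * (1 - 100 * κ) ≤ 1
    -- - κ'`.
    have hq' : q = 1 - 200 * κ := by rw [hκ]; ring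
    rw [div_le_iff₀ (by linarith), inv_mul_eq_div, le_div_iff₀ hγ0, hq']
    nlinarith
  have hΛ' : ∀ κ', 0 ≤ κ' → κ' ≤ 8 * κ → 1 + κ' ≤ ((1 + q) / 2)⁻¹ := by
    intro κ' h0 h8
    refine le_trans ?_ (hΛ κ' h0 h8)
    rw [le_div_iff₀ (by linarith)]
    nlinarith
  -- Lower Lipschitz bounds are upper ones for the inverse.
  have hlow : ∀ {M : Type} [MetricSpace M] (F : Equiv.Perm M),
      (∀ x y, dist (F.symm x) (F.symm y) ≤ ((1 + q) / 2)⁻¹ * dist x y) →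
      ∀ x y, (1 + q) / 2 * dist x y ≤ dist (F x) (F y) := by
    intro M _ F hF x y
    have := hF (F x) (F y)
    rwa [F.symm_apply_apply, F.symm_apply_apply, inv_mul_eq_div, le_div_iff₀ hγ0,
      mul_comm] at this
  have hb : ∀ i x y, dist (φ i x) (φ i y) ≤ ((1 + q) / 2)⁻¹ * dist x y := fun i x y =>
    (dist_le_of_fderiv_near_id ((φ i).differentiable hr) (h1 i) x y).trans
      (mul_le_mul_of_nonneg_right (hΛ' κ hκ0.le (by linarith)) dist_nonneg)
  have hs1 := fun i => (φ i).norm_fderiv_symm_sub_id_le hr (κ := κ) (by linarith) (h1 i)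
  have hs2 := fun i => (φ i).norm_fderiv_symm_sub_le hr (κ := κ) (by linarith) (h1 i) (h2 i)
  have hbs : ∀ i x y, dist ((φ i).symm x) ((φ i).symm y) ≤ ((1 + q) / 2)⁻¹ * dist x y :=
    fun i x y => (dist_le_of_fderiv_near_id (Diffeo.differentiable hr (φ i).symm) (hs1 i) x y).trans
      (mul_le_mul_of_nonneg_right (hΛ' _ (by linarith) (by linarith)) dist_nonneg)
  refine ⟨⟨by linarith, by linarith, by linarith, by linarith, fun i x y =>
    ⟨hlow (φ i).toEquiv (hbs i) x y, hb i x y⟩⟩,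
    ⟨by linarith, by linarith, by linarith, by linarith, fun i x y => ⟨?_, ?_⟩⟩⟩
  · refine hlow (hatPerm hr ℓ (φ i)) (fun z w => ?_) x y
    exact dist_hatFun_le hr ℓ (φ i).symm (κ := 8 * κ) (by linarith) (by linarith)
      (fun x => (hs1 i x).trans (by linarith)) (hs2 i) (hbs i) (hΛ _ (by linarith) le_rfl) z w
  · exact dist_hatFun_le hr ℓ (φ i) hκ0.le (by linarith) (h1 i) (h2 i) (hb i)
      (hΛ _ hκ0.le (by linarith)) x y

/-- The perturbation of the identity by a rescaled vector field. -/
noncomputable def pert (W : Euc c → Euc c) (x : Euc c) (s a : ℝ) (y : Euc c) : Euc c :=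
  y + (a * s) • W (s⁻¹ • (y - x))

/-- A smooth vector field whose first and second derivatives are bounded by `C`. -/
structure IsBoundedField (W : Euc c → Euc c) (C : ℝ) : Prop where
  contDiff : ContDiff ℝ (⊤ : ℕ∞) W
  norm_fderiv_le : ∀ z, ‖fderiv ℝ W z‖ ≤ C
  norm_fderiv_sub_le : ∀ z z', ‖fderiv ℝ W z - fderiv ℝ W z'‖ ≤ C * ‖z - z'‖

theorem exists_isBoundedField {W : Euc c → Euc c} (hW : ContDiff ℝ (⊤ : ℕ∞) W)
    (hs : HasCompactSupport W) : ∃ C, IsBoundedField W C := by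
  have h2 : ((2 : ℕ∞) : WithTop ℕ∞) ≤ ((⊤ : ℕ∞) : WithTop ℕ∞) := WithTop.coe_le_coe.2 le_top
  have hW1 : ContDiff ℝ 1 (fderiv ℝ W) := (hW.of_le h2).fderiv_right (by norm_num)
  obtain ⟨C1, h1⟩ := hW1.continuous.bounded_above_of_compact_support (hs.fderiv ℝ)
  obtain ⟨C2, h2⟩ := (hW1.continuous_fderiv one_ne_zero).bounded_above_of_compact_support
    ((hs.fderiv ℝ).fderiv ℝ)
  refine ⟨max C1 C2, hW, fun z => (h1 z).trans (le_max_left _ _), fun z z' => ?_⟩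
  refine (Convex.norm_image_sub_le_of_norm_fderiv_le
    (fun x _ => hW1.differentiable one_ne_zero x) (fun x _ => h2 x) convex_univ (mem_univ z')
    (mem_univ z)).trans ?_
  exact mul_le_mul_of_nonneg_right (le_max_right _ _) (norm_nonneg _)

/-! ### Derivative bounds, invertibility and arcs of rescaled perturbations. -/

section Pert

variable {W : Euc c → Euc c} {C : ℝ}

theorem contDiff_pert (hW : ContDiff ℝ (⊤ : ℕ∞) W) (x : Euc c) (s a : ℝ) :
    ContDiff ℝ (⊤ : ℕ∞) (pert W x s a) :=
  contDiff_id.add ((hW.comp ((contDiff_id.sub contDiff_const).const_smul _)).const_smul _)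

theorem hasFDerivAt_pert (hW : ContDiff ℝ (⊤ : ℕ∞) W) (x : Euc c) (s a : ℝ) (y : Euc c) :
    HasFDerivAt (pert W x s a) (ContinuousLinearMap.id ℝ _ +
      (a * s * s⁻¹) • fderiv ℝ W (s⁻¹ • (y - x))) y := by
  have h1 : HasFDerivAt (fun y : Euc c => s⁻¹ • (y - x))
      (s⁻¹ • ContinuousLinearMap.id ℝ (Euc c)) y :=
    ((hasFDerivAt_id y).sub_const x).const_smul s⁻¹
  have h2 := (((hW.differentiable (by simp)) (s⁻¹ • (y - x))).hasFDerivAt.comp y h1).const_smul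
    (a * s)
  have h3 := (hasFDerivAt_id y).add h2
  convert! h3 using 1
  ext1 v
  simp [mul_smul]

theorem fderiv_pert (hW : ContDiff ℝ (⊤ : ℕ∞) W) (x : Euc c) (s a : ℝ) (y : Euc c) :
    fderiv ℝ (pert W x s a) y = ContinuousLinearMap.id ℝ _ +
      (a * s * s⁻¹) • fderiv ℝ W (s⁻¹ • (y - x)) :=
  (hasFDerivAt_pert hW x s a y).fderiv

variable {κ s a : ℝ}

theorem norm_fderiv_pert_sub_id_le (hW : IsBoundedField W C) (ha : 0 ≤ a) (hs : 0 ≤ s)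
    (h1 : a * C ≤ κ) (x y : Euc c) :
    ‖fderiv ℝ (pert W x s a) y - ContinuousLinearMap.id ℝ _‖ ≤ κ := by
  rw [fderiv_pert hW.contDiff, add_sub_cancel_left, norm_smul, Real.norm_of_nonneg (by positivity)]
  -- Equality for `s ≠ 0`; at `s = 0` the convention `0⁻¹ = 0` makes the perturbation trivial.
  have h2 : s * s⁻¹ ≤ 1 := mul_inv_le_one
  have h3 : a * s * s⁻¹ ≤ a := by
    rw [mul_assoc]; exact mul_le_of_le_one_right ha h2
  exact (mul_le_mul h3 (hW.norm_fderiv_le _) (norm_nonneg _) ha).trans h1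

theorem norm_fderiv_pert_sub_le (hW : IsBoundedField W C) (ha : 0 ≤ a) (hs : 0 ≤ s)
    (h1 : a * s⁻¹ * C ≤ κ) (x y y' : Euc c) :
    ‖fderiv ℝ (pert W x s a) y - fderiv ℝ (pert W x s a) y'‖ ≤ κ * ‖y - y'‖ := by
  have h0 : fderiv ℝ (pert W x s a) y - fderiv ℝ (pert W x s a) y' =
      (a * s * s⁻¹) • (fderiv ℝ W (s⁻¹ • (y - x)) - fderiv ℝ W (s⁻¹ • (y' - x))) := by
    rw [fderiv_pert hW.contDiff, fderiv_pert hW.contDiff, add_sub_add_left_eq_sub]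
    exact (smul_sub _ _ _).symm
  rw [h0, norm_smul, Real.norm_of_nonneg (by positivity)]
  have h2 : s * s⁻¹ ≤ 1 := mul_inv_le_one
  have h3 : a * s * s⁻¹ ≤ a := by
    rw [mul_assoc]; exact mul_le_of_le_one_right ha h2
  have h4 : ‖s⁻¹ • (y - x) - s⁻¹ • (y' - x)‖ = s⁻¹ * ‖y - y'‖ := by
    rw [← smul_sub, sub_sub_sub_cancel_right, norm_smul, Real.norm_of_nonneg (inv_nonneg.2 hs)]
  calc _ ≤ a * (C * (s⁻¹ * ‖y - y'‖)) :=
        mul_le_mul h3 ((hW.norm_fderiv_sub_le _ _).trans_eq (by rw [h4])) (norm_nonneg _) ha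
    _ = a * s⁻¹ * C * ‖y - y'‖ := by ring
    _ ≤ _ := mul_le_mul_of_nonneg_right h1 (norm_nonneg _)

/-- A smooth map whose derivative is close to the identity is a diffeomorphism. -/
theorem exists_diffeo_of_fderiv_near_id {f : Euc c → Euc c} (hf : ContDiff ℝ (⊤ : ℕ∞) f)
    (h1 : ∀ x, ‖fderiv ℝ f x - ContinuousLinearMap.id ℝ _‖ ≤ 1 / 2) (r : ℕ∞) :
    ∃ g : Diffeo c r, ∀ x, g x = f x := by
  have hd : Differentiable ℝ f := hf.differentiable (by simp)
  have happ : ApproximatesLinearOn f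
      ((ContinuousLinearEquiv.refl ℝ (Euc c) : Euc c ≃L[ℝ] Euc c) : Euc c →L[ℝ] Euc c) univ
      (1 / 2 : ℝ≥0) := by
    intro x _ y _
    exact (norm_sub_sub_le_of_fderiv_near_id hd h1 x y).trans_eq (by norm_num)
  -- In dimension zero the identity has norm 0, so that case is separate.
  have hc : Subsingleton (Euc c) ∨ (1 / 2 : ℝ≥0) <
      ‖(((ContinuousLinearEquiv.refl ℝ (Euc c)).symm : Euc c ≃L[ℝ] Euc c) :
        Euc c →L[ℝ] Euc c)‖₊⁻¹ := by
    rcases subsingleton_or_nontrivial (Euc c) with h | h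
    · exact Or.inl h
    · right
      have : ‖(((ContinuousLinearEquiv.refl ℝ (Euc c)).symm : Euc c ≃L[ℝ] Euc c) :
        Euc c →L[ℝ] Euc c)‖₊ = 1 := by
        rw [ContinuousLinearEquiv.refl_symm, ContinuousLinearEquiv.coe_refl]
        exact nnnorm_one
      rw [this, inv_one]
      exact NNReal.half_lt_self one_ne_zero
  let h := happ.toHomeomorph f hc
  have hh : ∀ x, h x = f x := fun x => rfl
  have hunit : ∀ x, ∃ e : Euc c ≃L[ℝ] Euc c, (e : Euc c →L[ℝ] Euc c) = fderiv ℝ f x := by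
    intro x
    have hu : IsUnit (fderiv ℝ f x) := by
      refine isUnit_of_injective fun v hv => ?_
      have h4 := ContinuousLinearMap.le_of_opNorm_le _ (h1 x) v
      rw [sub_apply, ContinuousLinearMap.id_apply, hv, zero_sub, norm_neg] at h4
      have := norm_nonneg v
      exact norm_eq_zero.1 (by linarith)
    exact ⟨ContinuousLinearEquiv.unitsEquiv ℝ (Euc c) hu.unit, rfl⟩
  choose e he using hunit
  have hsymm : ContDiff ℝ (⊤ : ℕ∞) (h.symm : Euc c → Euc c) :=
    h.contDiff_symm (f₀' := e) (fun x => by rw [he]; exact (hd x).hasFDerivAt) hf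
  have hle : (r : WithTop ℕ∞) ≤ ((⊤ : ℕ∞) : WithTop ℕ∞) := by exact_mod_cast le_top
  exact ⟨⟨h.toEquiv, (hf.of_le hle).contMDiff, (hsymm.of_le hle).contMDiff⟩, fun x => rfl⟩

/-- Each derivative costs a factor `s⁻¹`. This is why the amplitude must decay faster than any power
of `s`. -/
theorem iteratedFDeriv_pert (hW : ContDiff ℝ (⊤ : ℕ∞) W) (x : Euc c) (s a : ℝ) (k : ℕ)
    (y : Euc c) : iteratedFDeriv ℝ k (pert W x s a) y =
      iteratedFDeriv ℝ k (id : Euc c → Euc c) y +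
        (a * s * (s⁻¹) ^ k) • iteratedFDeriv ℝ k W (s⁻¹ • (y - x)) := by
  have hk : ((k : ℕ) : WithTop ℕ∞) ≤ ((⊤ : ℕ∞) : WithTop ℕ∞) := by exact_mod_cast le_top
  have h1 : ContDiff ℝ k fun y : Euc c => W (s⁻¹ • (y - x)) :=
    (hW.of_le hk).comp ((contDiff_id.sub contDiff_const).const_smul _)
  have h2 : pert W x s a = id + (a * s) • fun y => W (s⁻¹ • (y - x)) := rfl
  have h1' : ContDiff ℝ k ((a * s) • fun y : Euc c => W (s⁻¹ • (y - x))) :=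
    contDiff_const.smul h1
  rw [h2, iteratedFDeriv_add_apply contDiff_id.contDiffAt h1'.contDiffAt,
    iteratedFDeriv_const_smul_apply h1.contDiffAt, mul_smul (a * s)]
  refine congrArg (fun T => iteratedFDeriv ℝ k (id : Euc c → Euc c) y + (a * s) • T) ?_
  have h3 : (fun y : Euc c => W (s⁻¹ • (y - x))) =
      fun y => (fun z => W ((s⁻¹ • ContinuousLinearMap.id ℝ (Euc c)) z)) (y - x) := rfl
  rw [h3, iteratedFDeriv_comp_sub (𝕜 := ℝ)
    (f := fun z => W ((s⁻¹ • ContinuousLinearMap.id ℝ (Euc c)) z)) k x]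
  have h4 := ContinuousLinearMap.iteratedFDeriv_comp_right
    (s⁻¹ • ContinuousLinearMap.id ℝ (Euc c)) hW (y - x) hk
  have h5 : (fun z => W ((s⁻¹ • ContinuousLinearMap.id ℝ (Euc c)) z)) =
    W ∘ (s⁻¹ • ContinuousLinearMap.id ℝ (Euc c)) := rfl
  rw [h5, h4]
  ext m
  simp only [ContinuousMultilinearMap.compContinuousLinearMap_apply,
    _root_.smul_apply, ContinuousLinearMap.id_apply]
  rw [ContinuousMultilinearMap.map_smul_univ]
  simp

/-- The rescaled argument has no limit at `ε = 0`, but `G` is bounded and `h` tends to 0. -/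
theorem continuous_smul_rescale {F : Type*} [NormedAddCommGroup F] [NormedSpace ℝ F]
    {h : ℝ≥0 → ℝ} (hh : Continuous h) (h0 : h 0 = 0) {G : Euc c → F} (hG : Continuous G) {C : ℝ}
    (hC : ∀ z, ‖G z‖ ≤ C) (x : Euc c) :
    Continuous fun p : ℝ≥0 × Euc c => h p.1 • G ((p.1 : ℝ)⁻¹ • (p.2 - x)) := by
  rw [continuous_iff_continuousAt]
  rintro ⟨ε, y⟩
  by_cases hε : ε = 0
  · subst hε
    rw [ContinuousAt]
    dsimp only
    rw [h0, zero_smul]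
    refine squeeze_zero_norm (a := fun p : ℝ≥0 × Euc c => |h p.1| * C) (fun p => ?_) ?_
    · rw [norm_smul, Real.norm_eq_abs]
      exact mul_le_mul_of_nonneg_left (hC _) (abs_nonneg _)
    · have : Continuous fun p : ℝ≥0 × Euc c => |h p.1| * C := by fun_prop
      have h2 := this.tendsto ((0 : ℝ≥0), y)
      simpa [h0] using h2
  · have hε' : (ε : ℝ) ≠ 0 := by exact_mod_cast hε
    have hh1 : ContinuousAt (fun p : ℝ≥0 × Euc c => h p.1) (ε, y) :=
      (hh.comp continuous_fst).continuousAt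
    have hh2 : ContinuousAt (fun p : ℝ≥0 × Euc c => (p.1 : ℝ)) (ε, y) :=
      (NNReal.continuous_coe.comp continuous_fst).continuousAt
    have hh3 : ContinuousAt (fun p : ℝ≥0 × Euc c => p.2 - x) (ε, y) :=
      (continuous_snd.sub continuous_const).continuousAt
    have hh4 : ContinuousAt (fun p : ℝ≥0 × Euc c => (p.1 : ℝ)⁻¹ • (p.2 - x)) (ε, y) :=
      (hh2.inv₀ hε').smul hh3
    exact hh1.smul (ContinuousAt.comp (g := G)
      (f := fun p : ℝ≥0 × Euc c => (p.1 : ℝ)⁻¹ • (p.2 - x)) hG.continuousAt hh4)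

/-- The amplitude of the perturbation: flat at zero and at most `a₀`. -/
noncomputable def amp (a₀ : ℝ) (ε : ℝ≥0) : ℝ := a₀ * expNegInvGlue ε

theorem expNegInvGlue_le_one (t : ℝ) : expNegInvGlue t ≤ 1 := by
  rw [expNegInvGlue]
  split_ifs with h
  · exact zero_le_one
  · exact Real.exp_le_one_iff.2 (neg_nonpos.2 (inv_nonneg.2 (not_le.1 h).le))

/-- For `u = t⁻¹ > 0` this is `u ≤ exp u`. -/
theorem expNegInvGlue_mul_inv_le_one (t : ℝ) : expNegInvGlue t * t⁻¹ ≤ 1 := by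
  rw [expNegInvGlue]
  split_ifs with h
  · simp
  · have h1 := Real.add_one_le_exp t⁻¹
    rw [Real.exp_neg, inv_mul_le_iff₀ (Real.exp_pos _)]
    linarith

theorem continuous_amp_mul_inv_pow (a₀ : ℝ) (k : ℕ) :
    Continuous fun ε : ℝ≥0 => amp a₀ ε * ε * ((ε : ℝ)⁻¹) ^ k := by
  have h1 := (expNegInvGlue.continuous_polynomial_eval_inv_mul
    (Polynomial.X ^ k)).comp NNReal.continuous_coe
  have h2 : Continuous fun ε : ℝ≥0 => a₀ * (ε : ℝ) * ((ε : ℝ)⁻¹ ^ k * expNegInvGlue ε) := by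
    refine (continuous_const.mul NNReal.continuous_coe).mul ?_
    simpa [Function.comp_def] using h1
  refine h2.congr fun ε => ?_
  rw [amp]; ring

/-- The rescaled perturbations form an arc of diffeomorphisms that starts at the identity. -/
theorem exists_arc (hW : ContDiff ℝ (⊤ : ℕ∞) W) (hsupp : HasCompactSupport W)
    (hC : IsBoundedField W C) {a₀ : ℝ} (ha₀ : 0 ≤ a₀) (haC : a₀ * C ≤ 1 / 2) (x : Euc c)
    (r : ℕ∞) : ∃ φ : ℝ≥0 → Diffeo c r, IsArcFromId φ ∧
      ∀ ε, (φ ε : Euc c → Euc c) = pert W x ε (amp a₀ ε) := by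
  have hC0 : 0 ≤ C := (norm_nonneg _).trans (hC.norm_fderiv_le 0)
  have hamp : ∀ ε, 0 ≤ amp a₀ ε := fun ε => mul_nonneg ha₀ (expNegInvGlue.nonneg _)
  have hampC : ∀ ε, amp a₀ ε * C ≤ 1 / 2 := fun ε => by
    refine le_trans (mul_le_mul_of_nonneg_right ?_ hC0) haC
    exact mul_le_of_le_one_right ha₀ (expNegInvGlue_le_one _)
  choose φ hφ using fun ε : ℝ≥0 => exists_diffeo_of_fderiv_near_id
    (contDiff_pert hW x ε (amp a₀ ε))
    (norm_fderiv_pert_sub_id_le hC (hamp ε) ε.2 (hampC ε) x) r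
  have hφ' : ∀ ε, (φ ε : Euc c → Euc c) = pert W x ε (amp a₀ ε) := fun ε => funext (hφ ε)
  refine ⟨φ, ⟨fun k _ => ?_, fun y => ?_⟩, hφ'⟩
  · have hk : ((k : ℕ) : WithTop ℕ∞) ≤ ((⊤ : ℕ∞) : WithTop ℕ∞) := by exact_mod_cast le_top
    have hWk : Continuous (iteratedFDeriv ℝ k W) := hW.continuous_iteratedFDeriv hk
    obtain ⟨K, hK⟩ := hWk.bounded_above_of_compact_support (hsupp.iteratedFDeriv k)
    have h1 := continuous_smul_rescale (continuous_amp_mul_inv_pow a₀ k) (by simp) hWk hK x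
    have h2 : Continuous fun p : ℝ≥0 × Euc c => iteratedFDeriv ℝ k (id : Euc c → Euc c) p.2 :=
      ((contDiff_id (n := (k : WithTop ℕ∞))).continuous_iteratedFDeriv le_rfl).comp continuous_snd
    refine (h2.add h1).congr fun p => ?_
    rw [hφ', iteratedFDeriv_pert hW]
    rfl
  · rw [hφ']
    simp [pert]

end Pert

end NearIdentity

/-! ## The global vector fields -/

section GlobalField

variable {c : ℕ}

/-- A bump function that equals one on the ball of radius `3 / 10`. -/
noncomputable def bump (c : ℕ) : ContDiffBump (0 : Euc c) where
  rIn := 3 / 10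
  -- More than 1/2, so that the bumps at 0 and `e` together are positive on the whole segment; less
  -- than 7/10, so that each vanishes where the other is known to be 1.
  rOut := 6 / 10
  rIn_pos := by norm_num
  rIn_lt_rOut := by norm_num

theorem bump_eq_one {z : Euc c} (h : ‖z‖ ≤ 3 / 10) : bump c z = 1 :=
  (bump c).one_of_mem_closedBall (by simpa [bump] using h)

theorem bump_eq_zero {z : Euc c} (h : 6 / 10 ≤ ‖z‖) : bump c z = 0 :=
  (bump c).zero_of_le_dist (by simpa [bump] using h)

theorem bump_pos {z : Euc c} (h : ‖z‖ < 6 / 10) : 0 < bump c z :=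
  (bump c).pos_of_mem_ball (by simpa [bump] using h)

/-- The vector field that agrees with a local model near the origin, and with the opposite of
another one near `e`. -/
noncomputable def globalField (ℓ n₁ n₂ : ℕ) (η δ : ℝ) (e : Euc c) (σ : Signs c) (z : Euc c) :
    Euc c :=
  bump c z • field ℓ n₁ η δ σ z - bump c (z - e) • field ℓ n₂ η δ σ (z - e)

variable {ℓ n₁ n₂ : ℕ} {η δ s a : ℝ} {e : Euc c} {σ : Signs c}

theorem contDiff_field (n : ℕ) : ContDiff ℝ (⊤ : ℕ∞) (field ℓ n η δ σ) :=
  (fieldLin ℓ n η σ).contDiff.add contDiff_const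

theorem contDiff_globalField : ContDiff ℝ (⊤ : ℕ∞) (globalField ℓ n₁ n₂ η δ e σ) :=
  ((bump c).contDiff.smul (contDiff_field n₁)).sub
    (((bump c).contDiff.comp (contDiff_id.sub contDiff_const)).smul
      ((contDiff_field n₂).comp (contDiff_id.sub contDiff_const)))

theorem hasCompactSupport_globalField :
    HasCompactSupport (globalField ℓ n₁ n₂ η δ e σ) := by
  have h1 : HasCompactSupport fun z => bump c z • field ℓ n₁ η δ σ z :=
    (bump c).hasCompactSupport.smul_right
  have h2 : HasCompactSupport fun z => bump c z • field ℓ n₂ η δ σ z :=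
    (bump c).hasCompactSupport.smul_right
  exact h1.sub (h2.comp_homeomorph (Homeomorph.subRight e))

theorem globalField_eq_field (he : ‖e‖ = 1) {z : Euc c} (hz : ‖z‖ ≤ 3 / 10) :
    globalField ℓ n₁ n₂ η δ e σ z = field ℓ n₁ η δ σ z := by
  have h := norm_sub_norm_le e z
  rw [norm_sub_rev] at h
  rw [globalField, bump_eq_one hz, bump_eq_zero (by linarith), one_smul, zero_smul, sub_zero]

theorem globalField_eq_neg_field (he : ‖e‖ = 1) {z : Euc c} (hz : ‖z‖ ≤ 3 / 10) :
    globalField ℓ n₁ n₂ η δ e σ (e + z) = -field ℓ n₂ η δ σ z := by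
  have h := norm_sub_norm_le e (-z)
  rw [sub_neg_eq_add, norm_neg] at h
  rw [globalField, add_sub_cancel_left, bump_eq_one hz, bump_eq_zero (by linarith), one_smul,
    zero_smul, zero_sub]

theorem pert_add_smul {W : Euc c → Euc c} (x : Euc c) (hs : s ≠ 0) (a : ℝ) (y : Euc c) :
    pert W x s a (x + s • y) = x + s • (y + a • W y) := by
  rw [pert, add_sub_cancel_left, smul_smul, inv_mul_cancel₀ hs, one_smul, smul_add, smul_smul,
    mul_comm s a, add_assoc]

theorem norm_le_of_mem_ebox {ρ : ℝ} {y : Euc c} (hy : y ∈ ebox c ρ) : ‖y‖ ≤ c * ρ := by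
  refine (norm_le_sum_abs y).trans ((Finset.sum_le_sum fun k _ => (hy k).le).trans_eq ?_)
  simp

theorem isLocalModel_globalField (he : ‖e‖ = 1) (hδ : c * (4 * δ) ≤ 3 / 10) (x : Euc c)
    (hs : s ≠ 0) : IsLocalModel ℓ n₁ η δ a x s (pert (globalField ℓ n₁ n₂ η δ e σ) x s a) σ := by
  intro y hy
  rw [pert_add_smul x hs, globalField_eq_field he ((norm_le_of_mem_ebox hy).trans hδ)]

/-- The minus sign in front of the second bump turns amplitude `a` into `-a`, so one family of maps
serves both regions. -/
theorem isLocalModel_globalField_neg (he : ‖e‖ = 1) (hδ : c * (4 * δ) ≤ 3 / 10) (x : Euc c)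
    (hs : s ≠ 0) :
    IsLocalModel ℓ n₂ η δ (-a) (x + s • e) s (pert (globalField ℓ n₁ n₂ η δ e σ) x s a) σ := by
  intro y hy
  rw [add_assoc, ← smul_add, pert_add_smul x hs,
    globalField_eq_neg_field he ((norm_le_of_mem_ebox hy).trans hδ), smul_neg, neg_smul,
    add_assoc, smul_add s e, ← add_assoc]

theorem image_ebox_subset_ball {ρ : ℝ} {p x : Euc c} (hs : 0 < s) (hp : ‖p - x‖ ≤ s)
    (hρ : c * ρ < 1) : (fun y => p + s • y) '' ebox c ρ ⊆ ball x (2 * s) := by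
  rintro _ ⟨y, hy, rfl⟩
  have h1 := norm_le_of_mem_ebox hy
  have h2 : p + s • y - x = (p - x) + s • y := by abel
  rw [mem_ball, dist_eq_norm, h2]
  refine (norm_add_le _ _).trans_lt ?_
  rw [norm_smul, Real.norm_of_nonneg hs.le]
  nlinarith

end GlobalField

/-! ## The transition -/

section Transition

variable {c : ℕ} {ℓ n₁ n₂ : ℕ} {η δ s a : ℝ} {e : Euc c}

/-- An interval map that moves all points of `(0, 1)` to the right pushes every orbit to `1`. -/
theorem exists_iterate_near_one {g : ℝ → ℝ} (hg : Continuous g)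
    (hlt : ∀ t ∈ Ioo (0 : ℝ) 1, t < g t) (hone : ∀ t ∈ Ioo (0 : ℝ) 1, g t < 1) {t : ℝ}
    (ht : t ∈ Ioo (0 : ℝ) 1) {δ : ℝ} (hδ : 0 < δ) : ∃ n, 1 - δ < g^[n + 1] t ∧ g^[n + 1] t < 1 := by
  have hmem : ∀ n, g^[n] t ∈ Ioo (0 : ℝ) 1 := by
    intro n
    induction n with
    | zero => exact ht
    | succ n ih =>
      rw [Function.iterate_succ_apply']
      exact ⟨ih.1.trans (hlt _ ih), hone _ ih⟩
  have hmono : Monotone fun n => g^[n] t := monotone_nat_of_le_succ fun n => by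
    rw [Function.iterate_succ_apply']
    exact (hlt _ (hmem n)).le
  have hbdd : BddAbove (range fun n => g^[n] t) := ⟨1, by
    rintro _ ⟨n, rfl⟩; exact (hmem n).2.le⟩
  have hlim := tendsto_atTop_ciSup hmono hbdd
  set L := ⨆ n, g^[n] t
  -- The monotone limit is a fixed point in `(0, 1]`, and there is none in `(0, 1)`.
  have hfix : g L = L := isFixedPt_of_tendsto_iterate hlim hg.continuousAt
  have hL0 : 0 < L := ht.1.trans_le (le_ciSup hbdd 0)
  have hL1 : L ≤ 1 := ciSup_le fun n => (hmem n).2.le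
  have hL : L = 1 := by
    by_contra hne
    exact (hlt L ⟨hL0, lt_of_le_of_ne hL1 hne⟩).ne' hfix
  rw [hL] at hlim
  obtain ⟨n, hn⟩ := ((Filter.tendsto_add_atTop_iff_nat 1).2 hlim).eventually
    (lt_mem_nhds (by linarith : 1 - δ < 1)) |>.exists
  exact ⟨n, hn, (hmem _).2⟩

theorem field_zero (n : ℕ) (z : Euc c) (k : Fin c) : field ℓ n η δ 0 z k = rate ℓ n k * z k := by
  have h1 : (shear ℓ n (0 : Signs c)) = 0 := by
    funext p; simp [shear]
  have h2 : (transl ℓ n (0 : Signs c)) = 0 := by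
    ext k; simp [transl]
  have h3 : calL (0 : GrIdx ℓ c → ℝ) = 0 := by simp [calL, opM]
  have h4 : fieldLin ℓ n η (0 : Signs c) = opM (Matrix.diagonal (rate ℓ n)) := by
    rw [fieldLin, h1, h3]
    ext1 v
    simp
  rw [field, h4, h2, smul_zero, add_zero, opM_diagonal_apply]

theorem globalField_zero_mem_botSub (he : e ∈ botSub ℓ c) {z : Euc c} (hz : z ∈ botSub ℓ c) :
    globalField ℓ n₁ n₂ η δ e 0 z ∈ botSub ℓ c := by
  have h : ∀ n, ∀ z ∈ botSub ℓ c, field ℓ n η δ (0 : Signs c) z ∈ botSub ℓ c := by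
    intro n z hz k hk
    rw [field_zero, hz k hk, mul_zero]
  exact Submodule.sub_mem _ (Submodule.smul_mem _ _ (h _ _ hz))
    (Submodule.smul_mem _ _ (h _ _ (Submodule.sub_mem _ hz he)))

/-- Along a line in the affine plane through `x` the field stays in the plane, so the remaining
coordinates of the image are constant and have derivative 0. -/
theorem map_fderiv_pert_botSub {W : Euc c → Euc c} (hW : ContDiff ℝ (⊤ : ℕ∞) W)
    (hbot : ∀ z ∈ botSub ℓ c, W z ∈ botSub ℓ c) (x : Euc c) (s a : ℝ) {y : Euc c}
    (hy : y - x ∈ botSub ℓ c) {v : Euc c} (hv : v ∈ botSub ℓ c) :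
    fderiv ℝ (pert W x s a) y v ∈ botSub ℓ c := by
  intro k hk
  have h1 : HasDerivAt (fun t : ℝ => pert W x s a (y + t • v))
      (fderiv ℝ (pert W x s a) y v) 0 :=
    ((hasFDerivAt_pert hW x s a y).differentiableAt.hasFDerivAt.hasLineDerivAt v)
  have h2 := ((EuclideanSpace.proj (𝕜 := ℝ) k).hasFDerivAt.comp_hasDerivAt 0 h1)
  refine h2.unique ?_
  have h3 : (EuclideanSpace.proj (𝕜 := ℝ) k ∘ fun t : ℝ => pert W x s a (y + t • v)) =
      fun _ => y k := by
    funext t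
    have h4 : s⁻¹ • (y + t • v - x) ∈ botSub ℓ c := by
      refine Submodule.smul_mem _ _ ?_
      rw [add_sub_right_comm]
      exact Submodule.add_mem _ hy (Submodule.smul_mem _ _ hv)
    have h5 := hbot _ h4 k hk
    have h6 := hv k hk
    simp [pert, h5, h6]
  rw [h3]
  exact hasDerivAt_const _ _

theorem graphSub_zero : graphSub (0 : GrIdx ℓ c → ℝ) = botSub ℓ c := by
  have h3 : calL (0 : GrIdx ℓ c → ℝ) = 0 := by simp [calL, opM]
  ext v
  rw [mem_graphSub, h3]
  constructor
  · rintro ⟨u, hu, rfl⟩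
    simpa using hu
  · intro hv
    exact ⟨v, hv, by simp⟩

/-- The speed of the zero-sign field along the axis. -/
noncomputable def axisSpeed (e : Euc c) (t : ℝ) : ℝ :=
  2 * t * bump c (t • e) + 2 * (1 - t) * bump c ((t - 1) • e)

theorem continuous_axisSpeed (e : Euc c) : Continuous (axisSpeed e) := by
  have h := (bump c).continuous
  unfold axisSpeed
  fun_prop

theorem axisSpeed_pos (he : ‖e‖ = 1) {t : ℝ} (ht : t ∈ Ioo (0 : ℝ) 1) : 0 < axisSpeed e t := by
  have h1 : 0 ≤ bump c (t • e) := (bump c).nonneg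
  have h2 : 0 ≤ bump c ((t - 1) • e) := (bump c).nonneg
  have ht0 := ht.1
  have ht1 : 0 < 1 - t := sub_pos.2 ht.2
  rcases lt_or_ge t (6 / 10) with h | h
  · have h3 : 0 < bump c (t • e) := bump_pos (by
      rw [norm_smul, he, mul_one, Real.norm_of_nonneg ht0.le]; exact h)
    exact add_pos_of_pos_of_nonneg (by positivity) (by positivity)
  · have h3 : 0 < bump c ((t - 1) • e) := bump_pos (by
      rw [norm_smul, he, mul_one, Real.norm_eq_abs, abs_sub_comm, abs_of_pos ht1]; linarith)
    exact add_pos_of_nonneg_of_pos (by positivity) (by positivity)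

/-- For `t < 6 / 10` the step is at most `2 * a < 1 / 8`. Beyond, only the second bump acts and the
step is at most `2 * a * (1 - t)`. -/
theorem add_mul_axisSpeed_lt_one (he : ‖e‖ = 1) (ha0 : 0 ≤ a) (ha : a < 1 / 16) {t : ℝ}
    (ht : t ∈ Ioo (0 : ℝ) 1) : t + a * axisSpeed e t < 1 := by
  have h1 : bump c (t • e) ≤ 1 := (bump c).le_one
  have h2 : bump c ((t - 1) • e) ≤ 1 := (bump c).le_one
  obtain ⟨ht0, ht1⟩ := ht
  have h5 : 2 * (1 - t) * bump c ((t - 1) • e) ≤ 2 * (1 - t) :=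
    mul_le_of_le_one_right (by linarith) h2
  rcases lt_or_ge t (6 / 10) with h | h
  · have h4 : 2 * t * bump c (t • e) ≤ 2 * t := mul_le_of_le_one_right (by linarith) h1
    have : axisSpeed e t ≤ 2 := by rw [axisSpeed]; linarith
    nlinarith
  · have h3 : bump c (t • e) = 0 := bump_eq_zero (by
      rw [norm_smul, he, mul_one, Real.norm_of_nonneg ht0.le]; exact h)
    have : axisSpeed e t ≤ 2 * (1 - t) := by rw [axisSpeed, h3]; linarith
    nlinarith

theorem globalField_zero_axis (k₀ : Fin c) (hk₀ : (k₀ : ℕ) < ℓ) (t : ℝ) :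
    globalField ℓ n₁ n₂ η δ (EuclideanSpace.single k₀ 1) 0 (t • EuclideanSpace.single k₀ 1) =
      axisSpeed (EuclideanSpace.single k₀ 1) t • EuclideanSpace.single k₀ (1 : ℝ) := by
  have h : ∀ n (t : ℝ), field ℓ n η δ (0 : Signs c) (t • EuclideanSpace.single k₀ 1) =
      (2 * t) • EuclideanSpace.single k₀ (1 : ℝ) := by
    intro n t
    ext k
    rw [field_zero]
    by_cases hk : k = k₀
    · subst hk
      simp [rate_of_lt hk₀]
    · simp [hk]
  have h1 : t • EuclideanSpace.single k₀ (1 : ℝ) - EuclideanSpace.single k₀ 1 =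
      (t - 1) • EuclideanSpace.single k₀ 1 := by rw [sub_smul, one_smul]
  rw [globalField, h1, h, h, smul_smul, smul_smul, ← sub_smul, axisSpeed]
  congr 1
  ring

/-- With zero signs there is neither shear nor translation, so the plane of the first `ℓ`
coordinates is preserved along the axis and the dynamics is an interval map. -/
theorem hatPerm_hatChart_axis {r : ℕ∞} (hr : 2 ≤ r) (hℓ : ℓ ≤ c) (k₀ : Fin c)
    (hk₀ : (k₀ : ℕ) < ℓ) (x : Euc c) (hs : s ≠ 0) {f : Diffeo c r}
    (hf : (f : Euc c → Euc c) =
      pert (globalField ℓ n₁ n₂ η δ (EuclideanSpace.single k₀ 1) 0) x s a) (t : ℝ) :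
    hatPerm hr ℓ f (hatChart hℓ x s (t • EuclideanSpace.single k₀ 1, 0)) =
      hatChart hℓ x s ((t + a * axisSpeed (EuclideanSpace.single k₀ 1) t) •
        EuclideanSpace.single k₀ 1, 0) := by
  have he : EuclideanSpace.single k₀ (1 : ℝ) ∈ botSub ℓ c := by
    intro k hk
    have : k ≠ k₀ := by rintro rfl; exact hk hk₀
    simp [this]
  refine Prod.ext ?_ (Subtype.ext ?_)
  · change f (x + s • t • EuclideanSpace.single k₀ 1) = x + s • _
    rw [hf, pert_add_smul x hs, globalField_zero_axis k₀ hk₀, add_smul, mul_smul a]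
  · change (graphSub 0).map (fderiv ℝ f (x + s • t • EuclideanSpace.single k₀ 1) :
      Euc c →ₗ[ℝ] Euc c) = graphSub 0
    refine Submodule.eq_of_le_of_finrank_eq ?_ (Diffeo.finrank_map_fderiv hr f _ _)
    rw [graphSub_zero, Submodule.map_le_iff_le_comap]
    intro v hv
    change fderiv ℝ f _ v ∈ botSub ℓ c
    rw [hf]
    refine map_fderiv_pert_botSub contDiff_globalField
      (fun z hz => globalField_zero_mem_botSub he hz) x s a ?_ hv
    rw [add_sub_cancel_left]
    exact Submodule.smul_mem _ _ (Submodule.smul_mem _ _ he)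

theorem Subsemigroup.pow_succ_mem {G : Type*} [Monoid G] (S : Subsemigroup G) {g : G} (hg : g ∈ S)
    (n : ℕ) : g ^ (n + 1) ∈ S := by
  induction n with
  | zero => simpa using hg
  | succ n ih =>
    rw [pow_succ]
    exact S.mul_mem ih hg

/-- Start at parameter `δ / 2`, inside the first box, with the horizontal plane `L = 0`, and iterate
the zero-sign map until the parameter is in `(1 - δ, 1)`, inside the second box. -/
theorem hasTransition_globalField {d : ℕ} {r : ℕ∞} (hr : 2 ≤ r) (hℓ : ℓ ≤ c) (k₀ : Fin c)
    (hk₀ : (k₀ : ℕ) < ℓ) (x : Euc c) (hs : s ≠ 0) (ha0 : 0 < a) (ha : a < 1 / 16) (hη : 0 < η)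
    (hδ : 0 < δ) (hδ1 : δ < 1) {φ : Fin d → Diffeo c r} (j : Fin d)
    (hf : (φ j : Euc c → Euc c) =
      pert (globalField ℓ n₁ n₂ η δ (EuclideanSpace.single k₀ 1) 0) x s a) :
    HasTransition (fun i => hatPerm hr ℓ (φ i)) (hatChart hℓ x s '' (ebox c δ ×ˢ box η))
      (hatChart hℓ (x + s • EuclideanSpace.single k₀ 1) s '' (ebox c δ ×ˢ box η)) := by
  have he : ‖EuclideanSpace.single k₀ (1 : ℝ)‖ = 1 := by simp
  set g : ℝ → ℝ := fun t => t + a * axisSpeed (EuclideanSpace.single k₀ 1) t with hg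
  have hit : ∀ n t, (hatPerm hr ℓ (φ j))^[n] (hatChart hℓ x s (t • EuclideanSpace.single k₀ 1, 0)) =
      hatChart hℓ x s (g^[n] t • EuclideanSpace.single k₀ 1, 0) := by
    intro n
    induction n with
    | zero => intro t; rfl
    | succ n ih =>
      intro t
      rw [Function.iterate_succ_apply, Function.iterate_succ_apply,
        hatPerm_hatChart_axis hr hℓ k₀ hk₀ x hs hf, ih]
  have hbox : ∀ t : ℝ, |t| < δ → t • EuclideanSpace.single k₀ (1 : ℝ) ∈ ebox c δ := by
    intro t ht k
    refine (abs_apply_le_norm _ k).trans_lt ?_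
    rwa [norm_smul, he, mul_one, Real.norm_eq_abs]
  obtain ⟨n, hn1, hn2⟩ := exists_iterate_near_one (g := g)
    (continuous_id.add (continuous_const.mul (continuous_axisSpeed _)))
    (fun t ht => lt_add_of_pos_right _ (mul_pos ha0 (axisSpeed_pos he ht)))
    (fun t ht => add_mul_axisSpeed_lt_one he ha0.le ha ht) (t := δ / 2)
    ⟨by linarith, by linarith⟩ hδ
  refine ⟨_, ⟨((δ / 2) • EuclideanSpace.single k₀ 1, 0), ⟨hbox _ ?_, zero_mem_box hη⟩, rfl⟩,
    hatPerm hr ℓ (φ j) ^ (n + 1),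
    Subsemigroup.pow_succ_mem _ (Subsemigroup.subset_closure (mem_range_self j)) n,
    ((g^[n + 1] (δ / 2) - 1) • EuclideanSpace.single k₀ 1, 0), ⟨hbox _ ?_, zero_mem_box hη⟩, ?_⟩
  · rw [abs_of_pos (by linarith)]; linarith
  · rw [abs_lt]; constructor <;> linarith
  · rw [← Equiv.Perm.iterate_eq_pow, hit]
    refine Prod.ext ?_ rfl
    change x + s • _ + s • _ = x + s • _
    rw [add_assoc, ← smul_add, sub_smul, one_smul, add_sub_cancel]

end Transition

theorem mainTheorem10 (c : ℕ) :
    ∃ d : ℕ, 2 ≤ d ∧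
      ∀ (i₁ i₂ ℓ : ℕ), 0 < i₁ → i₁ < c → 0 < i₂ → i₂ < c →
      max 0 ((i₂ : ℤ) - i₁) < ℓ → (ℓ : ℤ) ≤ min ((c : ℤ) - i₁) i₂ →
      ∀ (r : ℕ∞) (hr : 2 ≤ r) (ν α : ℝ), 0 < ν → ν < 1 → 0 < α →
      ∀ x : Euc c,
      ∃ φ : Fin d → ℝ≥0 → Diffeo c r,
        (∀ i, IsArcFromId (φ i)) ∧
        ∀ ε : ℝ≥0, 0 < ε →
          IsFiberBunched ν α (fun i => (φ i ε).toEquiv) ∧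
          ∃ (B₁ D₁ B₂ D₂ : Set (Euc c)) (Bh₁ Bh₂ : Set (Euc c × Gr ℓ c)),
            D₁ ⊆ ball x (2 * ε) ∧ D₂ ⊆ ball x (2 * ε) ∧
            IsCsBlendingRegion ν α (id : Euc c → Euc c) (fun i => (φ i ε).toEquiv) B₁ D₁ i₁ ∧
            IsCsTangency hr ν α ℓ (fun i => φ i ε) B₁ Bh₁ ∧
            IsCuBlendingRegion ν α (id : Euc c → Euc c) (fun i => (φ i ε).toEquiv) B₂ D₂ i₂ ∧
            IsCuTangency hr ν α ℓ (fun i => φ i ε) B₂ Bh₂ ∧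
            HasTransition (fun i => hatPerm hr ℓ (φ i ε)) Bh₁ Bh₂ := by
  rcases Nat.eq_zero_or_pos c with rfl | hc
  -- No admissible indices exist in dimension zero.
  · exact ⟨2, le_rfl, fun i₁ _ _ h0 h1 => by omega⟩
  let k₀ : Fin c := ⟨0, hc⟩
  have hcard : 2 ≤ Fintype.card (Signs c) := by
    have : Nontrivial (Signs c) := ⟨(0, 0), (1, 0), fun h => by
      have := congrFun (congrArg Prod.fst h) k₀
      simp at this⟩
    exact Fintype.one_lt_card
  refine ⟨_, hcard, fun i₁ i₂ ℓ hi₁ hi₁c hi₂ hi₂c hl1 hl2 r hr ν α hν0 hν1 hα x => ?_⟩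
  let σ : Fin (Fintype.card (Signs c)) → Signs c := (Fintype.equivFin (Signs c)).symm
  have hσ : Function.Surjective σ := (Fintype.equivFin (Signs c)).symm.surjective
  have : Nonempty (Fin (Fintype.card (Signs c))) := ⟨⟨0, by omega⟩⟩
  have hℓ0 : 0 < ℓ := by omega
  have hℓ1 : ℓ + i₁ ≤ c := by omega
  have hℓ2 : ℓ + (c - i₂) ≤ c := by omega
  have hℓ : ℓ ≤ c := by omega
  have hn2 : 0 < c - i₂ := by omega
  have hcc : c - (c - i₂) = i₂ := by omega
  have hc1 : (1 : ℝ) ≤ c := by exact_mod_cast hc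
  -- Makes the shear at most a tenth of the vector it acts on.
  set η : ℝ := 1 / (60 * (c : ℝ) ^ 2) with hη_def
  -- The box of radius `4 * δ` has norm at most 1/5, inside the ball of radius 3/10 where the bump
  -- is 1.
  set δ : ℝ := 1 / (20 * c) with hδ_def
  have hη : 0 < η := by positivity
  have hη' : 60 * (c : ℝ) ^ 2 * η ≤ 1 := (mul_one_div_cancel (by positivity)).le
  have hδ : 0 < δ := by positivity
  have hcδ : c * δ = 1 / 20 := by rw [hδ_def]; field_simp
  have hδ1 : δ < 1 := by nlinarith
  -- The coordinate 0 is among the first `ℓ`, so the axis lies in the plane to be transported.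
  set e : Euc c := EuclideanSpace.single k₀ 1 with he_def
  have he : ‖e‖ = 1 := by simp [he_def]
  let W : Fin (Fintype.card (Signs c)) → Euc c → Euc c := fun i =>
    globalField ℓ i₁ (c - i₂) η δ e (σ i)
  have hW : ∀ i, ContDiff ℝ (⊤ : ℕ∞) (W i) := fun i => contDiff_globalField
  have hsupp : ∀ i, HasCompactSupport (W i) := fun i => hasCompactSupport_globalField
  choose C hC using fun i => exists_isBoundedField (hW i) (hsupp i)
  have hC0 : ∀ i, 0 ≤ C i := fun i => (norm_nonneg _).trans ((hC i).norm_fderiv_le 0)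
  have hCle : ∀ i, C i ≤ ∑ j, C j := fun i =>
    Finset.single_le_sum (fun j _ => hC0 j) (Finset.mem_univ i)
  set q : ℝ := ν ^ α with hq_def
  have hq0 : 0 < q := Real.rpow_pos_of_pos hν0 α
  have hq1 : q < 1 := Real.rpow_lt_one hν0.le hν1 hα
  set Ct : ℝ := ∑ j, C j with hCt
  have hCt0 : 0 ≤ Ct := Finset.sum_nonneg fun j _ => hC0 j
  -- The first term keeps all maps within `(1 - q) / 200` of the identity, with `+ 1` against
  -- division by zero; the second gives `a < 1 / 16`.
  set a₀ : ℝ := min ((1 - q) / 200 / (Ct + 1)) (1 / 32) with ha₀_def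
  have ha₀ : 0 < a₀ := lt_min (div_pos (by linarith) (by linarith)) (by norm_num)
  have ha₀C : ∀ i, a₀ * C i ≤ (1 - q) / 200 := by
    intro i
    calc a₀ * C i ≤ (1 - q) / 200 / (Ct + 1) * (Ct + 1) :=
          mul_le_mul (min_le_left _ _) (by linarith [hCle i]) (hC0 i)
            (div_nonneg (by linarith) (by linarith))
      _ = _ := div_mul_cancel₀ _ (by linarith)
  choose φ hφ hφ' using fun i => exists_arc (hW i) (hsupp i) (hC i) ha₀.le
    ((ha₀C i).trans (by linarith)) x r
  refine ⟨φ, hφ, fun ε hε => ?_⟩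
  have hs0 : (0 : ℝ) < ε := hε
  set a : ℝ := amp a₀ ε with ha_def
  have ha0 : 0 < a := mul_pos ha₀ (expNegInvGlue.pos_of_pos hs0)
  have ha1 : a < 1 / 16 :=
    ((mul_le_of_le_one_right ha₀.le (expNegInvGlue_le_one _)).trans (min_le_right _ _)).trans_lt
      (by norm_num)
  have haC : ∀ i, a * C i ≤ (1 - q) / 200 := fun i =>
    (mul_le_mul_of_nonneg_right (mul_le_of_le_one_right ha₀.le (expNegInvGlue_le_one _))
      (hC0 i)).trans (ha₀C i)
  -- Decay of the amplitude absorbs the factor `ε⁻¹` of the second derivative, uniformly in `ε`.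
  have haC' : ∀ i, a * (ε : ℝ)⁻¹ * C i ≤ (1 - q) / 200 := fun i => by
    refine (mul_le_mul_of_nonneg_right ?_ (hC0 i)).trans (ha₀C i)
    rw [ha_def, amp, mul_assoc]
    exact mul_le_of_le_one_right ha₀.le (expNegInvGlue_mul_inv_le_one _)
  obtain ⟨hPH, hPHhat⟩ := hasPHBounds_of_near_id hr ℓ (fun i => φ i ε) hq0 hq1 hq_def.symm
    (fun i y => by
      rw [hφ']; exact norm_fderiv_pert_sub_id_le (hC i) ha0.le hs0.le (haC i) x y)
    (fun i y y' => by
      rw [hφ']; exact norm_fderiv_pert_sub_le (hC i) ha0.le hs0.le (haC' i) x y y')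
  have hδ4 : c * (4 * δ) ≤ 3 / 10 := by linarith
  have hloc₁ : ∀ i, IsLocalModel ℓ i₁ η δ a x ε (φ i ε) (σ i) := fun i => by
    rw [hφ']; exact isLocalModel_globalField he hδ4 x hs0.ne'
  have hloc₂ : ∀ i, IsLocalModel ℓ (c - i₂) η δ (-a) (x + (ε : ℝ) • e) ε (φ i ε) (σ i) :=
    fun i => by rw [hφ']; exact isLocalModel_globalField_neg he hδ4 x hs0.ne'
  have hcu := isCuBlendingRegion_model hs0.ne' (neg_lt_zero.2 ha0) (neg_lt_neg ha1) hη hη' hδ hn2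
    hℓ2 hσ hloc₂ ⟨_, _, hPH⟩
  rw [hcc] at hcu
  obtain ⟨j, hj⟩ := hσ 0
  -- Fibre bunching is `((1 + q) / 2) ^ 2 > q`, that is, `(1 - q) ^ 2 > 0`.
  refine ⟨⟨_, _, hPH, by nlinarith⟩, _, _, _, _, _, _,
    image_ebox_subset_ball hs0 ?_ ?_, image_ebox_subset_ball hs0 ?_ ?_,
    isCsBlendingRegion_model hs0.ne' ha0 ha1 hη hη' hδ hi₁ hℓ1 hσ hloc₁ ⟨_, _, hPH⟩,
    isCsTangency_model hr hs0.ne' ha0 ha1 hη hη' hδ hi₁ hℓ hℓ1 hσ hloc₁ ⟨_, _, hPHhat⟩, hcu,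
    isCuTangency_model hr hs0.ne' (neg_lt_zero.2 ha0) (neg_lt_neg ha1) hη hη' hδ hn2 hℓ hℓ2 hσ
      hloc₂ ⟨_, _, hPHhat⟩,
    hasTransition_globalField (n₁ := i₁) (n₂ := c - i₂) hr hℓ k₀ hℓ0 x hs0.ne' ha0 ha1 hη hδ
      hδ1 j ?_⟩
  · simp
  · linarith
  · rw [add_sub_cancel_left, norm_smul, he, mul_one, Real.norm_of_nonneg hs0.le]
  · linarith
  · rw [hφ', ← hj]
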